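/- **Setting.** Let $n,m\ge 1$, $A\in\mathbb R^{n\times n}$ with $A\neq 0$, $B\in\mathbb R^{n\times m}$, $(A,B)$ stabilizable, and let $Q\in\mathbb R^{n\times n}$, $R\in\mathbb R^{m\times m}$ be symmetric positive definite. Consider $x_{t+1}=Ax_t+Bu_t$ with stage cost $x^\top Qx+u^\top Ru$. For a matrix $P$ put $K(P)=(R+B^\top PB)^{-1}B^\top PA$. Let $P^*$ be the positive definite solution of the algebraic Riccati equation $P=A^\top PA-A^\top PB(R+B^\top PB)^{-1}B^\top PA+Q$, $K^*=K(P^*)$, $A_K^*=A-BK^*$, and fix a terminal cost matrix $Q_N\succeq P^*$. Write $\|\cdot\|$ for the spectral norm, $\kappa$ for the condition number, and $\|X\|_*^2=\sup_{z\ne0}\frac{z^\top X^\top P^*Xz}{z^\top P^*z}$. The initial state has a law $\mathcal D$ with mean $0$, covariance $\Sigma_0\succ0$, and $\|x_0\|^2\le C_m$ almost surely. For $\varepsilon>0$ let $$N=\left\lceil\frac12\,\frac{\log\big(2\|Q_N-P^*\|_*\,\kappa_{P^*}\|A_K^*\|\,\|B\|/(\varepsilon\lambda_{\min}(R))\big)}{\log(1/\|A_K^*\|_*)}\right\rceil+1$$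 (the ceiling being replaced by $0$ if it is negative or if the argument of the outer logarithm is $0$). Let $P^*_N=Q_N$ and, for $t<N$, $K_t^*=K(P^*_{t+1})$, $P^*_t=(A-BK_t^*)^\top P^*_{t+1}(A-BK_t^*)+K_t^{*\top}RK_t^*+Q$. Put $a=\sigma_{\min}(Q)/2$, $\varphi=\max_{0\le t<N}\|A-BK_t^*\|$, and $$C_1=\frac{\varphi\|B\|}{\lambda_{\min}(R)},\quad C_2=2\varphi\|A\|\Big(1+\frac{\|Q_N+aI\|\|B\|^2}{\lambda_{\min}(R)}\Big),\quad C_3=2\|R+B^\top(Q_N+aI)B\|.$$ The (corrected) stage-wise accuracies are $e_0=\varepsilon/4$, $e_1=\min\{\sqrt{a/C_3},\frac12\sqrt{\varepsilon/(C_1C_3)}\}$, and $e_h=\min\{\sqrt{a/C_3},\sqrt{a/(C_2^{h-2}C_3)},\frac12\sqrt{\varepsilon/(C_1C_2^{h-2}C_3)}\}$ for $2\le h\le N-1$. **Algorithm (receding-horizon policy gradient of Zhang and Başar, with two-point gradient estimates).** For $h=N-1,\dots,0$: start from a gain $K_{h,0}$ and, for $i=0,\dots,T'_h-1$, draw independently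 $x_0\sim\mathcal D$ and $U$ uniform on the Frobenius unit sphere of $\mathbb R^{m\times n}$, and set $$K_{h,i+1}=K_{h,i}-\alpha_{h,i}\,\frac{mn}{2r_h}\Big[\widetilde J_h(K_{h,i}+r_hU;x_0)-\widetilde J_h(K_{h,i}-r_hU;x_0)\Big]U;$$ then let $\widetilde K_h=K_{h,T'_h}$. Here $\widetilde J_h(K;x_0)$ is the cost of the trajectory of length $N-h$ from $x_0$ that uses $u_0=-Kx_0$ and then $u_i=-\widetilde K_{h+i}x_i$, with terminal cost $x_{N-h}^\top Q_Nx_{N-h}$. Let $\widetilde J_h(K)=\mathbb E_{x_0\sim\mathcal D}\widetilde J_h(K;x_0)$ and let $\widetilde K_h^*$ be its minimizer. The initial gain $K_{h,0}$ is an arbitrary measurable function $\iota_h$ of $\widetilde K_{h+1}$ (with $\widetilde K_N:=0$) such that $\|\iota_h(K)\|\le\max\{M,\|K\|\}$ for all $K$, where $M$ is fixed; constants and the warm start $K_{h,0}=\widetilde K_{h+1}$ are allowed. The sample complexity is $\sum_{h=0}^{N-1}T'_h$. **Claim 1.** For every such problem, every $\delta\in(0,1)$ and every $M$ there are $c,C>0$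 and $p,q\in\mathbb N$ such that for all sufficiently small $\varepsilon>0$ the following holds with $T'_h=\lceil c\,e_h^{-2}\log^p(1/\varepsilon)\rceil$. There are stepsizes $\alpha_{h,i}>0$ and radii $r_h>0$ such that, for every initialization rule as above, with probability at least $1-\delta$ one has $\|\widetilde K_h-\widetilde K_h^*\|\le e_h$ for all $0\le h<N$ and $\|\widetilde K_0-K^*\|\le\varepsilon$; and $$\sum_{h=0}^{N-1}T'_h\;\le\;C\,\log^q(1/\varepsilon)\,\max\Big\{\varepsilon^{-2},\ \varepsilon^{-\left(1+\frac{\log C_2}{2\log(1/\|A_K^*\|_*)}\right)}\Big\}.$$ That is, the algorithm has sample complexity at most $\widetilde{\mathcal O}\big(\max\{\varepsilon^{-2},\varepsilon^{-(1+\log C_2/(2\log(1/\|A_K^*\|_*)))}\}\big)$. **Claim 2.** This can be arbitrarily worse than $\varepsilon^{-2}$: for every $M\in\mathbb R$ there is a problem as above, with $A$ invertible and $B\neq0$, such that for all sufficiently small $\varepsilon>0$ the maximum above is at least $\varepsilon^{-M}$; and for all $c>0$, $p\in\mathbb N$, the prescribed budget $\sum_{h<N}\lceil c\,e_h^{-2}\log^p(1/\varepsilon)\rceil$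 is also at least $\varepsilon^{-M}$ for all sufficiently small $\varepsilon>0$. -/

import Mathlib

open MeasureTheory Filter Topology
-- On matrices, `‖X‖` is the spectral norm (the operator 2-norm).
open scoped Matrix Matrix.Norms.L2Operator

noncomputable section

namespace RHPG

/-! ### Matrix quantities -/

/-- Smallest eigenvalue of a symmetric real matrix. -/
def lamMin {k : ℕ} (X : Matrix (Fin k) (Fin k) ℝ) : ℝ := sInf (spectrum ℝ X)

/-- Smallest singular value of a square real matrix. -/
def sigmaMin {k : ℕ} (X : Matrix (Fin k) (Fin k) ℝ) : ℝ := Real.sqrt (lamMin (Xᵀ * X))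

/-- Condition number with respect to the spectral norm. -/
def condNum {k : ℕ} (X : Matrix (Fin k) (Fin k) ℝ) : ℝ := ‖X‖ * ‖X⁻¹‖

/-- The norm of `X` induced by the positive definite matrix `W`:
`‖X‖_W² = sup_{z ≠ 0} (zᵀ Xᵀ W X z) / (zᵀ W z)`. -/
def inducedNorm {k : ℕ} (W X : Matrix (Fin k) (Fin k) ℝ) : ℝ :=
  Real.sqrt (⨆ z : {z : Fin k → ℝ // z ≠ 0},
    ((X *ᵥ z.1) ⬝ᵥ (W *ᵥ (X *ᵥ z.1))) / (z.1 ⬝ᵥ (W *ᵥ z.1)))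

/-! ### The linear quadratic regulator -/

/-- Data of a discrete-time LQR problem with `n` states and `m` inputs:
dynamics `x_{t+1} = A x_t + B u_t`, stage cost `xᵀ Q x + uᵀ R u`, and the terminal cost matrix
`Q_N` of the finite-horizon problems. -/
structure LQR (n m : ℕ) where
  A : Matrix (Fin n) (Fin n) ℝ
  B : Matrix (Fin n) (Fin m) ℝ
  Q : Matrix (Fin n) (Fin n) ℝ
  R : Matrix (Fin m) (Fin m) ℝ
  QN : Matrix (Fin n) (Fin n) ℝ

namespace LQR

variable {n m : ℕ} (S : LQR n m)

/-- Closed-loop matrix `A - B K` of the feedback `u = -K x`. -/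
def closedLoop (K : Matrix (Fin m) (Fin n) ℝ) : Matrix (Fin n) (Fin n) ℝ := S.A - S.B * K

/-- `(A, B)` is stabilizable: for some gain all eigenvalues of `A - B K` lie in the open unit
disc. -/
def Stabilizable : Prop :=
  ∃ K : Matrix (Fin m) (Fin n) ℝ,
    ∀ z ∈ spectrum ℂ ((S.closedLoop K).map Complex.ofReal), ‖z‖ < 1

/-- The gain `(R + Bᵀ P B)⁻¹ Bᵀ P A`. -/
def gain (P : Matrix (Fin n) (Fin n) ℝ) : Matrix (Fin m) (Fin n) ℝ :=
  (S.R + S.Bᵀ * P * S.B)⁻¹ * S.Bᵀ * P * S.A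

/-- Cost matrix obtained by one step with gain `K` followed by the cost-to-go `P`:
`(A - B K)ᵀ P (A - B K) + Kᵀ R K + Q`. -/
def costStep (K : Matrix (Fin m) (Fin n) ℝ) (P : Matrix (Fin n) (Fin n) ℝ) :
    Matrix (Fin n) (Fin n) ℝ :=
  (S.closedLoop K)ᵀ * P * S.closedLoop K + Kᵀ * S.R * K + S.Q

/-- The discrete-time algebraic Riccati equation. -/
def IsARESolution (P : Matrix (Fin n) (Fin n) ℝ) : Prop :=
  P = S.Aᵀ * P * S.A
      - S.Aᵀ * P * S.B * (S.R + S.Bᵀ * P * S.B)⁻¹ * S.Bᵀ * P * S.A + S.Q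

/-- Standing assumptions; `P` is the positive definite solution `P*` of the algebraic Riccati
equation. The condition `A ≠ 0` says that the closed-loop matrix `A - B K*` is non-zero, so that
`log (1 / ‖A - B K*‖_*)` is meaningful. -/
structure Admissible (P : Matrix (Fin n) (Fin n) ℝ) : Prop where
  posDef_Q : S.Q.PosDef
  posDef_R : S.R.PosDef
  stabilizable : S.Stabilizable
  posDef_P : P.PosDef
  are : S.IsARESolution P
  terminal : (S.QN - P).PosSemidef
  A_ne_zero : S.A ≠ 0

/-- Solution of the Riccati difference equation after `k` backward steps from `Q_N`, so that
`P*_t = rde (N - t)`. -/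
def rde : ℕ → Matrix (Fin n) (Fin n) ℝ
  | 0 => S.QN
  | k + 1 => S.costStep (S.gain (rde k)) (rde k)

/-- The finite-horizon optimal gains `K*_t = (R + Bᵀ P*_{t+1} B)⁻¹ Bᵀ P*_{t+1} A`, `t < N`. -/
def finiteGain (N t : ℕ) : Matrix (Fin m) (Fin n) ℝ := S.gain (S.rde (N - (t + 1)))

/-! ### Constants, horizon, tolerances, iteration counts -/

/-- `a = σ_min(Q) / 2`. -/
def a : ℝ := sigmaMin S.Q / 2

/-- `φ = max_{0 ≤ t ≤ N-1} ‖A - B K*_t‖`. -/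
def phi (N : ℕ) : ℝ := ⨆ t : Fin N, ‖S.closedLoop (S.finiteGain N t)‖

/-- `C₁`. -/
def C1 (N : ℕ) : ℝ := S.phi N * ‖S.B‖ / lamMin S.R

/-- `C₂`. -/
def C2 (N : ℕ) : ℝ :=
  2 * S.phi N * ‖S.A‖ * (1 + ‖S.QN + S.a • (1 : Matrix (Fin n) (Fin n) ℝ)‖ * ‖S.B‖ ^ 2 / lamMin S.R)

/-- `C₃`. -/
def C3 : ℝ := 2 * ‖S.R + S.Bᵀ * (S.QN + S.a • (1 : Matrix (Fin n) (Fin n) ℝ)) * S.B‖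

/-- `‖A*_K‖_*`, with `A*_K = A - B K*` and `‖·‖_*` the norm induced by `P = P*`. -/
def rho (P : Matrix (Fin n) (Fin n) ℝ) : ℝ := inducedNorm P (S.closedLoop (S.gain P))

/-- The horizon
`N = ½ log (2 ‖Q_N - P*‖_* κ_{P*} ‖A*_K‖ ‖B‖ / (ε λ_min(R))) / log (1 / ‖A*_K‖_*) + 1`,
rounded up to a positive integer. -/
def horizon (P : Matrix (Fin n) (Fin n) ℝ) (ε : ℝ) : ℕ :=
  ⌈(1 / 2) * (Real.log (2 * inducedNorm P (S.QN - P) * condNum P * ‖S.closedLoop (S.gain P)‖ * ‖S.B‖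
      / (ε * lamMin S.R)) / Real.log (1 / S.rho P))⌉₊ + 1

/-- The corrected stage-wise accuracy that the outer loop with horizon `N` requires from the inner
loop at stage `h` for the target accuracy `ε`. -/
def tolerance (N : ℕ) (ε : ℝ) (h : ℕ) : ℝ :=
  if h = 0 then ε / 4
  else if h = 1 then
    min (Real.sqrt (S.a / S.C3)) (1 / 2 * Real.sqrt (ε / (S.C1 N * S.C3)))
  else
    min (Real.sqrt (S.a / S.C3))
      (min (Real.sqrt (S.a / (S.C2 N ^ (h - 2) * S.C3)))
        (1 / 2 * Real.sqrt (ε / (S.C1 N * S.C2 N ^ (h - 2) * S.C3))))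

/-- The number `T'_h` of inner-loop iterations: of order `e_h⁻²` up to a power of `log (1/ε)`,
where `e_h` is the required stage-wise accuracy. -/
def iterations (P : Matrix (Fin n) (Fin n) ℝ) (c : ℝ) (p : ℕ) (ε : ℝ) (h : ℕ) : ℕ :=
  ⌈c * Real.log (1 / ε) ^ p / S.tolerance (S.horizon P ε) ε h ^ 2⌉₊

/-- The exponent `1 + log C₂ / (2 log (1 / ‖A*_K‖_*))`. -/
def exponent (P : Matrix (Fin n) (Fin n) ℝ) (ε : ℝ) : ℝ :=
  1 + Real.log (S.C2 (S.horizon P ε)) / (2 * Real.log (1 / S.rho P))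

/-- `max {ε⁻², ε^{-(1 + log C₂ / (2 log (1 / ‖A*_K‖_*)))}}`. -/
def rate (P : Matrix (Fin n) (Fin n) ℝ) (ε : ℝ) : ℝ :=
  max (ε ^ (-2 : ℝ)) (ε ^ (-(S.exponent P ε)))

/-! ### The algorithm -/

/-- State at time `i` of the system started at `x` and controlled by `u_i = -K_i x_i`. -/
def rollout (K : ℕ → Matrix (Fin m) (Fin n) ℝ) (x : Fin n → ℝ) : ℕ → Fin n → ℝ
  | 0 => x
  | i + 1 => S.A *ᵥ rollout K x i + S.B *ᵥ (-(K i *ᵥ rollout K x i))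

/-- Sample cost `J̃_h(K; x₀)` observed at stage `h` of the problem with horizon `N`: starting from
`x₀ = x`, the gain `K` is applied at the first step and the frozen gains
`G_{h+1}, …, G_{N-1}` afterwards, with terminal cost matrix `Q_N`. -/
def sampleCost (N h : ℕ) (G : ℕ → Matrix (Fin m) (Fin n) ℝ) (K : Matrix (Fin m) (Fin n) ℝ)
    (x : Fin n → ℝ) : ℝ :=
  let F : ℕ → Matrix (Fin m) (Fin n) ℝ := fun i => if i = 0 then K else G (h + i)
  let X : ℕ → Fin n → ℝ := S.rollout F x
  (∑ i ∈ Finset.range (N - h),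
      (X i ⬝ᵥ (S.Q *ᵥ X i) + (-(F i *ᵥ X i)) ⬝ᵥ (S.R *ᵥ (-(F i *ᵥ X i)))))
    + X (N - h) ⬝ᵥ (S.QN *ᵥ X (N - h))

/-- The surrogate cost `J̃_h(K) = E_{x₀ ~ D} J̃_h(K; x₀)`. -/
def surrogateCost (D : Measure (EuclideanSpace ℝ (Fin n))) (N h : ℕ)
    (G : ℕ → Matrix (Fin m) (Fin n) ℝ) (K : Matrix (Fin m) (Fin n) ℝ) : ℝ :=
  ∫ x, S.sampleCost N h G K x.ofLp ∂D

/-- `Kopt` is an optimal gain `K̃*_h` at stage `h`, i.e. a minimizer of the surrogate cost, when the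
later gains are frozen to `G_{h+1}, …, G_{N-1}`. -/
def IsStageOptimal (D : Measure (EuclideanSpace ℝ (Fin n))) (N h : ℕ)
    (G : ℕ → Matrix (Fin m) (Fin n) ℝ) (Kopt : Matrix (Fin m) (Fin n) ℝ) : Prop :=
  IsMinOn (S.surrogateCost D N h G) Set.univ Kopt

/-- The two-point gradient estimate with smoothing radius `r` and unit direction `U`; both costs
are observed from the same initial state `x`. -/
def twoPointGradient (N h : ℕ) (G : ℕ → Matrix (Fin m) (Fin n) ℝ) (r : ℝ)
    (K : Matrix (Fin m) (Fin n) ℝ) (x : Fin n → ℝ) (U : Matrix (Fin m) (Fin n) ℝ) :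
    Matrix (Fin m) (Fin n) ℝ :=
  (((m : ℝ) * n) / (2 * r)
    * (S.sampleCost N h G (K + r • U) x - S.sampleCost N h G (K - r • U) x)) • U

end LQR

/-- The unit sphere (for the Frobenius norm) of the space of `m × n` gains. -/
abbrev Dir (n m : ℕ) : Type := Metric.sphere (0 : EuclideanSpace ℝ (Fin m × Fin n)) 1

/-- The direction seen as a matrix. -/
def Dir.toMatrix {n m : ℕ} (u : Dir n m) : Matrix (Fin m) (Fin n) ℝ :=
  Matrix.of fun i j => u.1 (i, j)

/-- The uniform distribution on the unit sphere of gains. -/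
def uniformDir (n m : ℕ) : Measure (Dir n m) :=
  let μ : Measure (Dir n m) :=
    (volume : Measure (EuclideanSpace ℝ (Fin m × Fin n))).toSphere
  (μ Set.univ)⁻¹ • μ

theorem isProbabilityMeasure_uniformDir (n m : ℕ) [NeZero n] [NeZero m] :
    IsProbabilityMeasure (uniformDir n m) := by
  have h0 : (volume : Measure (EuclideanSpace ℝ (Fin m × Fin n))).toSphere Set.univ ≠ 0 :=
    Measure.measure_univ_ne_zero.2 (Measure.toSphere_ne_zero _)
  exact ⟨by simpa [uniformDir] using ENNReal.inv_mul_cancel h0 (measure_ne_top _ _)⟩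

/-- Fresh randomness consumed in iteration `i` of stage `h`, for all `(h, i)`: an initial state and
a search direction. -/
abbrev Samples (n m : ℕ) : Type := ℕ × ℕ → EuclideanSpace ℝ (Fin n) × Dir n m

/-- All initial states have law `D`, all directions are uniform, and everything is independent. -/
def samplesLaw {n m : ℕ} (D : Measure (EuclideanSpace ℝ (Fin n))) : Measure (Samples n m) :=
  Measure.infinitePi fun _ : ℕ × ℕ => D.prod (uniformDir n m)

/-- Assumptions on the law of the initial state. -/
structure InitialLaw {n : ℕ} (D : Measure (EuclideanSpace ℝ (Fin n)))
    (Sigma0 : Matrix (Fin n) (Fin n) ℝ) (Cm : ℝ) : Prop where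
  prob : IsProbabilityMeasure D
  mean : ∫ x, x ∂D = 0
  second_moment : ∀ i j, ∫ x, x i * x j ∂D = Sigma0 i j
  posDef : Sigma0.PosDef
  Cm_pos : 0 < Cm
  bounded : ∀ᵐ x ∂D, ‖x‖ ^ 2 ≤ Cm

/-- Parameters of the algorithm: horizon `N`, iteration counts `T_h`, stepsizes `α_{h,i}`, smoothing
radii `r_h`, and the rule `init h` which produces the first iterate of stage `h` from the output of
the previous stage `h + 1` (e.g. a constant, or that output itself). -/
structure Params (n m : ℕ) where
  N : ℕ
  T : ℕ → ℕ
  α : ℕ → ℕ → ℝ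
  r : ℕ → ℝ
  init : ℕ → Matrix (Fin m) (Fin n) ℝ → Matrix (Fin m) (Fin n) ℝ

/-- Initialization rules: measurable, and bounded by `M` or by the norm of the previous output. -/
def IsInitRule {n m : ℕ} (M : ℝ)
    (init : ℕ → Matrix (Fin m) (Fin n) ℝ → Matrix (Fin m) (Fin n) ℝ) : Prop :=
  ∀ h, (∀ i j, Measurable fun K : Fin m → Fin n → ℝ => init h (Matrix.of K) i j) ∧
    ∀ K, ‖init h K‖ ≤ max M ‖K‖

namespace LQR

variable {n m : ℕ} (S : LQR n m)

/-- Inner loop: the iterate `K_{h,i}` of stage `h`, started at `K₀`, with frozen later gains `G`. -/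
def innerLoop (π : Params n m) (ω : Samples n m) (h : ℕ) (G : ℕ → Matrix (Fin m) (Fin n) ℝ)
    (K₀ : Matrix (Fin m) (Fin n) ℝ) : ℕ → Matrix (Fin m) (Fin n) ℝ
  | 0 => K₀
  | i + 1 =>
      innerLoop π ω h G K₀ i - π.α h i •
        S.twoPointGradient π.N h G (π.r h) (innerLoop π ω h G K₀ i)
          (ω (h, i)).1.ofLp (ω (h, i)).2.toMatrix

/-- Outer loop: the table of gains after the `k` stages `N - 1, …, N - k`; entries not yet computed
are zero (in particular the "previous output" of the first stage is zero). -/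
def outerLoop (π : Params n m) (ω : Samples n m) : ℕ → ℕ → Matrix (Fin m) (Fin n) ℝ
  | 0 => fun _ => 0
  | k + 1 =>
      let G := outerLoop π ω k
      let h := π.N - (k + 1)
      Function.update G h (S.innerLoop π ω h G (π.init h (G (h + 1))) (π.T h))

/-- The gains `K̃_0, …, K̃_{N-1}` computed by the algorithm; its output is `K̃_0`. -/
def output (π : Params n m) (ω : Samples n m) : ℕ → Matrix (Fin m) (Fin n) ℝ :=
  S.outerLoop π ω π.N

/-- The run is successful for target accuracy `ε`: each stage `h` ends within the required
tolerance of the optimal stage gain, and the output is `ε`-close to `K*` (`P` is `P*`). -/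
def Success (D : Measure (EuclideanSpace ℝ (Fin n))) (P : Matrix (Fin n) (Fin n) ℝ) (ε : ℝ)
    (π : Params n m) (ω : Samples n m) : Prop :=
  (∀ h < π.N, ∃ Kopt, S.IsStageOptimal D π.N h (S.output π ω) Kopt ∧
      ‖S.output π ω h - Kopt‖ ≤ S.tolerance π.N ε h) ∧
    ‖S.output π ω 0 - S.gain P‖ ≤ ε

end LQR

end RHPG

end

/-! With the later gains frozen, the stage cost is exactly quadratic in the gain. If `X` is the
cost-to-go matrix of those gains, completing the square (`costStep_eq`) gives the sample cost at `K`
as a term independent of `K` plus the form of the Hessian `R + Bᵀ X B` at `(K - gain X) x`. A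
symmetric difference of a quadratic has no bias for any radius, so `r = 1` will do, and the estimate
vanishes at the optimal gain: its noise is multiplicative. Isotropy of the direction and `Σ₀ ≻ 0`
then make one step with a small stepsize, constant and independent of `ε`, contract the mean squared
Frobenius error by a fixed factor `β < 1` (`lintegral_fro2_errStep_le`).

The tolerances are bounded above, so `e_h⁻² log²(1/ε)` iterations are at least a multiple of
`log²(1/ε)`, and `β ^ T` is smaller than any power of `ε`. Every stage can therefore be brought
within one common accuracy `η = ε ^ q`, `q` as large as desired, much finer than prescribed.
Markov's inequality at each stage and a union bound over the stages give probability `1 - δ`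
(`le_samplesLaw_goodSet`). The contraction needs a bounded Hessian, which is known only while the
previous stages succeed; hence the error is tracked on the event `goodSet`.

An error `η` per stage perturbs the Riccati iterates by at most `η * growth ^ N`
(`norm_tailCost_sub_rde_le`). As `N = O(log(1/ε))`, this growth is polynomial in `1/ε` and a
suitable `q` absorbs it. The exact finite-horizon gain at time `0` is within `ε/2` of `K*`, because
the Riccati iterates converge to `P*` at rate `‖A_K*‖_*²` and `N` is chosen accordingly
(`norm_gain_rde_horizon_sub_le`).

The budget is deterministic: up to constants `e_h⁻²` is at most `ε⁻²` or `C₂^(h-2)/ε`, and `h - 2`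
is at most the unrounded horizon, which turns the power of `C₂` into the second term of the rate
(`C2_pow_div_le`).

For the second claim, a scalar system with closed loop `1/2` keeps `log(1/ρ)` bounded by `1`, while
`C₂` is at least a multiple of the free terminal cost. The exponent is thus unbounded, and the
single stage `N - 1` already exhausts the claimed budget. -/

noncomputable section
namespace RHPG

/-! ### Quadratic forms, spectral norm and Frobenius norm. -/

section Quad
variable {k l : ℕ}

/-- The quadratic form `vᵀ X v`. -/
def qf (X : Matrix (Fin k) (Fin k) ℝ) (v : Fin k → ℝ) : ℝ := v ⬝ᵥ (X *ᵥ v)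

/-- Squared Frobenius norm. -/
def fro2 (X : Matrix (Fin k) (Fin l) ℝ) : ℝ := ∑ i, ∑ j, X i j ^ 2

theorem norm_sq_toLp (v : Fin k → ℝ) : ‖WithLp.toLp 2 v‖ ^ 2 = v ⬝ᵥ v := by
  rw [EuclideanSpace.norm_sq_eq]
  simp [dotProduct, sq]

theorem dot_self_nonneg (v : Fin k → ℝ) : 0 ≤ v ⬝ᵥ v := by
  rw [← norm_sq_toLp]; positivity

theorem norm_mulVec_le (X : Matrix (Fin k) (Fin l) ℝ) (v : Fin l → ℝ) :
    ‖WithLp.toLp 2 (X *ᵥ v)‖ ≤ ‖X‖ * ‖WithLp.toLp 2 v‖ :=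
  Matrix.l2_opNorm_mulVec X (WithLp.toLp 2 v)

theorem mulVec_dot_self_le (X : Matrix (Fin k) (Fin l) ℝ) (v : Fin l → ℝ) :
    (X *ᵥ v) ⬝ᵥ (X *ᵥ v) ≤ ‖X‖ ^ 2 * (v ⬝ᵥ v) := by
  rw [← norm_sq_toLp, ← norm_sq_toLp, ← mul_pow]
  exact pow_le_pow_left₀ (norm_nonneg _) (norm_mulVec_le X v) 2

theorem abs_dot_le (v w : Fin k → ℝ) :
    |v ⬝ᵥ w| ≤ ‖WithLp.toLp 2 v‖ * ‖WithLp.toLp 2 w‖ := by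
  have h := abs_real_inner_le_norm (WithLp.toLp 2 w) (WithLp.toLp 2 v)
  rw [EuclideanSpace.inner_toLp_toLp, mul_comm] at h
  simpa using h

theorem abs_dot_mulVec_le (X : Matrix (Fin k) (Fin k) ℝ) (v : Fin k → ℝ) :
    |qf X v| ≤ ‖X‖ * (v ⬝ᵥ v) := by
  have h1 := abs_dot_le v (X *ᵥ v)
  have h2 := norm_mulVec_le X v
  have h3 := mul_le_mul_of_nonneg_left h2 (norm_nonneg (WithLp.toLp 2 v))
  have h4 := norm_sq_toLp v
  unfold qf
  calc _ ≤ _ := h1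
    _ ≤ _ := h3
    _ = _ := by rw [← h4]; ring

theorem opNorm_le_of_dot (X : Matrix (Fin k) (Fin l) ℝ) {c : ℝ} (hc : 0 ≤ c)
    (h : ∀ v, (X *ᵥ v) ⬝ᵥ (X *ᵥ v) ≤ c ^ 2 * (v ⬝ᵥ v)) : ‖X‖ ≤ c := by
  rw [Matrix.l2_opNorm_def]
  refine ContinuousLinearMap.opNorm_le_bound _ hc fun v => ?_
  have h1 := h v.ofLp
  rw [← norm_sq_toLp, ← norm_sq_toLp, ← mul_pow] at h1
  exact le_of_sq_le_sq h1 (by positivity)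

/-- Factor `X = Cᴴ C`: the form is `|C v|²` and the norm is `‖C‖²`, so it suffices that `‖C‖ ≤ √c`.
-/
theorem opNorm_le_of_qf {X : Matrix (Fin k) (Fin k) ℝ} (hX : X.PosSemidef) {c : ℝ} (hc : 0 ≤ c)
    (h : ∀ v, qf X v ≤ c * (v ⬝ᵥ v)) : ‖X‖ ≤ c := by
  obtain ⟨C, rfl⟩ := (by
    open scoped MatrixOrder in
    exact CStarAlgebra.nonneg_iff_eq_star_mul_self.1 (Matrix.nonneg_iff_posSemidef.2 hX) :
      ∃ C : Matrix (Fin k) (Fin k) ℝ, X = Cᴴ * C)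
  rw [Matrix.l2_opNorm_conjTranspose_mul_self]
  have : ‖C‖ ≤ Real.sqrt c := by
    refine opNorm_le_of_dot C (Real.sqrt_nonneg _) fun v => ?_
    rw [Real.sq_sqrt hc]
    refine le_trans (le_of_eq ?_) (h v)
    rw [qf, ← Matrix.mulVec_mulVec, Matrix.conjTranspose_eq_transpose_of_trivial,
      Matrix.dotProduct_mulVec v, Matrix.vecMul_transpose]
  calc ‖C‖ * ‖C‖ ≤ Real.sqrt c * Real.sqrt c := by gcongr
    _ = c := Real.mul_self_sqrt hc

theorem qf_nonneg {X : Matrix (Fin k) (Fin k) ℝ} (hX : X.PosSemidef) (v : Fin k → ℝ) :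
    0 ≤ qf X v := by
  simpa [qf] using hX.dotProduct_mulVec_nonneg v

theorem posSemidef_of_qf {X : Matrix (Fin k) (Fin k) ℝ} (hX : Xᵀ = X) (h : ∀ v, 0 ≤ qf X v) :
    X.PosSemidef :=
  Matrix.PosSemidef.of_dotProduct_mulVec_nonneg
    (by rw [Matrix.IsHermitian, Matrix.conjTranspose_eq_transpose_of_trivial, hX])
    (fun v => by simpa [qf] using h v)

theorem transpose_eq {X : Matrix (Fin k) (Fin k) ℝ} (hX : X.PosSemidef) : Xᵀ = X := by
  have := hX.1
  rwa [Matrix.IsHermitian, Matrix.conjTranspose_eq_transpose_of_trivial] at this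

theorem qf_add (X Y : Matrix (Fin k) (Fin k) ℝ) (v : Fin k → ℝ) :
    qf (X + Y) v = qf X v + qf Y v := by
  simp [qf, Matrix.add_mulVec]

theorem qf_sub (X Y : Matrix (Fin k) (Fin k) ℝ) (v : Fin k → ℝ) :
    qf (X - Y) v = qf X v - qf Y v := by
  simp [qf, Matrix.sub_mulVec]

theorem qf_smul (c : ℝ) (X : Matrix (Fin k) (Fin k) ℝ) (v : Fin k → ℝ) :
    qf (c • X) v = c * qf X v := by
  simp [qf, Matrix.smul_mulVec]

theorem qf_one (v : Fin k → ℝ) : qf (1 : Matrix (Fin k) (Fin k) ℝ) v = v ⬝ᵥ v := by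
  simp [qf]

theorem qf_conj (X : Matrix (Fin k) (Fin k) ℝ) (Y : Matrix (Fin k) (Fin l) ℝ) (v : Fin l → ℝ) :
    qf (Yᵀ * X * Y) v = qf X (Y *ᵥ v) := by
  rw [qf, qf, ← Matrix.mulVec_mulVec, ← Matrix.mulVec_mulVec, Matrix.dotProduct_mulVec,
    Matrix.vecMul_transpose]

/-- Subtracting `lamMin X` times the identity shifts the spectrum, which stays nonnegative. Positive
semidefiniteness bounds the spectrum below, so the `sInf` in `lamMin` is a genuine lower bound. -/
theorem lamMin_mul_le {X : Matrix (Fin k) (Fin k) ℝ} (hX : X.PosSemidef) (v : Fin k → ℝ) :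
    lamMin X * (v ⬝ᵥ v) ≤ qf X v := by
  have hbdd : BddBelow (spectrum ℝ X) := ⟨0, fun x hx =>
    (Matrix.posSemidef_iff_isHermitian_and_spectrum_nonneg.1 hX).2 hx⟩
  have hY : (X - lamMin X • (1 : Matrix (Fin k) (Fin k) ℝ)).PosSemidef := by
    rw [Matrix.posSemidef_iff_isHermitian_and_spectrum_nonneg]
    refine ⟨hX.1.sub ?_, ?_⟩
    · exact Matrix.isHermitian_one.smul (IsSelfAdjoint.all _)
    · intro x hx
      rw [← Algebra.algebraMap_eq_smul_one, ← spectrum.sub_singleton_eq,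
        Set.sub_singleton] at hx
      obtain ⟨y, hy, rfl⟩ := hx
      exact sub_nonneg.2 (csInf_le hbdd hy)
  have := qf_nonneg hY v
  rw [qf_sub, qf_smul, qf_one] at this
  linarith

theorem lamMin_pos [NeZero k] {X : Matrix (Fin k) (Fin k) ℝ} (hX : X.PosDef) : 0 < lamMin X := by
  have hs := hX.1.spectrum_real_eq_range_eigenvalues
  have hne : (spectrum ℝ X).Nonempty := by rw [hs]; exact Set.range_nonempty _
  have hfin : (spectrum ℝ X).Finite := by rw [hs]; exact Set.finite_range _
  have := hne.csInf_mem hfin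
  rw [hs] at this
  obtain ⟨i, hi⟩ := this
  rw [lamMin, hs, ← hi]
  exact hX.eigenvalues_pos i

/-- Coercivity and Cauchy–Schwarz: `c |w|² ≤ w · X w ≤ |w| |X w|`, applied to `w = X⁻¹ v`. -/
theorem norm_inv_le {X : Matrix (Fin k) (Fin k) ℝ} {c : ℝ} (hc : 0 < c) (hX : X.PosDef)
    (h : ∀ v, c * (v ⬝ᵥ v) ≤ qf X v) : ‖X⁻¹‖ ≤ 1 / c := by
  refine opNorm_le_of_dot _ (by positivity) fun v => ?_
  have hu := (Matrix.isUnit_iff_isUnit_det _).1 hX.isUnit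
  set w := X⁻¹ *ᵥ v with hw
  have hv : X *ᵥ w = v := by
    rw [hw, Matrix.mulVec_mulVec, Matrix.mul_nonsing_inv _ hu, Matrix.one_mulVec]
  have h1 := h w
  rw [qf, hv] at h1
  have h2 := (le_abs_self _).trans (abs_dot_le w v)
  rw [← norm_sq_toLp] at h1 ⊢
  rw [← norm_sq_toLp]
  rw [← mul_pow]
  refine pow_le_pow_left₀ (norm_nonneg _) ?_ 2
  by_cases h0 : ‖WithLp.toLp 2 w‖ = 0
  · rw [h0]; positivity
  · have h0' : 0 < ‖WithLp.toLp 2 w‖ := lt_of_le_of_ne (norm_nonneg _) (Ne.symm h0)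
    rw [one_div, ← div_eq_inv_mul, le_div_iff₀ hc]
    nlinarith

theorem fro2_nonneg (X : Matrix (Fin k) (Fin l) ℝ) : 0 ≤ fro2 X := by
  unfold fro2; positivity

theorem opNorm_sq_le_fro2 (X : Matrix (Fin k) (Fin l) ℝ) : ‖X‖ ^ 2 ≤ fro2 X := by
  have : ‖X‖ ≤ Real.sqrt (fro2 X) := by
    refine opNorm_le_of_dot _ (Real.sqrt_nonneg _) fun v => ?_
    rw [Real.sq_sqrt (fro2_nonneg X), fro2, Finset.sum_mul]
    simp only [dotProduct, Matrix.mulVec]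
    refine Finset.sum_le_sum fun i _ => ?_
    rw [← sq]
    simpa [sq] using Finset.sum_mul_sq_le_sq_mul_sq Finset.univ (fun j => X i j) v
  calc ‖X‖ ^ 2 ≤ Real.sqrt (fro2 X) ^ 2 := by gcongr
    _ = _ := Real.sq_sqrt (fro2_nonneg X)

theorem fro2_le (X : Matrix (Fin k) (Fin l) ℝ) : fro2 X ≤ l * ‖X‖ ^ 2 := by
  rw [fro2, Finset.sum_comm]
  calc ∑ j, ∑ i, X i j ^ 2 ≤ ∑ _j : Fin l, ‖X‖ ^ 2 := by
        refine Finset.sum_le_sum fun j _ => ?_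
        have := mulVec_dot_self_le X (Pi.single j 1)
        simpa [dotProduct, sq, Pi.single_apply] using this
    _ = _ := by simp

theorem norm_transpose (X : Matrix (Fin k) (Fin l) ℝ) : ‖Xᵀ‖ = ‖X‖ := by
  rw [← Matrix.conjTranspose_eq_transpose_of_trivial, Matrix.l2_opNorm_conjTranspose]

theorem norm_mul3_le {a b : ℕ} (X : Matrix (Fin a) (Fin b) ℝ) (Y : Matrix (Fin b) (Fin k) ℝ)
    (Z : Matrix (Fin k) (Fin l) ℝ) : ‖X * Y * Z‖ ≤ ‖X‖ * ‖Y‖ * ‖Z‖ :=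
  (Matrix.l2_opNorm_mul _ _).trans
    (mul_le_mul_of_nonneg_right (Matrix.l2_opNorm_mul _ _) (norm_nonneg _))

end Quad

/-! ### The norm induced by a positive definite matrix. -/

section Induced
variable {k : ℕ}

/-- With `P = Cᴴ C` one has `‖P⁻¹‖ = ‖C⁻¹‖²`, and `v = C⁻¹ (C v)`. -/
theorem dot_self_le_qf {P : Matrix (Fin k) (Fin k) ℝ} (hP : P.PosDef) (v : Fin k → ℝ) :
    v ⬝ᵥ v ≤ ‖P⁻¹‖ * qf P v := by
  have hu := (Matrix.isUnit_iff_isUnit_det _).1 hP.isUnit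
  obtain ⟨C, rfl⟩ := (by
    open scoped MatrixOrder in
    exact CStarAlgebra.nonneg_iff_eq_star_mul_self.1
      (Matrix.nonneg_iff_posSemidef.2 hP.posSemidef) :
      ∃ C : Matrix (Fin k) (Fin k) ℝ, P = Cᴴ * C)
  have hC : IsUnit C.det := by
    rw [Matrix.det_mul] at hu
    exact isUnit_of_mul_isUnit_right hu
  have h1 : ‖(Cᴴ * C)⁻¹‖ = ‖C⁻¹‖ ^ 2 := by
    have := Matrix.l2_opNorm_conjTranspose_mul_self ((C⁻¹)ᴴ)
    rw [Matrix.conjTranspose_conjTranspose, Matrix.l2_opNorm_conjTranspose,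
      Matrix.conjTranspose_nonsing_inv] at this
    rw [Matrix.mul_inv_rev, this, sq]
  have h2 : qf (Cᴴ * C) v = (C *ᵥ v) ⬝ᵥ (C *ᵥ v) := by
    rw [qf, ← Matrix.mulVec_mulVec, Matrix.conjTranspose_eq_transpose_of_trivial,
      Matrix.dotProduct_mulVec v, Matrix.vecMul_transpose]
  have h3 := mulVec_dot_self_le C⁻¹ (C *ᵥ v)
  rwa [Matrix.mulVec_mulVec, Matrix.nonsing_inv_mul _ hC, Matrix.one_mulVec, ← h1, ← h2] at h3

theorem qf_pos {P : Matrix (Fin k) (Fin k) ℝ} (hP : P.PosDef) {v : Fin k → ℝ} (hv : v ≠ 0) :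
    0 < qf P v := by
  simpa [qf] using hP.dotProduct_mulVec_pos hv

theorem qf_le (P : Matrix (Fin k) (Fin k) ℝ) (v : Fin k → ℝ) : qf P v ≤ ‖P‖ * (v ⬝ᵥ v) :=
  (le_abs_self _).trans (abs_dot_mulVec_le P v)

theorem inducedNorm_nonneg (P X : Matrix (Fin k) (Fin k) ℝ) : 0 ≤ inducedNorm P X :=
  Real.sqrt_nonneg _

theorem qf_mulVec_le {P : Matrix (Fin k) (Fin k) ℝ} (hP : P.PosDef)
    (X : Matrix (Fin k) (Fin k) ℝ) (v : Fin k → ℝ) :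
    qf P (X *ᵥ v) ≤ inducedNorm P X ^ 2 * qf P v := by
  by_cases hv : v = 0
  · simp [hv, qf]
  -- An unbounded real supremum would have the default value `0`; equivalence of the `P`-norm with
  -- the Euclidean norm excludes this.
  have hbdd : BddAbove (Set.range fun z : {z : Fin k → ℝ // z ≠ 0} =>
      ((X *ᵥ z.1) ⬝ᵥ (P *ᵥ (X *ᵥ z.1))) / (z.1 ⬝ᵥ (P *ᵥ z.1))) := by
    refine ⟨‖P‖ * ‖X‖ ^ 2 * ‖P⁻¹‖, ?_⟩
    rintro _ ⟨z, rfl⟩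
    change qf P (X *ᵥ z.1) / qf P z.1 ≤ _
    rw [div_le_iff₀ (qf_pos hP z.2)]
    calc qf P (X *ᵥ z.1) ≤ ‖P‖ * ((X *ᵥ z.1) ⬝ᵥ (X *ᵥ z.1)) := qf_le _ _
      _ ≤ ‖P‖ * (‖X‖ ^ 2 * (z.1 ⬝ᵥ z.1)) := by gcongr; exact mulVec_dot_self_le _ _
      _ ≤ ‖P‖ * (‖X‖ ^ 2 * (‖P⁻¹‖ * qf P z.1)) := by gcongr; exact dot_self_le_qf hP _
      _ = _ := by ring
  have h1 := le_ciSup hbdd ⟨v, hv⟩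
  change qf P (X *ᵥ v) / qf P v ≤ _ at h1
  rw [inducedNorm, Real.sq_sqrt]
  · rwa [div_le_iff₀ (qf_pos hP hv)] at h1
  · exact le_trans (div_nonneg (qf_nonneg hP.posSemidef _) (qf_nonneg hP.posSemidef _)) h1

/-- Cauchy–Schwarz gives `|w| |X w|`, and passing to the `P`-norm costs `‖P⁻¹‖^(1/2)` for each
factor. Together with `qf_le` this produces the condition number in the horizon. -/
theorem qf_le_inducedNorm {P : Matrix (Fin k) (Fin k) ℝ} (hP : P.PosDef)
    (X : Matrix (Fin k) (Fin k) ℝ) (w : Fin k → ℝ) :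
    qf X w ≤ ‖P⁻¹‖ * inducedNorm P X * qf P w := by
  have h0 := qf_nonneg hP.posSemidef w
  have h1 := dot_self_le_qf hP w
  have h2 := (dot_self_le_qf hP (X *ᵥ w)).trans
    (mul_le_mul_of_nonneg_left (qf_mulVec_le hP X w) (norm_nonneg _))
  have h3 := (le_abs_self _).trans (abs_dot_le w (X *ᵥ w))
  refine h3.trans (le_of_sq_le_sq ?_ ?_)
  · rw [mul_pow, norm_sq_toLp, norm_sq_toLp]
    calc _ ≤ (‖P⁻¹‖ * qf P w) * (‖P⁻¹‖ * (inducedNorm P X ^ 2 * qf P w)) :=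
          mul_le_mul h1 h2 (dot_self_nonneg _) (by positivity)
      _ = _ := by ring
  · have := inducedNorm_nonneg P X
    positivity

theorem qf_pow_mulVec_le {P : Matrix (Fin k) (Fin k) ℝ} (hP : P.PosDef)
    (X : Matrix (Fin k) (Fin k) ℝ) (v : Fin k → ℝ) (j : ℕ) :
    qf P ((X ^ j) *ᵥ v) ≤ (inducedNorm P X ^ 2) ^ j * qf P v := by
  induction j generalizing v with
  | zero => simp
  | succ j ih =>
    rw [pow_succ X, ← Matrix.mulVec_mulVec]
    refine (ih _).trans ?_
    rw [pow_succ (inducedNorm P X ^ 2), mul_assoc]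
    exact mul_le_mul_of_nonneg_left (qf_mulVec_le hP X v) (by positivity)

end Induced

/-! ### The one-step cost, its minimizer and perturbation of the gain. -/

namespace LQR
variable {n m : ℕ} (S : LQR n m)

/-- The Hessian `R + Bᵀ P B` of the one-step cost. -/
def hess (P : Matrix (Fin n) (Fin n) ℝ) : Matrix (Fin m) (Fin m) ℝ := S.R + S.Bᵀ * P * S.B

variable {S}

theorem posSemidef_conj {k l : ℕ} {P : Matrix (Fin k) (Fin k) ℝ} (hP : P.PosSemidef)
    (Y : Matrix (Fin k) (Fin l) ℝ) : (Yᵀ * P * Y).PosSemidef := by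
  simpa using hP.conjTranspose_mul_mul_same Y

theorem hess_posDef (hR : S.R.PosDef) {P : Matrix (Fin n) (Fin n) ℝ} (hP : P.PosSemidef) :
    (S.hess P).PosDef :=
  hR.add_posSemidef (posSemidef_conj hP _)

theorem hess_mul_gain (hR : S.R.PosDef) {P : Matrix (Fin n) (Fin n) ℝ} (hP : P.PosSemidef) :
    S.hess P * S.gain P = S.Bᵀ * P * S.A := by
  have hu := (Matrix.isUnit_iff_isUnit_det _).1 (hess_posDef hR hP).isUnit
  have : S.gain P = (S.hess P)⁻¹ * (S.Bᵀ * P * S.A) := by simp [gain, hess, Matrix.mul_assoc]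
  rw [this, ← Matrix.mul_assoc, Matrix.mul_nonsing_inv _ hu, Matrix.one_mul]

theorem R_mul_gain (hR : S.R.PosDef) {P : Matrix (Fin n) (Fin n) ℝ} (hP : P.PosSemidef) :
    S.R * S.gain P = S.Bᵀ * P * S.closedLoop (S.gain P) := by
  have h := hess_mul_gain hR hP
  rw [hess, Matrix.add_mul] at h
  rw [closedLoop, Matrix.mul_sub, ← h]
  simp [Matrix.mul_assoc]

theorem costStep_eq_hess (K : Matrix (Fin m) (Fin n) ℝ) (P : Matrix (Fin n) (Fin n) ℝ) :
    S.costStep K P = Kᵀ * S.hess P * K - Kᵀ * (S.Bᵀ * P * S.A) - S.Aᵀ * P * S.B * K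
      + S.Aᵀ * P * S.A + S.Q := by
  simp only [costStep, closedLoop, hess, Matrix.transpose_sub, Matrix.transpose_mul,
    Matrix.sub_mul, Matrix.mul_sub, Matrix.add_mul, Matrix.mul_add, Matrix.mul_assoc]
  abel

/-- Completing the square in `K`. Optimality of `gain P`, the exact form of the stage costs and the
error recursion all come from this identity. -/
theorem costStep_eq (hR : S.R.PosDef) {P : Matrix (Fin n) (Fin n) ℝ} (hP : P.PosSemidef)
    (K : Matrix (Fin m) (Fin n) ℝ) :
    S.costStep K P = S.costStep (S.gain P) P
      + (K - S.gain P)ᵀ * S.hess P * (K - S.gain P) := by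
  have h1 := hess_mul_gain hR hP
  have h2 : S.Aᵀ * P * S.B = (S.gain P)ᵀ * S.hess P := by
    have := congrArg Matrix.transpose h1
    rw [Matrix.transpose_mul, transpose_eq (hess_posDef hR hP).posSemidef] at this
    rw [this]
    simp [transpose_eq hP, Matrix.mul_assoc]
  rw [costStep_eq_hess, costStep_eq_hess, h2, ← h1]
  simp only [Matrix.transpose_sub, Matrix.sub_mul, Matrix.mul_sub, Matrix.mul_assoc]
  abel

theorem costStep_sub (K : Matrix (Fin m) (Fin n) ℝ) (P P' : Matrix (Fin n) (Fin n) ℝ) :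
    S.costStep K P' - S.costStep K P
      = (S.closedLoop K)ᵀ * (P' - P) * S.closedLoop K := by
  simp only [costStep, Matrix.sub_mul, Matrix.mul_sub]
  abel

theorem costStep_posSemidef (hQ : S.Q.PosSemidef) (hR : S.R.PosSemidef)
    {P : Matrix (Fin n) (Fin n) ℝ} (hP : P.PosSemidef) (K : Matrix (Fin m) (Fin n) ℝ) :
    (S.costStep K P).PosSemidef :=
  ((posSemidef_conj hP _).add (posSemidef_conj hR _)).add hQ

theorem qf_costStep_gain_le (hR : S.R.PosDef) {P : Matrix (Fin n) (Fin n) ℝ} (hP : P.PosSemidef)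
    (K : Matrix (Fin m) (Fin n) ℝ) (v : Fin n → ℝ) :
    qf (S.costStep (S.gain P) P) v ≤ qf (S.costStep K P) v := by
  rw [costStep_eq hR hP K, qf_add]
  linarith [qf_nonneg (posSemidef_conj (hess_posDef hR hP).posSemidef (K - S.gain P)) v]

theorem costStep_gain_of_are (hR : S.R.PosDef) {P : Matrix (Fin n) (Fin n) ℝ}
    (hP : P.PosSemidef) (h : S.IsARESolution P) : S.costStep (S.gain P) P = P := by
  -- At `K = 0` the one-step cost is `Aᵀ P A + Q`, and the completed square is exactly the term
  -- subtracted in the Riccati equation.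
  have h1 := costStep_eq hR hP 0
  have hg := hess_mul_gain hR hP
  rw [costStep_eq_hess] at h1
  have h3 : S.Aᵀ * P * S.B = (S.gain P)ᵀ * S.hess P := by
    have := congrArg Matrix.transpose hg
    rw [Matrix.transpose_mul, transpose_eq (hess_posDef hR hP).posSemidef] at this
    rw [this]
    simp [transpose_eq hP, Matrix.mul_assoc]
  have h4 : (0 - S.gain P)ᵀ * S.hess P * (0 - S.gain P)
      = S.Aᵀ * P * S.B * (S.R + S.Bᵀ * P * S.B)⁻¹ * S.Bᵀ * P * S.A := by
    rw [h3]
    simp [gain, hess, Matrix.mul_assoc]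
  rw [h4] at h1
  have h5 := eq_sub_of_add_eq h1.symm
  rw [h5]
  conv_rhs => rw [h]
  simp
  abel

/-- The first-order condition `R K = Bᵀ P (A - B K)` makes the difference of gains linear in `P' -
P`, apart from the Hessian at `P'`. Since that Hessian dominates `R`, a Lipschitz bound follows that
needs no bound on `P'`. -/
theorem gain_sub_gain (hR : S.R.PosDef) {P P' : Matrix (Fin n) (Fin n) ℝ} (hP : P.PosSemidef)
    (hP' : P'.PosSemidef) :
    S.gain P' - S.gain P = (S.hess P')⁻¹ * (S.Bᵀ * (P' - P) * S.closedLoop (S.gain P)) := by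
  have hu := (Matrix.isUnit_iff_isUnit_det _).1 (hess_posDef hR hP').isUnit
  have h : S.hess P' * (S.gain P' - S.gain P)
      = S.Bᵀ * (P' - P) * S.closedLoop (S.gain P) := by
    rw [Matrix.mul_sub, hess_mul_gain hR hP', Matrix.mul_sub, Matrix.sub_mul, ← R_mul_gain hR hP,
      hess, closedLoop]
    simp only [Matrix.add_mul, Matrix.mul_sub, Matrix.mul_assoc]
    abel
  rw [← h, ← Matrix.mul_assoc, Matrix.nonsing_inv_mul _ hu, Matrix.one_mul]

theorem lamMin_mul_le_qf_hess (hR : S.R.PosDef) {P : Matrix (Fin n) (Fin n) ℝ}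
    (hP : P.PosSemidef) (v : Fin m → ℝ) : lamMin S.R * (v ⬝ᵥ v) ≤ qf (S.hess P) v := by
  rw [hess, qf_add]
  linarith [lamMin_mul_le hR.posSemidef v, qf_nonneg (posSemidef_conj hP S.B) v]

theorem norm_hess_le (P : Matrix (Fin n) (Fin n) ℝ) :
    ‖S.hess P‖ ≤ ‖S.R‖ + ‖S.B‖ ^ 2 * ‖P‖ := by
  refine (norm_add_le _ _).trans (add_le_add le_rfl ((norm_mul3_le _ _ _).trans ?_))
  rw [norm_transpose]
  exact le_of_eq (by ring)

theorem norm_gain_sub_le [NeZero m] (hR : S.R.PosDef) {P P' : Matrix (Fin n) (Fin n) ℝ}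
    (hP : P.PosSemidef) (hP' : P'.PosSemidef) :
    ‖S.gain P' - S.gain P‖
      ≤ ‖S.B‖ * ‖S.closedLoop (S.gain P)‖ / lamMin S.R * ‖P' - P‖ := by
  have hl := lamMin_pos hR
  rw [gain_sub_gain hR hP hP']
  calc _ ≤ ‖(S.hess P')⁻¹‖ * ‖S.Bᵀ * (P' - P) * S.closedLoop (S.gain P)‖ := Matrix.l2_opNorm_mul _ _
    _ ≤ (1 / lamMin S.R) * (‖S.Bᵀ‖ * ‖P' - P‖ * ‖S.closedLoop (S.gain P)‖) := by
        gcongr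
        · exact norm_inv_le hl (hess_posDef hR hP') (lamMin_mul_le_qf_hess hR hP')
        · exact norm_mul3_le _ _ _
    _ = _ := by rw [norm_transpose]; ring

theorem norm_gain_le [NeZero m] (hR : S.R.PosDef) {P : Matrix (Fin n) (Fin n) ℝ}
    (hP : P.PosSemidef) : ‖S.gain P‖ ≤ ‖S.B‖ * ‖S.A‖ / lamMin S.R * ‖P‖ := by
  have h := norm_gain_sub_le hR Matrix.PosSemidef.zero hP
  -- Comparison with the cost-to-go `0`, whose gain is `0` and whose closed loop is `A`.
  have h0 : S.gain 0 = 0 := by simp [gain]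
  simpa [h0, closedLoop] using h

theorem norm_closedLoop_le (K : Matrix (Fin m) (Fin n) ℝ) :
    ‖S.closedLoop K‖ ≤ ‖S.A‖ + ‖S.B‖ * ‖K‖ :=
  (norm_sub_le _ _).trans (add_le_add le_rfl (Matrix.l2_opNorm_mul _ _))

/-- If `A - B K` vanished, then `R K = Bᵀ P (A - B K) = 0` would force `K = 0` and hence `A = 0`. -/
theorem closedLoop_gain_ne_zero (hR : S.R.PosDef) {P : Matrix (Fin n) (Fin n) ℝ}
    (hP : P.PosSemidef) (hA : S.A ≠ 0) : S.closedLoop (S.gain P) ≠ 0 := by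
  intro h0
  have h := R_mul_gain hR hP
  rw [h0, Matrix.mul_zero] at h
  have hu := (Matrix.isUnit_iff_isUnit_det _).1 hR.isUnit
  have hg : S.gain P = 0 := by
    rw [← Matrix.one_mul (S.gain P), ← Matrix.nonsing_inv_mul _ hu, Matrix.mul_assoc, h,
      Matrix.mul_zero]
  rw [closedLoop, hg, Matrix.mul_zero, sub_zero] at h0
  exact hA h0

/-! ### Convergence of the Riccati difference equation. -/

section Riccati
variable {P : Matrix (Fin n) (Fin n) ℝ}

theorem QN_posSemidef (hS : S.Admissible P) : S.QN.PosSemidef := by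
  simpa using hS.terminal.add hS.posDef_P.posSemidef

theorem rde_posSemidef (hS : S.Admissible P) (k : ℕ) : (S.rde k).PosSemidef := by
  induction k with
  | zero => exact QN_posSemidef hS
  | succ k ih =>
    exact costStep_posSemidef hS.posDef_Q.posSemidef hS.posDef_R.posSemidef ih _

theorem costStep_gain_self (hS : S.Admissible P) : S.costStep (S.gain P) P = P :=
  costStep_gain_of_are hS.posDef_R hS.posDef_P.posSemidef hS.are

/-- Apply the gain of `rde k` to both `rde k` and `P`: the cost step is monotone in the cost-to-go,
and with `P` this gain is no better than `gain P`, which reproduces `P`. -/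
theorem rde_sub_posSemidef (hS : S.Admissible P) (k : ℕ) : (S.rde k - P).PosSemidef := by
  induction k with
  | zero => exact hS.terminal
  | succ k ih =>
    refine posSemidef_of_qf ?_ fun v => ?_
    · rw [Matrix.transpose_sub, transpose_eq (rde_posSemidef hS _),
        transpose_eq hS.posDef_P.posSemidef]
    · have h1 := qf_costStep_gain_le hS.posDef_R hS.posDef_P.posSemidef (S.gain (S.rde k)) v
      rw [costStep_gain_self hS] at h1
      have h2 := qf_nonneg (posSemidef_conj ih (S.closedLoop (S.gain (S.rde k)))) v
      rw [← costStep_sub, qf_sub] at h2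
      rw [qf_sub, rde]
      linarith

/-- The reverse comparison: using the stationary gain `gain P` is suboptimal for `rde k`, and under
a common gain the difference from `P` is merely conjugated by the closed loop. -/
theorem qf_rde_sub_le (hS : S.Admissible P) (k : ℕ) (v : Fin n → ℝ) :
    qf (S.rde k - P) v ≤ qf (S.QN - P) ((S.closedLoop (S.gain P) ^ k) *ᵥ v) := by
  induction k generalizing v with
  | zero => simp [rde]
  | succ k ih =>
    rw [pow_succ, ← Matrix.mulVec_mulVec]
    refine le_trans ?_ (ih _)
    have h1 := qf_costStep_gain_le hS.posDef_R (rde_posSemidef hS k) (S.gain P) v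
    have h2 : qf (S.costStep (S.gain P) (S.rde k) - S.costStep (S.gain P) P) v
        = qf (S.rde k - P) (S.closedLoop (S.gain P) *ᵥ v) := by
      rw [costStep_sub, qf_conj]
    rw [costStep_gain_self hS, qf_sub] at h2
    rw [qf_sub, rde, ← h2]
    linarith

theorem rho_nonneg : 0 ≤ S.rho P := inducedNorm_nonneg _ _

theorem norm_rde_sub_le (hS : S.Admissible P) (k : ℕ) :
    ‖S.rde k - P‖ ≤ inducedNorm P (S.QN - P) * condNum P * (S.rho P ^ 2) ^ k := by
  have h0 := inducedNorm_nonneg P (S.QN - P)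
  refine opNorm_le_of_qf (rde_sub_posSemidef hS k) (by unfold condNum; positivity) fun v => ?_
  calc _ ≤ _ := qf_rde_sub_le hS k v
    _ ≤ _ := qf_le_inducedNorm hS.posDef_P _ _
    _ ≤ ‖P⁻¹‖ * inducedNorm P (S.QN - P) * ((S.rho P ^ 2) ^ k * (‖P‖ * (v ⬝ᵥ v))) := by
        gcongr
        refine (qf_pow_mulVec_le hS.posDef_P _ v k).trans ?_
        exact mul_le_mul_of_nonneg_left (qf_le _ _) (by positivity)
    _ = _ := by unfold condNum; ring

theorem rho_pos (hS : S.Admissible P) : 0 < S.rho P := by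
  refine lt_of_le_of_ne rho_nonneg fun h0 => ?_
  refine closedLoop_gain_ne_zero hS.posDef_R hS.posDef_P.posSemidef hS.A_ne_zero ?_
  refine Matrix.ext_of_mulVec_single fun i => ?_
  rw [Matrix.zero_mulVec]
  by_contra hne
  have h1 := qf_mulVec_le hS.posDef_P (S.closedLoop (S.gain P)) (Pi.single i 1)
  change _ ≤ S.rho P ^ 2 * _ at h1
  rw [← h0] at h1
  have := qf_pos hS.posDef_P hne
  simp at h1
  simp at this
  linarith

/-- `P` is a Lyapunov function: by the Riccati equation the closed loop lowers the form of `P` by at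
least that of `Q`, which is at least the fraction `lamMin Q / ‖P‖` of it. -/
theorem rho_lt_one [NeZero n] (hS : S.Admissible P) : S.rho P < 1 := by
  have hQ := lamMin_pos hS.posDef_Q
  have hne : Nonempty {z : Fin n → ℝ // z ≠ 0} :=
    ⟨⟨fun _ => 1, fun h => one_ne_zero (congrFun h 0)⟩⟩
  have hP : 0 < ‖P‖ := by
    obtain ⟨z, hz⟩ := hne
    have h1 := qf_pos hS.posDef_P hz
    have h2 := qf_le P z
    by_contra h
    have h3 : ‖P‖ = 0 := le_antisymm (not_lt.1 h) (norm_nonneg _)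
    rw [h3] at h2
    linarith
  rw [rho, inducedNorm, ← Real.sqrt_one]
  refine Real.sqrt_lt_sqrt (Real.iSup_nonneg fun z =>
    div_nonneg (qf_nonneg hS.posDef_P.posSemidef _) (qf_nonneg hS.posDef_P.posSemidef _))
    (lt_of_le_of_lt (ciSup_le (c := 1 - lamMin S.Q / ‖P‖) fun z => ?_) ?_)
  · change qf P (S.closedLoop (S.gain P) *ᵥ z.1) / qf P z.1 ≤ _
    rw [div_le_iff₀ (qf_pos hS.posDef_P z.2)]
    have h1 : qf P z.1 = qf (S.costStep (S.gain P) P) z.1 := by rw [costStep_gain_self hS]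
    rw [costStep, qf_add, qf_add, qf_conj] at h1
    have h2 := qf_nonneg (posSemidef_conj hS.posDef_R.posSemidef (S.gain P)) z.1
    have h3 := lamMin_mul_le hS.posDef_Q.posSemidef z.1
    have h4 := qf_le P z.1
    have h5 : lamMin S.Q / ‖P‖ * qf P z.1 ≤ lamMin S.Q * (z.1 ⬝ᵥ z.1) := by
      rw [div_mul_eq_mul_div, div_le_iff₀ hP]
      nlinarith
    nlinarith
  · have : 0 < lamMin S.Q / ‖P‖ := by positivity
    linarith

/-- A uniform bound for the Riccati iterates. -/
def rdeBound (S : LQR n m) (P : Matrix (Fin n) (Fin n) ℝ) : ℝ :=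
  ‖P‖ + inducedNorm P (S.QN - P) * condNum P

theorem rdeBound_nonneg : 0 ≤ S.rdeBound P := by
  have := inducedNorm_nonneg P (S.QN - P)
  unfold rdeBound condNum
  positivity

theorem norm_rde_le [NeZero n] (hS : S.Admissible P) (k : ℕ) : ‖S.rde k‖ ≤ S.rdeBound P := by
  have h1 := norm_rde_sub_le hS k
  have h2 : (S.rho P ^ 2) ^ k ≤ 1 :=
    pow_le_one₀ (by positivity) (pow_le_one₀ rho_nonneg (rho_lt_one hS).le)
  have h3 : ‖S.rde k‖ ≤ ‖P‖ + ‖S.rde k - P‖ := by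
    calc ‖S.rde k‖ = ‖P + (S.rde k - P)‖ := by rw [add_sub_cancel]
      _ ≤ _ := norm_add_le _ _
  have h4 : 0 ≤ inducedNorm P (S.QN - P) * condNum P := by
    have := inducedNorm_nonneg P (S.QN - P)
    unfold condNum
    positivity
  have h5 := mul_le_mul_of_nonneg_left h2 h4
  unfold rdeBound
  linarith

end Riccati
end LQR

/-! ### Stage costs as quadratic forms, and propagation of gain errors. -/

namespace LQR
variable {n m : ℕ} {S : LQR n m}

/-- The cost-to-go matrix of the gains `G_{N-k}, …, G_{N-1}`. -/
def tailCost (S : LQR n m) (N : ℕ) (G : ℕ → Matrix (Fin m) (Fin n) ℝ) :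
    ℕ → Matrix (Fin n) (Fin n) ℝ
  | 0 => S.QN
  | k + 1 => S.costStep (G (N - (k + 1))) (tailCost S N G k)

theorem tailCost_congr {N : ℕ} {G G' : ℕ → Matrix (Fin m) (Fin n) ℝ} {k : ℕ}
    (h : ∀ j < k, G (N - (j + 1)) = G' (N - (j + 1))) :
    S.tailCost N G k = S.tailCost N G' k := by
  induction k with
  | zero => rfl
  | succ k ih => rw [tailCost, tailCost, ih fun j hj => h j (by omega), h k (by omega)]

theorem qf_costStep (K : Matrix (Fin m) (Fin n) ℝ) (X : Matrix (Fin n) (Fin n) ℝ)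
    (x : Fin n → ℝ) :
    qf (S.costStep K X) x = qf S.Q x + qf S.R (K *ᵥ x) + qf X (S.closedLoop K *ᵥ x) := by
  rw [costStep, qf_add, qf_add, qf_conj, qf_conj]
  ring

theorem rollout_succ (F : ℕ → Matrix (Fin m) (Fin n) ℝ) (x : Fin n → ℝ) (i : ℕ) :
    S.rollout F x (i + 1) = S.rollout (fun j => F (j + 1)) (S.closedLoop (F 0) *ᵥ x) i := by
  induction i with
  | zero =>
    simp [rollout, closedLoop, Matrix.sub_mulVec, Matrix.mulVec_neg, ← sub_eq_add_neg]
  | succ i ih => rw [rollout, ih]; rfl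

/-- Dynamic programming: splitting off the first step leaves a rollout from the next state with
shifted gains. Agreement of `F` with `G` is asked only on the steps that matter, so that the
candidate gain may replace the first one. -/
theorem rollout_cost (N k : ℕ) (hk : k ≤ N) (G F : ℕ → Matrix (Fin m) (Fin n) ℝ) (x : Fin n → ℝ)
    (hF : ∀ i < k, F i = G (N - k + i)) :
    (∑ i ∈ Finset.range k, (S.rollout F x i ⬝ᵥ (S.Q *ᵥ S.rollout F x i)
      + (-(F i *ᵥ S.rollout F x i)) ⬝ᵥ (S.R *ᵥ (-(F i *ᵥ S.rollout F x i)))))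
      + S.rollout F x k ⬝ᵥ (S.QN *ᵥ S.rollout F x k) = qf (S.tailCost N G k) x := by
  induction k generalizing F x with
  | zero => simp [rollout, tailCost, qf]
  | succ k ih =>
    rw [Finset.sum_range_succ']
    simp only [rollout_succ]
    have h := ih (by omega) (fun j => F (j + 1)) (S.closedLoop (F 0) *ᵥ x) fun i hi => by
      rw [hF (i + 1) (by omega)]; congr 1; omega
    have h0 := hF 0 (by omega)
    rw [add_zero] at h0
    rw [tailCost, qf_costStep, ← h0, ← h]
    simp only [rollout, Matrix.mulVec_neg, dotProduct_neg, neg_dotProduct, neg_neg, qf]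
    ring

theorem sampleCost_eq {N h : ℕ} (hh : h < N) (G : ℕ → Matrix (Fin m) (Fin n) ℝ)
    (K : Matrix (Fin m) (Fin n) ℝ) (x : Fin n → ℝ) :
    S.sampleCost N h G K x = qf (S.costStep K (S.tailCost N G (N - h - 1))) x := by
  have h1 := rollout_cost (S := S) N (N - h) (by omega) (Function.update G h K)
    (fun i => if i = 0 then K else G (h + i)) x (by
      intro i hi
      have : N - (N - h) + i = h + i := by omega
      rw [this]
      by_cases h0 : i = 0
      · simp [h0]
      · rw [if_neg h0, Function.update_of_ne (by omega)])
  have h2 : N - h = (N - h - 1) + 1 := by omega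
  rw [sampleCost]
  refine h1.trans ?_
  conv_lhs => rw [h2]
  rw [tailCost]
  have h3 : N - (N - h - 1 + 1) = h := by omega
  rw [h3, Function.update_self]
  congr 2
  refine tailCost_congr fun j hj => Function.update_of_ne (by omega) _ _

variable {P : Matrix (Fin n) (Fin n) ℝ}

theorem tailCost_posSemidef (hS : S.Admissible P) (N : ℕ) (G : ℕ → Matrix (Fin m) (Fin n) ℝ)
    (k : ℕ) : (S.tailCost N G k).PosSemidef := by
  induction k with
  | zero => exact QN_posSemidef hS
  | succ k ih =>
    exact costStep_posSemidef hS.posDef_Q.posSemidef hS.posDef_R.posSemidef ih _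

/-- A bound for the exact finite-horizon gains. -/
def gainBound (S : LQR n m) (P : Matrix (Fin n) (Fin n) ℝ) : ℝ :=
  ‖S.B‖ * ‖S.A‖ / lamMin S.R * (S.rdeBound P + 1)

/-- A bound for the closed-loop matrices. -/
def loopBound (S : LQR n m) (P : Matrix (Fin n) (Fin n) ℝ) : ℝ :=
  ‖S.A‖ + ‖S.B‖ * S.gainBound P

/-- A bound for the Hessians `R + Bᵀ P B`. -/
def hessBound (S : LQR n m) (P : Matrix (Fin n) (Fin n) ℝ) : ℝ :=
  ‖S.R‖ + ‖S.B‖ ^ 2 * (S.rdeBound P + 1)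

/-- A Lipschitz constant for the gain as a function of the cost-to-go matrix. -/
def gainLip (S : LQR n m) (P : Matrix (Fin n) (Fin n) ℝ) : ℝ :=
  ‖S.B‖ * S.loopBound P / lamMin S.R

/-- A growth constant for the propagation of errors through one stage. -/
def growth (S : LQR n m) (P : Matrix (Fin n) (Fin n) ℝ) : ℝ :=
  1 + S.hessBound P + S.hessBound P * S.gainLip P ^ 2 + S.loopBound P ^ 2

theorem hessBound_nonneg : 0 ≤ S.hessBound P := by
  have := rdeBound_nonneg (S := S) (P := P)
  unfold hessBound
  positivity

theorem norm_hess_le_of_norm_le {X : Matrix (Fin n) (Fin n) ℝ} (h : ‖X‖ ≤ S.rdeBound P + 1) :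
    ‖S.hess X‖ ≤ S.hessBound P := by
  refine (norm_hess_le _).trans ?_
  unfold hessBound
  gcongr

theorem norm_le_of_norm_sub_rde_le [NeZero n] (hS : S.Admissible P) (k : ℕ)
    {X : Matrix (Fin n) (Fin n) ℝ} (hd : ‖X - S.rde k‖ ≤ 1) : ‖X‖ ≤ S.rdeBound P + 1 := by
  calc ‖X‖ = ‖S.rde k + (X - S.rde k)‖ := by rw [add_sub_cancel]
    _ ≤ _ := (norm_add_le _ _).trans (add_le_add (norm_rde_le hS k) hd)

theorem one_le_growth : 1 ≤ S.growth P := by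
  have := hessBound_nonneg (S := S) (P := P)
  have : 0 ≤ S.hessBound P * S.gainLip P ^ 2 := by positivity
  have := sq_nonneg (S.loopBound P)
  unfold growth
  linarith

section Bounds
variable [NeZero m]

theorem gainBound_nonneg (hS : S.Admissible P) : 0 ≤ S.gainBound P := by
  have := lamMin_pos hS.posDef_R
  have := rdeBound_nonneg (S := S) (P := P)
  unfold gainBound
  positivity

theorem loopBound_nonneg (hS : S.Admissible P) : 0 ≤ S.loopBound P := by
  have := gainBound_nonneg hS
  unfold loopBound
  positivity

theorem gainLip_nonneg (hS : S.Admissible P) : 0 ≤ S.gainLip P := by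
  have := lamMin_pos hS.posDef_R
  have := loopBound_nonneg hS
  unfold gainLip
  positivity

theorem norm_gain_le_of_norm_le (hS : S.Admissible P) {X : Matrix (Fin n) (Fin n) ℝ}
    (hX : X.PosSemidef) (h : ‖X‖ ≤ S.rdeBound P + 1) : ‖S.gain X‖ ≤ S.gainBound P := by
  have := lamMin_pos hS.posDef_R
  refine (norm_gain_le hS.posDef_R hX).trans ?_
  unfold gainBound
  gcongr

theorem norm_closedLoop_gain_le (hS : S.Admissible P) {X : Matrix (Fin n) (Fin n) ℝ}
    (hX : X.PosSemidef) (h : ‖X‖ ≤ S.rdeBound P + 1) :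
    ‖S.closedLoop (S.gain X)‖ ≤ S.loopBound P := by
  refine (norm_closedLoop_le _).trans ?_
  unfold loopBound
  gcongr
  exact norm_gain_le_of_norm_le hS hX h

theorem norm_gain_sub_rde_le [NeZero n] (hS : S.Admissible P) (k : ℕ)
    {X : Matrix (Fin n) (Fin n) ℝ} (hX : X.PosSemidef) :
    ‖S.gain X - S.gain (S.rde k)‖ ≤ S.gainLip P * ‖X - S.rde k‖ := by
  have := lamMin_pos hS.posDef_R
  refine (norm_gain_sub_le hS.posDef_R (rde_posSemidef hS k) hX).trans ?_
  unfold gainLip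
  gcongr
  exact norm_closedLoop_gain_le hS (rde_posSemidef hS k) ((norm_rde_le hS k).trans (by linarith))

/-- Each stage multiplies the error by at most `growth P`. The smallness hypothesis on `η` keeps
every tail within distance `1` of the exact iterate, where the uniform bounds on Hessians and gains
hold. -/
theorem norm_tailCost_sub_rde_le [NeZero n] (hS : S.Admissible P) {N : ℕ}
    {G : ℕ → Matrix (Fin m) (Fin n) ℝ} {η : ℝ} (hη : 0 ≤ η) (hηN : η * S.growth P ^ N ≤ 1)
    {k : ℕ} (hk : k ≤ N)
    (hG : ∀ j < k, ‖G (N - (j + 1)) - S.gain (S.tailCost N G j)‖ ≤ η) :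
    ‖S.tailCost N G k - S.rde k‖ ≤ η * S.growth P ^ k := by
  have hL := one_le_growth (S := S) (P := P)
  induction k with
  | zero => simpa [tailCost, rde] using hη
  | succ k ih =>
    have ih := ih (by omega) fun j hj => hG j (by omega)
    set X := S.tailCost N G k with hX
    set K := G (N - (k + 1)) with hK
    have hXp : X.PosSemidef := tailCost_posSemidef hS N G k
    have hpow : ∀ j ≤ N, η * S.growth P ^ j ≤ 1 := fun j hj =>
      (mul_le_mul_of_nonneg_left (pow_le_pow_right₀ hL hj) hη).trans hηN
    have hd1 : ‖X - S.rde k‖ ≤ 1 := ih.trans (hpow k (by omega))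
    have hη1 : η ≤ 1 := by simpa using hpow 0 (by omega)
    have hη2 : η ≤ η * S.growth P ^ k := le_mul_of_one_le_right hη (one_le_pow₀ hL)
    have hH := norm_hess_le_of_norm_le (S := S) (P := P) (norm_le_of_norm_sub_rde_le hS k hd1)
    have hHn := hessBound_nonneg (S := S) (P := P)
    have hK1 : ‖K - S.gain X‖ ≤ η := hG k (by omega)
    have hK2 := norm_gain_sub_rde_le hS k hXp
    have hφ := norm_closedLoop_gain_le hS (rde_posSemidef hS k)
      ((norm_rde_le hS k).trans (by linarith))
    -- Both cost steps are compared with the one that uses the exact gain on the perturbed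
    -- cost-to-go `X`. Two completed squares appear, around the optimal gain for `X`, and one
    -- conjugated difference.
    have key : S.tailCost N G (k + 1) - S.rde (k + 1)
        = (K - S.gain X)ᵀ * S.hess X * (K - S.gain X)
          - (S.gain (S.rde k) - S.gain X)ᵀ * S.hess X * (S.gain (S.rde k) - S.gain X)
          + (S.closedLoop (S.gain (S.rde k)))ᵀ * (X - S.rde k)
            * S.closedLoop (S.gain (S.rde k)) := by
      rw [tailCost, ← hX, ← hK, rde, costStep_eq hS.posDef_R hXp K, ← costStep_sub,
        costStep_eq hS.posDef_R hXp (S.gain (S.rde k))]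
      abel
    have hsq : ∀ (Y : Matrix (Fin m) (Fin n) ℝ) (c : ℝ), ‖Y‖ ≤ c →
        ‖Yᵀ * S.hess X * Y‖ ≤ S.hessBound P * c ^ 2 := by
      intro Y c hc
      refine (norm_mul3_le _ _ _).trans ?_
      rw [norm_transpose]
      calc ‖Y‖ * ‖S.hess X‖ * ‖Y‖ ≤ c * S.hessBound P * c := by
            have := (norm_nonneg Y).trans hc
            gcongr
        _ = _ := by ring
    have h1 := hsq _ _ hK1
    have h2 := hsq (S.gain (S.rde k) - S.gain X) (S.gainLip P * ‖X - S.rde k‖)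
      (by rw [norm_sub_rev]; exact hK2)
    have h3 : ‖(S.closedLoop (S.gain (S.rde k)))ᵀ * (X - S.rde k)
            * S.closedLoop (S.gain (S.rde k))‖ ≤ S.loopBound P ^ 2 * ‖X - S.rde k‖ := by
      refine (norm_mul3_le _ _ _).trans ?_
      rw [norm_transpose]
      have := loopBound_nonneg hS
      calc _ ≤ S.loopBound P * ‖X - S.rde k‖ * S.loopBound P := by gcongr
        _ = _ := by ring
    rw [key]
    set D := ‖X - S.rde k‖ with hD
    have hD0 : 0 ≤ D := norm_nonneg _
    set e := η * S.growth P ^ k with he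
    -- The quadratic contributions are absorbed into linear ones because `η` and `D` are at most
    -- `1`; hence a linear recursion.
    have h4 : S.hessBound P * η ^ 2 ≤ S.hessBound P * e := by
      have : η ^ 2 ≤ e := by nlinarith
      gcongr
    have h5 : S.hessBound P * (S.gainLip P * D) ^ 2 ≤ S.hessBound P * S.gainLip P ^ 2 * e := by
      have : D ^ 2 ≤ e := by nlinarith
      rw [mul_pow, ← mul_assoc]
      gcongr
    have h6 : S.loopBound P ^ 2 * D ≤ S.loopBound P ^ 2 * e := by gcongr
    calc _ ≤ S.hessBound P * e + S.hessBound P * S.gainLip P ^ 2 * e + S.loopBound P ^ 2 * e := by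
          refine (norm_add_le _ _).trans (add_le_add ((norm_sub_le _ _).trans ?_) (h3.trans h6))
          exact add_le_add (h1.trans h4) (h2.trans h5)
      _ ≤ e * S.growth P := by
          have : 0 ≤ e := hD0.trans ih
          unfold growth
          nlinarith
      _ = _ := by rw [he, pow_succ, mul_assoc]

end Bounds

end LQR

/-! ### Second moments of a uniform direction. -/

section Sphere
variable {E : Type*} [NormedAddCommGroup E] [InnerProductSpace ℝ E]

/-- A linear isometry acting on the unit sphere. -/
def sphereMap (e : E ≃ₗᵢ[ℝ] E) (u : Metric.sphere (0 : E) 1) : Metric.sphere (0 : E) 1 :=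
  ⟨e u.1, by simp [e.norm_map]⟩

theorem continuous_sphereMap (e : E ≃ₗᵢ[ℝ] E) : Continuous (sphereMap e) :=
  (e.continuous.comp continuous_subtype_val).subtype_mk _

variable [MeasurableSpace E] [BorelSpace E]

/-- The surface measure of a set is a multiple of the volume of the cone over it, and an isometry
preserves volume and maps cones to cones. -/
theorem map_sphereMap_toSphere [FiniteDimensional ℝ E] (e : E ≃ₗᵢ[ℝ] E) :
    (volume : Measure E).toSphere.map (sphereMap e) = (volume : Measure E).toSphere := by
  have hm : Measurable (sphereMap e) := (continuous_sphereMap e).measurable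
  refine Measure.ext fun s hs => ?_
  rw [Measure.map_apply hm hs, Measure.toSphere_apply' _ (hm hs), Measure.toSphere_apply' _ hs]
  congr 1
  conv_rhs => rw [← (e.measurePreserving).measure_preimage_equiv (f := e.toMeasurableEquiv)]
  congr 1
  ext x
  simp only [Set.mem_smul, Set.mem_image, Set.mem_preimage]
  constructor
  · rintro ⟨t, ht, _, ⟨u, hu, rfl⟩, rfl⟩
    exact ⟨t, ht, _, ⟨_, hu, rfl⟩, by simp [sphereMap]⟩
  · rintro ⟨t, ht, _, ⟨u, hu, rfl⟩, hx⟩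
    refine ⟨t, ht, _, ⟨sphereMap e.symm u, ?_, rfl⟩, ?_⟩
    · have : sphereMap e (sphereMap e.symm u) = u := by ext; simp [sphereMap]
      rwa [this]
    · apply e.injective
      simpa [sphereMap] using hx

open scoped RealInnerProductSpace

variable (σ : Measure (Metric.sphere (0 : E) 1))

/-- A reflection exchanges two vectors of equal norm, so invariance makes the second moment a
function of the norm alone. -/
theorem integral_inner_sq_eq (hσ : ∀ e : E ≃ₗᵢ[ℝ] E, σ.map (sphereMap e) = σ) {v w : E}
    (h : ‖v‖ = ‖w‖) : ∫ u, ⟪v, u.1⟫ ^ 2 ∂σ = ∫ u, ⟪w, u.1⟫ ^ 2 ∂σ := by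
  set e := (ℝ ∙ (v - w))ᗮ.reflection with he
  have hev : e v = w := Submodule.reflection_sub h
  have hc : Continuous fun u : Metric.sphere (0 : E) 1 => ⟪w, u.1⟫ ^ 2 := by fun_prop
  conv_rhs => rw [← hσ e]
  rw [integral_map (continuous_sphereMap e).measurable.aemeasurable hc.aestronglyMeasurable]
  refine integral_congr_ae (Eventually.of_forall fun u => ?_)
  simp only [sphereMap]
  rw [← hev, e.inner_map_map]

variable [FiniteDimensional ℝ E] [IsProbabilityMeasure σ]

theorem integrable_sphere {f : Metric.sphere (0 : E) 1 → ℝ} (hf : Continuous f) :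
    Integrable f σ :=
  hf.integrable_of_hasCompactSupport (HasCompactSupport.of_compactSpace f)

/-- All members of an orthonormal basis have the same second moment, and these moments add up to `1`
by Parseval. -/
theorem finrank_mul_integral_inner_sq (hσ : ∀ e : E ≃ₗᵢ[ℝ] E, σ.map (sphereMap e) = σ) (v : E) :
    (Module.finrank ℝ E : ℝ) * ∫ u, ⟪v, u.1⟫ ^ 2 ∂σ = ‖v‖ ^ 2 := by
  set b := stdOrthonormalBasis ℝ E
  have h1 : ∀ i, ∫ u, ⟪v, u.1⟫ ^ 2 ∂σ = ‖v‖ ^ 2 * ∫ u, ⟪b i, u.1⟫ ^ 2 ∂σ := by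
    intro i
    rw [← integral_const_mul, integral_inner_sq_eq σ hσ (w := ‖v‖ • b i) (by
      simp [norm_smul, b.orthonormal.1 i])]
    refine integral_congr_ae (Eventually.of_forall fun u => ?_)
    simp [inner_smul_left, mul_pow]
  have h2 : ∑ i, ∫ u, ⟪b i, u.1⟫ ^ 2 ∂σ = 1 := by
    rw [← integral_finsetSum _ fun i _ => integrable_sphere σ (by fun_prop)]
    have : ∀ u : Metric.sphere (0 : E) 1, ∑ i, ⟪b i, u.1⟫ ^ 2 = 1 := by
      intro u
      rw [b.sum_sq_inner_right]
      simp
    simp [this]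
  calc (Module.finrank ℝ E : ℝ) * ∫ u, ⟪v, u.1⟫ ^ 2 ∂σ
      = ∑ i : Fin (Module.finrank ℝ E), ∫ u, ⟪v, u.1⟫ ^ 2 ∂σ := by simp
    _ = ∑ i, ‖v‖ ^ 2 * ∫ u, ⟪b i, u.1⟫ ^ 2 ∂σ := Finset.sum_congr rfl fun i _ => h1 i
    _ = ‖v‖ ^ 2 := by rw [← Finset.mul_sum, h2, mul_one]

theorem finrank_mul_integral_inner_mul (hσ : ∀ e : E ≃ₗᵢ[ℝ] E, σ.map (sphereMap e) = σ)
    (v w : E) :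
    (Module.finrank ℝ E : ℝ) * ∫ u, ⟪v, u.1⟫ * ⟪w, u.1⟫ ∂σ = ⟪v, w⟫ := by
  have h1 := finrank_mul_integral_inner_sq σ hσ (v + w)
  have h2 := finrank_mul_integral_inner_sq σ hσ (v - w)
  have h3 : ∫ u, ⟪v, u.1⟫ * ⟪w, u.1⟫ ∂σ
      = (1 / 4) * ((∫ u, ⟪v + w, u.1⟫ ^ 2 ∂σ) - ∫ u, ⟪v - w, u.1⟫ ^ 2 ∂σ) := by
    rw [← integral_sub (integrable_sphere σ (by fun_prop)) (integrable_sphere σ (by fun_prop)),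
      ← integral_const_mul]
    refine integral_congr_ae (Eventually.of_forall fun u => ?_)
    simp only [inner_add_left, inner_sub_left]
    ring
  rw [h3]
  have h4 := norm_add_sq_real v w
  have h5 := norm_sub_sq_real v w
  linear_combination (1 / 4) * h1 - (1 / 4) * h2 + (1 / 4) * h4 - (1 / 4) * h5

/-- Mean squared distance to the target after one step along a random direction. -/
theorem integral_norm_sub_smul_sq (hσ : ∀ e : E ≃ₗᵢ[ℝ] E, σ.map (sphereMap e) = σ)
    (v w : E) (c : ℝ) :
    ∫ u, ‖v - (c * (Module.finrank ℝ E : ℝ) * ⟪w, u.1⟫) • u.1‖ ^ 2 ∂σ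
      = ‖v‖ ^ 2 - 2 * c * ⟪v, w⟫ + c ^ 2 * (Module.finrank ℝ E : ℝ) * ‖w‖ ^ 2 := by
  set d := (Module.finrank ℝ E : ℝ)
  have h : ∀ u : Metric.sphere (0 : E) 1, ‖v - (c * d * ⟪w, u.1⟫) • u.1‖ ^ 2
      = ‖v‖ ^ 2 - (2 * c * d) * (⟪v, u.1⟫ * ⟪w, u.1⟫)
        + (c ^ 2 * d ^ 2) * (⟪w, u.1⟫ * ⟪w, u.1⟫) := by
    intro u
    rw [norm_sub_sq_real, norm_smul, inner_smul_right, mul_pow, Real.norm_eq_abs, sq_abs]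
    have : ‖u.1‖ = 1 := by simp
    rw [this]
    ring
  simp only [h]
  have i1 := integrable_sphere σ (f := fun u => (2 * c * d) * (⟪v, u.1⟫ * ⟪w, u.1⟫)) (by fun_prop)
  have i2 := integrable_sphere σ (f := fun u => (c ^ 2 * d ^ 2) * (⟪w, u.1⟫ * ⟪w, u.1⟫))
    (by fun_prop)
  have i3 : Integrable (fun u : Metric.sphere (0 : E) 1 =>
      ‖v‖ ^ 2 - (2 * c * d) * (⟪v, u.1⟫ * ⟪w, u.1⟫)) σ := integrable_sphere σ (by fun_prop)
  rw [integral_add i3 i2, integral_sub (integrable_const _) i1,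
    integral_const_mul, integral_const_mul]
  have h1 := finrank_mul_integral_inner_mul σ hσ v w
  have h2 := finrank_mul_integral_inner_mul σ hσ w w
  rw [real_inner_self_eq_norm_sq] at h2
  simp only [integral_const, probReal_univ, one_smul]
  linear_combination (-2 * c) * h1 + (c ^ 2 * d) * h2

end Sphere

theorem map_sphereMap_uniformDir {n m : ℕ}
    (e : EuclideanSpace ℝ (Fin m × Fin n) ≃ₗᵢ[ℝ] EuclideanSpace ℝ (Fin m × Fin n)) :
    (uniformDir n m).map (sphereMap e) = uniformDir n m := by
  simp only [uniformDir]
  rw [Measure.map_smul, map_sphereMap_toSphere]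

open scoped RealInnerProductSpace

/-! ### Gains as Euclidean vectors, and the exact two-point difference. -/

section Vec
variable {n m : ℕ}

/-- A gain as a vector of the Euclidean space of its entries. -/
def gainVec (X : Matrix (Fin m) (Fin n) ℝ) : EuclideanSpace ℝ (Fin m × Fin n) :=
  WithLp.toLp 2 fun p => X p.1 p.2

theorem norm_gainVec_sq (X : Matrix (Fin m) (Fin n) ℝ) : ‖gainVec X‖ ^ 2 = fro2 X := by
  rw [EuclideanSpace.norm_sq_eq, Fintype.sum_prod_type]
  simp [gainVec, fro2]

theorem gainVec_sub (X Y : Matrix (Fin m) (Fin n) ℝ) :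
    gainVec (X - Y) = gainVec X - gainVec Y := rfl

theorem gainVec_smul (c : ℝ) (X : Matrix (Fin m) (Fin n) ℝ) :
    gainVec (c • X) = c • gainVec X := rfl

theorem gainVec_toMatrix (u : Dir n m) : gainVec u.toMatrix = u.1 := rfl

theorem inner_gainVec_vecMulVec (a : Fin m → ℝ) (x : Fin n → ℝ) (Y : Matrix (Fin m) (Fin n) ℝ) :
    ⟪gainVec (Matrix.vecMulVec a x), gainVec Y⟫ = a ⬝ᵥ (Y *ᵥ x) := by
  rw [gainVec, gainVec, EuclideanSpace.inner_toLp_toLp]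
  simp only [dotProduct, Fintype.sum_prod_type, Matrix.vecMulVec_apply, Matrix.mulVec,
    Finset.mul_sum]
  refine Finset.sum_congr rfl fun i _ => Finset.sum_congr rfl fun j _ => ?_
  simp
  ring

theorem norm_gainVec_vecMulVec_sq (a : Fin m → ℝ) (x : Fin n → ℝ) :
    ‖gainVec (Matrix.vecMulVec a x)‖ ^ 2 = (a ⬝ᵥ a) * (x ⬝ᵥ x) := by
  rw [norm_gainVec_sq, fro2]
  simp only [dotProduct, Matrix.vecMulVec_apply, Finset.sum_mul_sum]
  refine Finset.sum_congr rfl fun i _ => Finset.sum_congr rfl fun j _ => by ring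

/-- The even terms cancel, so the difference is exactly linear in `U` whatever the radius, and
vanishes at `X = 0`. There is neither smoothing bias nor additive noise. -/
theorem qf_mulVec_add_sub (H : Matrix (Fin m) (Fin m) ℝ) (hH : Hᵀ = H)
    (X U : Matrix (Fin m) (Fin n) ℝ) (r : ℝ) (x : Fin n → ℝ) :
    qf H ((X + r • U) *ᵥ x) - qf H ((X - r • U) *ᵥ x)
      = 4 * r * ((H *ᵥ (X *ᵥ x)) ⬝ᵥ (U *ᵥ x)) := by
  have hs : ∀ v w : Fin m → ℝ, v ⬝ᵥ (H *ᵥ w) = (H *ᵥ v) ⬝ᵥ w := by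
    intro v w
    rw [Matrix.dotProduct_mulVec, ← Matrix.mulVec_transpose, hH]
  simp only [qf, Matrix.add_mulVec, Matrix.sub_mulVec, Matrix.smul_mulVec, Matrix.mulVec_add,
    Matrix.mulVec_sub, Matrix.mulVec_smul, add_dotProduct, sub_dotProduct, dotProduct_add,
    dotProduct_sub, smul_dotProduct, dotProduct_smul, smul_eq_mul, hs]
  rw [dotProduct_comm (H *ᵥ (U *ᵥ x)) (X *ᵥ x), hs]
  ring

end Vec

/-! ### Second moments of the initial state. -/

section InitialLaw
variable {n : ℕ} {D : Measure (EuclideanSpace ℝ (Fin n))} {Sigma0 : Matrix (Fin n) (Fin n) ℝ}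
  {Cm : ℝ}

theorem InitialLaw.dot_self_le (hD : InitialLaw D Sigma0 Cm) :
    ∀ᵐ x ∂D, x.ofLp ⬝ᵥ x.ofLp ≤ Cm := by
  filter_upwards [hD.bounded] with x hx
  rwa [← norm_sq_toLp]

theorem InitialLaw.integrable_qf (hD : InitialLaw D Sigma0 Cm) (X : Matrix (Fin n) (Fin n) ℝ) :
    Integrable (fun x : EuclideanSpace ℝ (Fin n) => qf X x.ofLp) D := by
  have := hD.prob
  refine Integrable.of_bound (C := ‖X‖ * Cm) ?_ ?_
  · refine Continuous.aestronglyMeasurable ?_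
    unfold qf
    fun_prop
  · filter_upwards [hD.dot_self_le] with x hx
    exact (abs_dot_mulVec_le X x.ofLp).trans (by gcongr)

theorem InitialLaw.integrable_mul (hD : InitialLaw D Sigma0 Cm) (i j : Fin n) :
    Integrable (fun x : EuclideanSpace ℝ (Fin n) => x i * x j) D := by
  have h := hD.integrable_qf (Matrix.single i j 1)
  refine h.congr (Eventually.of_forall fun x => ?_)
  simp [qf, Matrix.single_mulVec, dotProduct, Function.update_apply]

/-- The expectation is the trace of `X Σ₀ Xᵀ`, that is, the sum of the forms of `Σ₀` over the rows
of `X`. -/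
theorem InitialLaw.integral_mulVec_dot_self (hD : InitialLaw D Sigma0 Cm) {m : ℕ}
    (X : Matrix (Fin m) (Fin n) ℝ) :
    lamMin Sigma0 * fro2 X ≤ ∫ x, (X *ᵥ x.ofLp) ⬝ᵥ (X *ᵥ x.ofLp) ∂D := by
  have h1 : ∫ x, (X *ᵥ x.ofLp) ⬝ᵥ (X *ᵥ x.ofLp) ∂D = ∑ i, qf Sigma0 (X i) := by
    have : ∀ x : EuclideanSpace ℝ (Fin n), (X *ᵥ x.ofLp) ⬝ᵥ (X *ᵥ x.ofLp)
        = ∑ i, ∑ j, ∑ k, X i j * X i k * (x j * x k) := by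
      intro x
      simp only [dotProduct, Matrix.mulVec, Finset.sum_mul_sum]
      refine Finset.sum_congr rfl fun i _ => Finset.sum_congr rfl fun j _ =>
        Finset.sum_congr rfl fun k _ => by ring
    simp only [this]
    rw [integral_finsetSum _ fun i _ => integrable_finsetSum _ fun j _ =>
      integrable_finsetSum _ fun k _ => (hD.integrable_mul j k).const_mul _]
    refine Finset.sum_congr rfl fun i _ => ?_
    rw [integral_finsetSum _ fun j _ => integrable_finsetSum _ fun k _ =>
      (hD.integrable_mul j k).const_mul _]
    simp only [qf, dotProduct, Matrix.mulVec, Finset.mul_sum]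
    refine Finset.sum_congr rfl fun j _ => ?_
    rw [integral_finsetSum _ fun k _ => (hD.integrable_mul j k).const_mul _]
    refine Finset.sum_congr rfl fun k _ => ?_
    rw [integral_const_mul, hD.second_moment]
    ring
  rw [h1, fro2, Finset.mul_sum]
  refine Finset.sum_le_sum fun i _ => ?_
  have := lamMin_mul_le hD.posDef.posSemidef (X i)
  simpa [dotProduct, sq] using this

end InitialLaw

/-! ### Mean-square contraction of one iteration. -/

section Step
variable {n m : ℕ}

/-- One inner-loop step, as a map on the deviation from the optimal gain; `H` is the Hessian. -/
def errStep (H : Matrix (Fin m) (Fin m) ℝ) (α r : ℝ) (X : Matrix (Fin m) (Fin n) ℝ)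
    (y : EuclideanSpace ℝ (Fin n) × Dir n m) : Matrix (Fin m) (Fin n) ℝ :=
  X - α • ((((m : ℝ) * n) / (2 * r) * (qf H ((X + r • y.2.toMatrix) *ᵥ y.1.ofLp)
    - qf H ((X - r • y.2.toMatrix) *ᵥ y.1.ofLp))) • y.2.toMatrix)

theorem continuous_errStep (H : Matrix (Fin m) (Fin m) ℝ) (α r : ℝ)
    (X : Matrix (Fin m) (Fin n) ℝ) : Continuous fun y => fro2 (errStep H α r X y) := by
  have hU : Continuous fun y : EuclideanSpace ℝ (Fin n) × Dir n m => y.2.toMatrix := by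
    refine continuous_matrix fun i j => ?_
    simp only [Dir.toMatrix, Matrix.of_apply]
    fun_prop
  have hx : Continuous fun y : EuclideanSpace ℝ (Fin n) × Dir n m => y.1.ofLp := by fun_prop
  have h1 := ((continuous_const (y := X)).add (hU.const_smul r)).matrix_mulVec hx
  have h2 := ((continuous_const (y := X)).sub (hU.const_smul r)).matrix_mulVec hx
  have hq : Continuous fun v : Fin m → ℝ => qf H v := by unfold qf; fun_prop
  have h3 : Continuous fun y => errStep H α r X y :=
    continuous_const.sub (((continuous_const.mul ((hq.comp h1).sub (hq.comp h2))).smul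
      hU).const_smul α)
  unfold fro2
  exact continuous_finsetSum _ fun i _ => continuous_finsetSum _ fun j _ =>
    (h3.matrix_elem i j).pow 2

theorem fro2_errStep {H : Matrix (Fin m) (Fin m) ℝ} (hH : Hᵀ = H) {r : ℝ} (hr : 0 < r) (α : ℝ)
    (X : Matrix (Fin m) (Fin n) ℝ) (y : EuclideanSpace ℝ (Fin n) × Dir n m) :
    fro2 (errStep H α r X y) = ‖gainVec X - ((2 * α) * ((m : ℝ) * n)
      * ⟪gainVec (Matrix.vecMulVec (H *ᵥ (X *ᵥ y.1.ofLp)) y.1.ofLp), y.2.1⟫) • y.2.1‖ ^ 2 := by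
  rw [← norm_gainVec_sq, errStep, gainVec_sub, gainVec_smul, gainVec_smul, gainVec_toMatrix,
    qf_mulVec_add_sub H hH, ← gainVec_toMatrix y.2, inner_gainVec_vecMulVec, smul_smul]
  have hs : ∀ t : ℝ, α * ((m : ℝ) * n / (2 * r) * (4 * r * t)) = 2 * α * (m * n) * t := by
    intro t
    field_simp
    ring
  rw [hs]

variable [NeZero n] [NeZero m] {D : Measure (EuclideanSpace ℝ (Fin n))}
  {Sigma0 : Matrix (Fin n) (Fin n) ℝ} {Cm : ℝ}

/-- For a fixed initial state the mean descent has size `4 α l |X x|²`, and the second-order term is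
also proportional to `|X x|²`. The stepsize condition lets the latter consume at most half of the
descent. -/
theorem integral_fro2_errStep_le {H : Matrix (Fin m) (Fin m) ℝ} (hH : Hᵀ = H) {l h : ℝ}
    (hl : ∀ v, l * (v ⬝ᵥ v) ≤ qf H v) (hh : ‖H‖ ≤ h) {α r : ℝ} (hα : 0 < α) (hr : 0 < r)
    (hαl : 2 * α * (m * n) * h ^ 2 * Cm ≤ l) (X : Matrix (Fin m) (Fin n) ℝ)
    {x : EuclideanSpace ℝ (Fin n)} (hx : x.ofLp ⬝ᵥ x.ofLp ≤ Cm) :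
    ∫ u, fro2 (errStep H α r X (x, u)) ∂(uniformDir n m)
      ≤ fro2 X - 2 * α * l * ((X *ᵥ x.ofLp) ⬝ᵥ (X *ᵥ x.ofLp)) := by
  have := isProbabilityMeasure_uniformDir n m
  have hd : (Module.finrank ℝ (EuclideanSpace ℝ (Fin m × Fin n)) : ℝ) = (m : ℝ) * n := by simp
  simp only [fro2_errStep hH hr]
  rw [← hd, integral_norm_sub_smul_sq _ map_sphereMap_uniformDir, hd, norm_gainVec_sq,
    real_inner_comm, inner_gainVec_vecMulVec, norm_gainVec_vecMulVec_sq, dotProduct_comm]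
  set v := X *ᵥ x.ofLp
  have h1 := hl v
  have h2 := mulVec_dot_self_le H v
  have h3 := dot_self_nonneg v
  have h4 := dot_self_nonneg x.ofLp
  have h5 : (H *ᵥ v) ⬝ᵥ (H *ᵥ v) * (x.ofLp ⬝ᵥ x.ofLp) ≤ h ^ 2 * (v ⬝ᵥ v) * Cm := by
    refine mul_le_mul (h2.trans ?_) hx h4 (by positivity)
    gcongr
  have h6 : (2 * α) ^ 2 * (m * n) * ((H *ᵥ v) ⬝ᵥ (H *ᵥ v) * (x.ofLp ⬝ᵥ x.ofLp))
      ≤ (2 * α) * l * (v ⬝ᵥ v) := by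
    calc _ ≤ (2 * α) ^ 2 * (m * n) * (h ^ 2 * (v ⬝ᵥ v) * Cm) := by gcongr
      _ = (2 * α) * (v ⬝ᵥ v) * (2 * α * (m * n) * h ^ 2 * Cm) := by ring
      _ ≤ (2 * α) * (v ⬝ᵥ v) * l := by gcongr
      _ = _ := by ring
  have h7 : 2 * (2 * α) * (l * (v ⬝ᵥ v)) ≤ 2 * (2 * α) * qf H v := by gcongr
  have h8 : v ⬝ᵥ (H *ᵥ v) = qf H v := rfl
  rw [h8]
  linarith

/-- One initial state sees only the direction `x`; averaging over `D` replaces `|X x|²` by at least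
`lamMin Sigma0 * fro2 X` and so gives a true contraction. -/
theorem lintegral_fro2_errStep_le (hD : InitialLaw D Sigma0 Cm) {H : Matrix (Fin m) (Fin m) ℝ}
    (hH : Hᵀ = H) {l h : ℝ} (hl0 : 0 < l) (hl : ∀ v, l * (v ⬝ᵥ v) ≤ qf H v) (hh : ‖H‖ ≤ h)
    {α r : ℝ} (hα : 0 < α) (hr : 0 < r)
    (hαl : 2 * α * (m * n) * h ^ 2 * Cm ≤ l) (X : Matrix (Fin m) (Fin n) ℝ) :
    ∫⁻ y, ENNReal.ofReal (fro2 (errStep H α r X y)) ∂(D.prod (uniformDir n m))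
      ≤ ENNReal.ofReal (1 - 2 * α * l * lamMin Sigma0) * ENNReal.ofReal (fro2 X) := by
  have := isProbabilityMeasure_uniformDir n m
  have := hD.prob
  have hc := continuous_errStep H α r X
  rw [lintegral_prod _ (hc.measurable.ennreal_ofReal.aemeasurable)]
  have h1 : ∀ᵐ x ∂D, ∫⁻ u, ENNReal.ofReal (fro2 (errStep H α r X (x, u))) ∂(uniformDir n m)
      ≤ ENNReal.ofReal (fro2 X - 2 * α * l * ((X *ᵥ x.ofLp) ⬝ᵥ (X *ᵥ x.ofLp))) := by
    filter_upwards [hD.dot_self_le] with x hx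
    have hi : Integrable (fun u => fro2 (errStep H α r X (x, u))) (uniformDir n m) :=
      integrable_sphere _ (hc.comp (Continuous.prodMk_right x))
    rw [← ofReal_integral_eq_lintegral_ofReal hi
      (Eventually.of_forall fun u => fro2_nonneg _)]
    exact ENNReal.ofReal_le_ofReal (integral_fro2_errStep_le hH hl hh hα hr hαl X hx)
  -- Nonnegativity keeps `ENNReal.ofReal` from truncating, so that the integral over `x` can be
  -- taken in the reals; it holds because the expression dominates the mean of a square.
  have h2 : ∀ᵐ x ∂D, 0 ≤ fro2 X - 2 * α * l * ((X *ᵥ x.ofLp) ⬝ᵥ (X *ᵥ x.ofLp)) := by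
    filter_upwards [hD.dot_self_le] with x hx
    exact (integral_nonneg fun u => fro2_nonneg _).trans
      (integral_fro2_errStep_le hH hl hh hα hr hαl X hx)
  have h3 : Integrable (fun x : EuclideanSpace ℝ (Fin n) =>
      (X *ᵥ x.ofLp) ⬝ᵥ (X *ᵥ x.ofLp)) D := by
    refine (hD.integrable_qf (Xᵀ * X)).congr (Eventually.of_forall fun x => ?_)
    rw [← Matrix.mul_one Xᵀ]
    simp only [qf_conj, qf_one]
  refine (lintegral_mono_ae h1).trans ?_
  have h6 : Integrable (fun x : EuclideanSpace ℝ (Fin n) =>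
      fro2 X - 2 * α * l * ((X *ᵥ x.ofLp) ⬝ᵥ (X *ᵥ x.ofLp))) D :=
    (integrable_const _).sub (h3.const_mul _)
  rw [← ofReal_integral_eq_lintegral_ofReal h6 h2,
    integral_sub (integrable_const _) (h3.const_mul _), integral_const_mul, integral_const,
    probReal_univ, one_smul, ← ENNReal.ofReal_mul' (fro2_nonneg X)]
  refine ENNReal.ofReal_le_ofReal ?_
  have h4 := hD.integral_mulVec_dot_self X
  have h5 : 2 * α * l * (lamMin Sigma0 * fro2 X)
      ≤ 2 * α * l * ∫ x, (X *ᵥ x.ofLp) ⬝ᵥ (X *ᵥ x.ofLp) ∂D := by gcongr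
  linarith

end Step

/-! ### Resampling one coordinate of an infinite product. -/

section Resample
variable {ι : Type*} [DecidableEq ι] {X : ι → Type*} [∀ i, MeasurableSpace (X i)]
  (μ : ∀ i, Measure (X i)) [∀ i, IsProbabilityMeasure (μ i)]

theorem map_update_infinitePi (j : ι) :
    ((Measure.infinitePi μ).prod (μ j)).map (fun p => Function.update p.1 j p.2)
      = Measure.infinitePi μ := by
  refine Measure.eq_infinitePi μ fun s t ht => ?_
  rw [Measure.map_apply measurable_update' (MeasurableSet.pi s.countable_toSet fun i _ => ht i)]
  have h : (fun p : (∀ i, X i) × X j => Function.update p.1 j p.2) ⁻¹' (Set.pi s t)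
      = (Set.pi (s.erase j : Finset ι) t) ×ˢ (if j ∈ s then t j else Set.univ) := by
    ext ⟨ω, y⟩
    simp only [Set.mem_preimage, Set.mem_pi, Set.mem_prod, Finset.mem_coe, Finset.mem_erase]
    constructor
    · intro h
      refine ⟨fun i hi => ?_, ?_⟩
      · have := h i hi.2
        rwa [Function.update_of_ne hi.1] at this
      · split_ifs with hj
        · simpa using h j hj
        · trivial
    · rintro ⟨h1, h2⟩ i hi
      by_cases hij : i = j
      · subst hij
        simpa [hi] using h2
      · rw [Function.update_of_ne hij]
        exact h1 i ⟨hij, hi⟩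
  rw [h, Measure.prod_prod, Measure.infinitePi_pi _ fun i _ => ht i]
  split_ifs with hj
  · rw [Finset.prod_erase_mul _ _ hj]
  · rw [Finset.erase_eq_of_notMem hj, measure_univ, mul_one]

/-- This replaces conditional expectation: a quantity independent of coordinate `j` is unchanged by
the update, and the inner integral averages over the fresh sample alone. -/
theorem lintegral_infinitePi_update (j : ι) {f : (∀ i, X i) → ENNReal} (hf : Measurable f) :
    ∫⁻ ω, f ω ∂(Measure.infinitePi μ)
      = ∫⁻ ω, ∫⁻ y, f (Function.update ω j y) ∂(μ j) ∂(Measure.infinitePi μ) := by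
  conv_lhs => rw [← map_update_infinitePi μ j]
  rw [lintegral_map hf measurable_update',
    lintegral_prod (fun p => f (Function.update p.1 j p.2))
      (hf.comp measurable_update').aemeasurable]

end Resample

/-! ### Entrywise measurability of matrix operations. -/

section Measurability
variable {Ω : Type*} [MeasurableSpace Ω] {k l p : ℕ}

/-- Entrywise measurability of a matrix-valued function. -/
def MeasMat (f : Ω → Matrix (Fin k) (Fin l) ℝ) : Prop := ∀ i j, Measurable fun ω => f ω i j

/-- Entrywise measurability of a vector-valued function. -/
def MeasVec (f : Ω → Fin k → ℝ) : Prop := ∀ i, Measurable fun ω => f ω i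

theorem MeasMat.const (X : Matrix (Fin k) (Fin l) ℝ) : MeasMat fun _ : Ω => X :=
  fun _ _ => measurable_const

theorem MeasMat.add {f g : Ω → Matrix (Fin k) (Fin l) ℝ} (hf : MeasMat f) (hg : MeasMat g) :
    MeasMat fun ω => f ω + g ω := fun i j => (hf i j).add (hg i j)

theorem MeasMat.sub {f g : Ω → Matrix (Fin k) (Fin l) ℝ} (hf : MeasMat f) (hg : MeasMat g) :
    MeasMat fun ω => f ω - g ω := fun i j => (hf i j).sub (hg i j)

theorem MeasMat.smul {c : Ω → ℝ} {f : Ω → Matrix (Fin k) (Fin l) ℝ} (hc : Measurable c)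
    (hf : MeasMat f) : MeasMat fun ω => c ω • f ω := fun i j => hc.mul (hf i j)

theorem MeasMat.transpose {f : Ω → Matrix (Fin k) (Fin l) ℝ} (hf : MeasMat f) :
    MeasMat fun ω => (f ω)ᵀ := fun i j => hf j i

theorem MeasMat.mul {f : Ω → Matrix (Fin k) (Fin l) ℝ} {g : Ω → Matrix (Fin l) (Fin p) ℝ}
    (hf : MeasMat f) (hg : MeasMat g) : MeasMat fun ω => f ω * g ω := fun i j => by
  simp only [Matrix.mul_apply]
  exact Finset.measurable_sum _ fun a _ => (hf i a).mul (hg a j)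

theorem MeasMat.det {f : Ω → Matrix (Fin k) (Fin k) ℝ} (hf : MeasMat f) :
    Measurable fun ω => (f ω).det := by
  simp only [Matrix.det_apply']
  exact Finset.measurable_sum _ fun τ _ =>
    measurable_const.mul (Finset.measurable_prod _ fun i _ => hf _ _)

/-- The adjugate formula is polynomial up to division by the determinant. It holds for singular
matrices too, where both sides are `0`, so no invertibility is needed. -/
theorem MeasMat.inv {f : Ω → Matrix (Fin k) (Fin k) ℝ} (hf : MeasMat f) :
    MeasMat fun ω => (f ω)⁻¹ := fun i j => by
  simp only [Matrix.inv_def, Matrix.smul_apply, Ring.inverse_eq_inv', Matrix.adjugate_apply,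
    smul_eq_mul]
  refine hf.det.inv.mul (MeasMat.det fun a b => ?_)
  simp only [Matrix.updateRow_apply]
  split_ifs
  · exact measurable_const
  · exact hf a b

theorem MeasMat.mulVec {f : Ω → Matrix (Fin k) (Fin l) ℝ} {v : Ω → Fin l → ℝ}
    (hf : MeasMat f) (hv : MeasVec v) : MeasVec fun ω => f ω *ᵥ v ω := fun i => by
  simp only [Matrix.mulVec, dotProduct]
  exact Finset.measurable_sum _ fun a _ => (hf i a).mul (hv a)

theorem MeasMat.qf {f : Ω → Matrix (Fin k) (Fin k) ℝ} {v : Ω → Fin k → ℝ}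
    (hf : MeasMat f) (hv : MeasVec v) : Measurable fun ω => qf (f ω) (v ω) := by
  simp only [RHPG.qf, dotProduct]
  exact Finset.measurable_sum _ fun a _ => (hv a).mul (hf.mulVec hv a)

theorem MeasMat.fro2 {f : Ω → Matrix (Fin k) (Fin l) ℝ} (hf : MeasMat f) :
    Measurable fun ω => fro2 (f ω) := by
  simp only [RHPG.fro2]
  exact Finset.measurable_sum _ fun a _ => Finset.measurable_sum _ fun b _ => (hf a b).pow_const 2

end Measurability

/-! ### Which samples each stage depends on, and the error recursion. -/

namespace LQR
variable {n m : ℕ} (S : LQR n m)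

theorem measMat_closedLoop {Ω : Type*} [MeasurableSpace Ω] {K : Ω → Matrix (Fin m) (Fin n) ℝ}
    (hK : MeasMat K) : MeasMat fun ω => S.closedLoop (K ω) :=
  (MeasMat.const _).sub ((MeasMat.const _).mul hK)

theorem measMat_costStep {Ω : Type*} [MeasurableSpace Ω] {K : Ω → Matrix (Fin m) (Fin n) ℝ}
    {X : Ω → Matrix (Fin n) (Fin n) ℝ} (hK : MeasMat K) (hX : MeasMat X) :
    MeasMat fun ω => S.costStep (K ω) (X ω) :=
  (((((S.measMat_closedLoop hK).transpose).mul hX).mul (S.measMat_closedLoop hK)).add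
    ((hK.transpose.mul (MeasMat.const _)).mul hK)).add (MeasMat.const _)

theorem measMat_hess {Ω : Type*} [MeasurableSpace Ω] {X : Ω → Matrix (Fin n) (Fin n) ℝ}
    (hX : MeasMat X) : MeasMat fun ω => S.hess (X ω) :=
  (MeasMat.const _).add (((MeasMat.const _).mul hX).mul (MeasMat.const _))

theorem measMat_gain {Ω : Type*} [MeasurableSpace Ω] {X : Ω → Matrix (Fin n) (Fin n) ℝ}
    (hX : MeasMat X) : MeasMat fun ω => S.gain (X ω) :=
  (((S.measMat_hess hX).inv.mul (MeasMat.const _)).mul hX).mul (MeasMat.const _)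

theorem measMat_tailCost {Ω : Type*} [MeasurableSpace Ω] {N : ℕ}
    {G : Ω → ℕ → Matrix (Fin m) (Fin n) ℝ} (hG : ∀ h, MeasMat fun ω => G ω h) (k : ℕ) :
    MeasMat fun ω => S.tailCost N (G ω) k := by
  induction k with
  | zero => exact MeasMat.const _
  | succ k ih => exact S.measMat_costStep (hG _) ih

variable (π : Params n m)

/-- Cost-to-go matrix of the gains computed in the first `k` stages. -/
def stageTail (ω : Samples n m) (k : ℕ) : Matrix (Fin n) (Fin n) ℝ :=
  S.tailCost π.N (S.outerLoop π ω k) k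

/-- Inner iterate `i` of the stage that follows the first `k` stages. -/
def stageIter (ω : Samples n m) (k i : ℕ) : Matrix (Fin m) (Fin n) ℝ :=
  S.innerLoop π ω (π.N - (k + 1)) (S.outerLoop π ω k)
    (π.init (π.N - (k + 1)) (S.outerLoop π ω k (π.N - (k + 1) + 1))) i

/-- Deviation of an inner iterate from the optimal gain of its stage. -/
def stageErr (ω : Samples n m) (k i : ℕ) : Matrix (Fin m) (Fin n) ℝ :=
  S.stageIter π ω k i - S.gain (S.stageTail π ω k)

/-- Deviation at the end of a stage. -/
def finalErr (ω : Samples n m) (k : ℕ) : Matrix (Fin m) (Fin n) ℝ :=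
  S.stageErr π ω k (π.T (π.N - (k + 1)))

/-- The first `k` stages end within `η` of their optimal gains. -/
def goodSet (η : ℝ) (k : ℕ) : Set (Samples n m) :=
  {ω | ∀ j < k, fro2 (S.finalErr π ω j) ≤ η ^ 2}

theorem outerLoop_succ (ω : Samples n m) (k : ℕ) :
    S.outerLoop π ω (k + 1) = Function.update (S.outerLoop π ω k) (π.N - (k + 1))
      (S.stageIter π ω k (π.T (π.N - (k + 1)))) := rfl

theorem outerLoop_of_lt (ω : Samples n m) {j k : ℕ} (hjk : j < k) (hk : k ≤ π.N) :
    S.outerLoop π ω k (π.N - (j + 1)) = S.stageIter π ω j (π.T (π.N - (j + 1))) := by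
  induction k with
  | zero => omega
  | succ k ih =>
    rw [outerLoop_succ]
    by_cases h : j = k
    · subst h; rw [Function.update_self]
    · rw [Function.update_of_ne (by omega), ih (by omega) (by omega)]

/-- Later stages never overwrite earlier entries. The cost-to-go read from the final table is
therefore the one that was frozen while the stage ran. -/
theorem tailCost_outerLoop (ω : Samples n m) {j k : ℕ} (hjk : j ≤ k) (hk : k ≤ π.N) :
    S.tailCost π.N (S.outerLoop π ω k) j = S.stageTail π ω j := by
  refine tailCost_congr fun i hi => ?_
  rw [S.outerLoop_of_lt π ω (by omega) hk, S.outerLoop_of_lt π ω hi (by omega)]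

theorem outerLoop_sub_gain (ω : Samples n m) {j k : ℕ} (hjk : j < k) (hk : k ≤ π.N) :
    S.outerLoop π ω k (π.N - (j + 1)) - S.gain (S.tailCost π.N (S.outerLoop π ω k) j)
      = S.finalErr π ω j := by
  rw [S.outerLoop_of_lt π ω hjk hk, S.tailCost_outerLoop π ω hjk.le hk]
  rfl

theorem innerLoop_congr {ω ω' : Samples n m} {h i : ℕ} {G : ℕ → Matrix (Fin m) (Fin n) ℝ}
    {K : Matrix (Fin m) (Fin n) ℝ} (hω : ∀ i' < i, ω (h, i') = ω' (h, i')) :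
    S.innerLoop π ω h G K i = S.innerLoop π ω' h G K i := by
  induction i with
  | zero => rfl
  | succ i ih => rw [innerLoop, innerLoop, ih fun i' hi' => hω i' (by omega), hω i (by omega)]

theorem outerLoop_congr {ω ω' : Samples n m} {k : ℕ}
    (hω : ∀ h i, π.N - k ≤ h → ω (h, i) = ω' (h, i)) :
    S.outerLoop π ω k = S.outerLoop π ω' k := by
  induction k with
  | zero => rfl
  | succ k ih =>
    rw [outerLoop_succ, outerLoop_succ, stageIter, stageIter,
      ih fun h i hh => hω h i (by omega), S.innerLoop_congr π fun i' _ => hω _ i' le_rfl]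

theorem stageErr_congr {ω ω' : Samples n m} {k i : ℕ}
    (hω : ∀ h i, π.N - k ≤ h → ω (h, i) = ω' (h, i))
    (hi : ∀ i' < i, ω (π.N - (k + 1), i') = ω' (π.N - (k + 1), i')) :
    S.stageErr π ω k i = S.stageErr π ω' k i := by
  rw [stageErr, stageErr, stageIter, stageIter, stageTail, stageTail, S.outerLoop_congr π hω,
    S.innerLoop_congr π hi]

/-- Iterate `i` uses only the samples of earlier stages and the samples `i' < i` of its own, so
sample `i` is independent of it. -/
theorem stageErr_update (ω : Samples n m) {k : ℕ} (hk : k < π.N) (i : ℕ)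
    (y : EuclideanSpace ℝ (Fin n) × Dir n m) :
    S.stageErr π (Function.update ω (π.N - (k + 1), i) y) k i = S.stageErr π ω k i := by
  refine S.stageErr_congr π (fun h i' hh => ?_) fun i' hi' => ?_
  · refine Function.update_of_ne (fun h => ?_) _ _
    simp only [Prod.mk.injEq] at h
    omega
  · refine Function.update_of_ne (fun h => ?_) _ _
    simp only [Prod.mk.injEq] at h
    omega

theorem outerLoop_update (ω : Samples n m) {k : ℕ} (hk : k < π.N) (i : ℕ)
    (y : EuclideanSpace ℝ (Fin n) × Dir n m) :
    S.outerLoop π (Function.update ω (π.N - (k + 1), i) y) k = S.outerLoop π ω k := by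
  refine S.outerLoop_congr π fun h i' hh => Function.update_of_ne (fun h => ?_) _ _
  simp only [Prod.mk.injEq] at h
  omega

theorem finalErr_update (ω : Samples n m) {j k : ℕ} (hjk : j < k) (hk : k < π.N) (i : ℕ)
    (y : EuclideanSpace ℝ (Fin n) × Dir n m) :
    S.finalErr π (Function.update ω (π.N - (k + 1), i) y) j = S.finalErr π ω j := by
  refine S.stageErr_congr π (fun h i' hh => ?_) fun i' hi' => ?_
  all_goals
    refine Function.update_of_ne (fun h => ?_) _ _
    simp only [Prod.mk.injEq] at h
    omega

theorem mem_goodSet_update (ω : Samples n m) {η : ℝ} {k : ℕ} (hk : k < π.N) (i : ℕ)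
    (y : EuclideanSpace ℝ (Fin n) × Dir n m) :
    Function.update ω (π.N - (k + 1), i) y ∈ S.goodSet π η k ↔ ω ∈ S.goodSet π η k := by
  simp only [goodSet, Set.mem_ofPred_eq]
  refine forall₂_congr fun j hj => ?_
  rw [S.finalErr_update π ω hj hk]

variable {S} {P : Matrix (Fin n) (Fin n) ℝ}

theorem stageTail_posSemidef (hS : S.Admissible P) (ω : Samples n m) (k : ℕ) :
    (S.stageTail π ω k).PosSemidef := tailCost_posSemidef hS _ _ _

/-- After completing the square the part of the sample cost independent of `K` cancels in the
two-point difference, leaving a recursion for the deviation alone. -/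
theorem stageErr_succ (hS : S.Admissible P) (ω : Samples n m) {k : ℕ} (hk : k < π.N) (i : ℕ) :
    S.stageErr π ω k (i + 1) = errStep (S.hess (S.stageTail π ω k)) (π.α (π.N - (k + 1)) i)
      (π.r (π.N - (k + 1))) (S.stageErr π ω k i) (ω (π.N - (k + 1), i)) := by
  have hT := stageTail_posSemidef π hS ω k
  have hN : π.N - (π.N - (k + 1)) - 1 = k := by omega
  have hs : ∀ (K : Matrix (Fin m) (Fin n) ℝ) (x : Fin n → ℝ),
      S.sampleCost π.N (π.N - (k + 1)) (S.outerLoop π ω k) K x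
        = qf (S.costStep (S.gain (S.stageTail π ω k)) (S.stageTail π ω k)) x
          + qf (S.hess (S.stageTail π ω k)) ((K - S.gain (S.stageTail π ω k)) *ᵥ x) := by
    intro K x
    rw [sampleCost_eq (by omega), hN]
    change qf (S.costStep K (S.stageTail π ω k)) x = _
    rw [costStep_eq hS.posDef_R hT K, qf_add, qf_conj]
  have h1 : ∀ X Y : Matrix (Fin m) (Fin n) ℝ, X + Y - S.gain (S.stageTail π ω k)
      = X - S.gain (S.stageTail π ω k) + Y := fun X Y => by abel
  have h2 : ∀ X Y : Matrix (Fin m) (Fin n) ℝ, X - Y - S.gain (S.stageTail π ω k)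
      = X - S.gain (S.stageTail π ω k) - Y := fun X Y => by abel
  rw [errStep, stageErr, stageIter, innerLoop, twoPointGradient, hs, hs, add_sub_add_left_eq_sub]
  simp only [h1, h2]
  rfl

section MeasAlg
variable {M : ℝ}

theorem measMat_sample (p : ℕ × ℕ) : MeasMat fun ω : Samples n m => (ω p).2.toMatrix := by
  intro i j
  simp only [Dir.toMatrix, Matrix.of_apply]
  have h1 : Measurable fun ω : Samples n m => (ω p).2 := (measurable_pi_apply p).snd
  have h2 : Continuous fun u : Dir n m => u.1 (i, j) := by fun_prop
  exact h2.measurable.comp h1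

theorem measVec_sample (p : ℕ × ℕ) : MeasVec fun ω : Samples n m => (ω p).1.ofLp := by
  intro i
  have h1 : Measurable fun ω : Samples n m => (ω p).1 := (measurable_pi_apply p).fst
  have h2 : Continuous fun x : EuclideanSpace ℝ (Fin n) => x.ofLp i := by fun_prop
  exact h2.measurable.comp h1

theorem measMat_stageErr (hS : S.Admissible P) (hinit : IsInitRule M π.init) {k : ℕ}
    (hk : k < π.N) (hG : ∀ h, MeasMat fun ω => S.outerLoop π ω k h) (i : ℕ) :
    MeasMat fun ω => S.stageErr π ω k i := by
  have hT : MeasMat fun ω => S.stageTail π ω k := S.measMat_tailCost hG k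
  induction i with
  | zero =>
    refine MeasMat.sub (fun a b => ?_) (S.measMat_gain hT)
    exact ((hinit (π.N - (k + 1))).1 a b).comp (measurable_pi_lambda _ fun c =>
      measurable_pi_lambda _ fun d => hG (π.N - (k + 1) + 1) c d)
  | succ i ih =>
    simp only [stageErr_succ π hS _ hk]
    have hU := measMat_sample (n := n) (m := m) (π.N - (k + 1), i)
    have hx := measVec_sample (n := n) (m := m) (π.N - (k + 1), i)
    have hH := S.measMat_hess hT
    have hrU := hU.smul (measurable_const (a := π.r (π.N - (k + 1))))
    exact ih.sub (MeasMat.smul measurable_const (MeasMat.smul (measurable_const.mul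
      ((hH.qf ((ih.add hrU).mulVec hx)).sub
(hH.qf ((ih.sub hrU).mulVec hx)))) hU))

end MeasAlg

end LQR

namespace LQR
variable {n m : ℕ} {S : LQR n m} {P : Matrix (Fin n) (Fin n) ℝ} (π : Params n m) {M : ℝ}

theorem measMat_outerLoop (hS : S.Admissible P) (hinit : IsInitRule M π.init) {k : ℕ}
    (hk : k ≤ π.N) (h : ℕ) : MeasMat fun ω => S.outerLoop π ω k h := by
  induction k generalizing h with
  | zero => exact MeasMat.const _
  | succ k ih =>
    have ih := ih (by omega)
    simp only [outerLoop_succ, Function.update_apply]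
    split_ifs
    · have h1 := measMat_stageErr π hS hinit (by omega) ih (π.T (π.N - (k + 1)))
      have h2 := h1.add (S.measMat_gain (S.measMat_tailCost (N := π.N) ih k))
      have h3 : ∀ ω, S.stageErr π ω k (π.T (π.N - (k + 1)))
          + S.gain (S.tailCost π.N (S.outerLoop π ω k) k)
          = S.stageIter π ω k (π.T (π.N - (k + 1))) := fun ω => sub_add_cancel _ _
      simpa only [h3] using h2
    · exact ih h

theorem measurable_fro2_stageErr (hS : S.Admissible P) (hinit : IsInitRule M π.init) {k : ℕ}
    (hk : k < π.N) (i : ℕ) : Measurable fun ω => fro2 (S.stageErr π ω k i) :=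
  (measMat_stageErr π hS hinit hk (measMat_outerLoop π hS hinit hk.le) i).fro2

theorem measurableSet_goodSet (hS : S.Admissible P) (hinit : IsInitRule M π.init) (η : ℝ) {k : ℕ}
    (hk : k ≤ π.N) : MeasurableSet (S.goodSet π η k) := by
  have : S.goodSet π η k = ⋂ j ∈ Set.Iio k, {ω | fro2 (S.finalErr π ω j) ≤ η ^ 2} := by
    ext ω; simp [goodSet]
  rw [this]
  refine MeasurableSet.biInter (Set.to_countable _) fun j hj => ?_
  exact measurableSet_le (measurable_fro2_stageErr π hS hinit (lt_of_lt_of_le hj hk) _)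
    measurable_const

theorem norm_finalErr_le {η : ℝ} (hη : 0 ≤ η) {k : ℕ} {ω : Samples n m}
    (hω : ω ∈ S.goodSet π η k) {j : ℕ} (hj : j < k) : ‖S.finalErr π ω j‖ ≤ η :=
  le_of_sq_le_sq ((opNorm_sq_le_fro2 _).trans (hω j hj)) hη

/-! ### Probability that all stages succeed. -/

section Good
variable [NeZero n] [NeZero m]

theorem norm_stageTail_sub_rde_le (hS : S.Admissible P) {η : ℝ} (hη : 0 ≤ η)
    (hηN : η * S.growth P ^ π.N ≤ 1) {k : ℕ} (hk : k ≤ π.N) {ω : Samples n m}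
    (hω : ω ∈ S.goodSet π η k) :
    ‖S.stageTail π ω k - S.rde k‖ ≤ η * S.growth P ^ k := by
  refine norm_tailCost_sub_rde_le hS hη hηN hk fun j hj => ?_
  rw [S.outerLoop_sub_gain π ω hj hk]
  exact norm_finalErr_le π hη hω hj

theorem norm_stageTail_le (hS : S.Admissible P) {η : ℝ} (hη : 0 ≤ η)
    (hηN : η * S.growth P ^ π.N ≤ 1) {k : ℕ} (hk : k ≤ π.N) {ω : Samples n m}
    (hω : ω ∈ S.goodSet π η k) : ‖S.stageTail π ω k‖ ≤ S.rdeBound P + 1 := by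
  refine norm_le_of_norm_sub_rde_le hS k ((norm_stageTail_sub_rde_le π hS hη hηN hk hω).trans ?_)
  exact (mul_le_mul_of_nonneg_left (pow_le_pow_right₀ one_le_growth hk) hη).trans hηN

/-- A bound for the squared deviation of the first iterate of a stage. -/
def initBound (S : LQR n m) (P : Matrix (Fin n) (Fin n) ℝ) (M : ℝ) : ℝ :=
  n * (max M (S.gainBound P + 1) + S.gainBound P) ^ 2

theorem fro2_stageErr_zero_le (hS : S.Admissible P) (hinit : IsInitRule M π.init) {η : ℝ}
    (hη : 0 ≤ η) (hηN : η * S.growth P ^ π.N ≤ 1) {k : ℕ} (hk : k < π.N) {ω : Samples n m}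
    (hω : ω ∈ S.goodSet π η k) : fro2 (S.stageErr π ω k 0) ≤ S.initBound P M := by
  have hg := gainBound_nonneg hS
  have hη1 : η ≤ 1 := (le_mul_of_one_le_right hη (one_le_pow₀ one_le_growth)).trans hηN
  have hgain : ∀ j, j ≤ k → ‖S.gain (S.stageTail π ω j)‖ ≤ S.gainBound P := fun j hj =>
    norm_gain_le_of_norm_le hS (stageTail_posSemidef π hS ω j)
      (norm_stageTail_le π hS hη hηN (by omega) fun i hi => hω i (by omega))
  have hprev : ‖S.outerLoop π ω k (π.N - (k + 1) + 1)‖ ≤ S.gainBound P + 1 := by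
    -- The first stage is initialized from the zero entry of the table; afterwards the previous
    -- output is an exact gain of bounded norm plus an error of at most `η ≤ 1`.
    rcases k with _ | k
    · simp only [outerLoop, norm_zero]; positivity
    · have : π.N - (k + 1 + 1) + 1 = π.N - (k + 1) := by omega
      rw [this, S.outerLoop_of_lt π ω (Nat.lt_succ_self k) hk.le]
      have h1 := norm_finalErr_le π hη hω (Nat.lt_succ_self k)
      calc ‖S.stageIter π ω k (π.T (π.N - (k + 1)))‖
          = ‖S.gain (S.stageTail π ω k) + S.finalErr π ω k‖ := by
            rw [finalErr, stageErr, add_sub_cancel]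
        _ ≤ _ := (norm_add_le _ _).trans (add_le_add (hgain k (by omega)) (h1.trans hη1))
  refine (fro2_le _).trans ?_
  unfold initBound
  gcongr
  refine (norm_sub_le _ _).trans (add_le_add ?_ (hgain k le_rfl))
  exact ((hinit _).2 _).trans (max_le_max le_rfl hprev)

variable {D : Measure (EuclideanSpace ℝ (Fin n))} {Sigma0 : Matrix (Fin n) (Fin n) ℝ} {Cm : ℝ}

theorem isProbabilityMeasure_samplesLaw [IsProbabilityMeasure D] :
    IsProbabilityMeasure (samplesLaw (n := n) (m := m) D) := by
  have := isProbabilityMeasure_uniformDir n m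
  unfold samplesLaw
  infer_instance

/-- The squared error of an inner iterate, counted only if all previous stages succeeded. -/
def lyapunov (S : LQR n m) (π : Params n m) (η : ℝ) (k i : ℕ) : Samples n m → ENNReal :=
  (S.goodSet π η k).indicator fun ω => ENNReal.ofReal (fro2 (S.stageErr π ω k i))

/-- The event and the current error ignore the sample about to be used, so that sample can be
integrated out first. On the event the Hessian is at most `hessBound P`, which makes one stepsize
admissible for all stages. -/
theorem lintegral_lyapunov_succ_le (hS : S.Admissible P) (hD : InitialLaw D Sigma0 Cm)
    (hinit : IsInitRule M π.init) {α : ℝ} (hα : 0 < α) (hπα : ∀ h i, π.α h i = α)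
    (hπr : ∀ h, 0 < π.r h)
    (hαl : 2 * α * (m * n) * S.hessBound P ^ 2 * Cm ≤ lamMin S.R) {η : ℝ}
    (hη : 0 ≤ η) (hηN : η * S.growth P ^ π.N ≤ 1) {k : ℕ} (hk : k < π.N) (i : ℕ) :
    ∫⁻ ω, S.lyapunov π η k (i + 1) ω ∂(samplesLaw D)
      ≤ ENNReal.ofReal (1 - 2 * α * lamMin S.R * lamMin Sigma0)
        * ∫⁻ ω, S.lyapunov π η k i ω ∂(samplesLaw D) := by
  have := hD.prob
  have := isProbabilityMeasure_uniformDir n m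
  have hm : ∀ i, Measurable (S.lyapunov π η k i) := fun i =>
    (measurable_fro2_stageErr π hS hinit hk i).ennreal_ofReal.indicator
      (measurableSet_goodSet π hS hinit η hk.le)
  rw [← lintegral_const_mul _ (hm i), samplesLaw,
    lintegral_infinitePi_update _ (π.N - (k + 1), i) (hm (i + 1))]
  refine lintegral_mono fun ω => ?_
  by_cases hω : ω ∈ S.goodSet π η k
  · have h1 : ∀ y, S.lyapunov π η k (i + 1) (Function.update ω (π.N - (k + 1), i) y)
        = ENNReal.ofReal (fro2 (errStep (S.hess (S.stageTail π ω k)) α (π.r (π.N - (k + 1)))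
          (S.stageErr π ω k i) y)) := by
      intro y
      rw [lyapunov, Set.indicator_of_mem ((S.mem_goodSet_update π ω hk i y).2 hω),
        stageErr_succ π hS _ hk, S.stageErr_update π ω hk, stageTail, S.outerLoop_update π ω hk,
        Function.update_self, hπα]
      rfl
    simp only [h1]
    rw [lyapunov, Set.indicator_of_mem hω]
    have hT := stageTail_posSemidef π hS ω k
    exact lintegral_fro2_errStep_le hD
      (transpose_eq (hess_posDef hS.posDef_R hT).posSemidef) (lamMin_pos hS.posDef_R)
      (lamMin_mul_le_qf_hess hS.posDef_R hT)
      (norm_hess_le_of_norm_le (norm_stageTail_le π hS hη hηN hk.le hω)) hα (hπr _) hαl _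
  · have h1 : ∀ y, S.lyapunov π η k (i + 1) (Function.update ω (π.N - (k + 1), i) y) = 0 :=
      fun y => Set.indicator_of_notMem (fun h => hω ((S.mem_goodSet_update π ω hk i y).1 h)) _
    simp [h1]

theorem lintegral_lyapunov_le (hS : S.Admissible P) (hD : InitialLaw D Sigma0 Cm)
    (hinit : IsInitRule M π.init) {α : ℝ} (hα : 0 < α) (hπα : ∀ h i, π.α h i = α)
    (hπr : ∀ h, 0 < π.r h)
    (hαl : 2 * α * (m * n) * S.hessBound P ^ 2 * Cm ≤ lamMin S.R) {η : ℝ}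
    (hη : 0 ≤ η) (hηN : η * S.growth P ^ π.N ≤ 1) {k : ℕ} (hk : k < π.N) (i : ℕ) :
    ∫⁻ ω, S.lyapunov π η k i ω ∂(samplesLaw D)
      ≤ ENNReal.ofReal (1 - 2 * α * lamMin S.R * lamMin Sigma0) ^ i
        * ENNReal.ofReal (S.initBound P M) := by
  have := hD.prob
  have := isProbabilityMeasure_samplesLaw (n := n) (m := m) (D := D)
  induction i with
  | zero =>
    rw [pow_zero, one_mul]
    calc _ ≤ ∫⁻ _ω, ENNReal.ofReal (S.initBound P M) ∂(samplesLaw (m := m) D) := by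
          refine lintegral_mono fun ω => ?_
          by_cases hω : ω ∈ S.goodSet π η k
          · rw [lyapunov, Set.indicator_of_mem hω]
            exact ENNReal.ofReal_le_ofReal (fro2_stageErr_zero_le π hS hinit hη hηN hk hω)
          · rw [lyapunov, Set.indicator_of_notMem hω]
            exact zero_le
      _ = _ := by simp
  | succ i ih =>
    refine (lintegral_lyapunov_succ_le π hS hD hinit hα hπα hπr hαl hη hηN hk i).trans ?_
    rw [pow_succ', mul_assoc (ENNReal.ofReal _)]
    gcongr

/-- Markov's inequality for the squared error, restricted to the event that the previous stages
succeeded. -/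
theorem samplesLaw_goodSet_diff_le (hS : S.Admissible P) (hD : InitialLaw D Sigma0 Cm)
    (hinit : IsInitRule M π.init) {α : ℝ} (hα : 0 < α) (hπα : ∀ h i, π.α h i = α)
    (hπr : ∀ h, 0 < π.r h)
    (hαl : 2 * α * (m * n) * S.hessBound P ^ 2 * Cm ≤ lamMin S.R)
    (hβ : 0 ≤ 1 - 2 * α * lamMin S.R * lamMin Sigma0) {η : ℝ}
    (hη : 0 < η) (hηN : η * S.growth P ^ π.N ≤ 1) {k : ℕ} (hk : k < π.N) {b : ℝ}
    (hb : (1 - 2 * α * lamMin S.R * lamMin Sigma0) ^ (π.T (π.N - (k + 1))) * S.initBound P M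
      ≤ b * η ^ 2) :
    samplesLaw D (S.goodSet π η k \ S.goodSet π η (k + 1)) ≤ ENNReal.ofReal b := by
  have h1 : S.goodSet π η k \ S.goodSet π η (k + 1) ⊆ {ω | ENNReal.ofReal (η ^ 2)
      ≤ S.lyapunov π η k (π.T (π.N - (k + 1))) ω} := by
    rintro ω ⟨hω, hω'⟩
    rw [Set.mem_ofPred_eq, lyapunov, Set.indicator_of_mem hω]
    refine ENNReal.ofReal_le_ofReal ?_
    by_contra hlt
    refine hω' fun j hj => ?_
    rcases Nat.lt_succ_iff_lt_or_eq.1 hj with h | h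
    · exact hω j h
    · subst h; exact (not_le.1 hlt).le
  have h0 : ENNReal.ofReal (η ^ 2) ≠ 0 := by
    rw [Ne, ENNReal.ofReal_eq_zero, not_le]; positivity
  have hm : Measurable (S.lyapunov π η k (π.T (π.N - (k + 1)))) :=
    (measurable_fro2_stageErr π hS hinit hk _).ennreal_ofReal.indicator
      (measurableSet_goodSet π hS hinit η hk.le)
  have h2 := mul_meas_ge_le_lintegral (μ := samplesLaw D) hm (ENNReal.ofReal (η ^ 2))
  have h3 := h2.trans (lintegral_lyapunov_le π hS hD hinit hα hπα hπr hαl hη.le hηN hk _)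
  rw [← ENNReal.ofReal_pow hβ, ← ENNReal.ofReal_mul (by positivity)] at h3
  have h4 := h3.trans (ENNReal.ofReal_le_ofReal hb)
  rw [mul_comm b, ENNReal.ofReal_mul (by positivity)] at h4
  exact (measure_mono h1).trans
    ((ENNReal.mul_le_mul_iff_right h0 ENNReal.ofReal_ne_top).1 h4)

/-- Union bound over the first stage that fails. -/
theorem le_samplesLaw_goodSet (hS : S.Admissible P) (hD : InitialLaw D Sigma0 Cm)
    (hinit : IsInitRule M π.init) {α : ℝ} (hα : 0 < α) (hπα : ∀ h i, π.α h i = α)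
    (hπr : ∀ h, 0 < π.r h)
    (hαl : 2 * α * (m * n) * S.hessBound P ^ 2 * Cm ≤ lamMin S.R)
    (hβ : 0 ≤ 1 - 2 * α * lamMin S.R * lamMin Sigma0) {η : ℝ}
    (hη : 0 < η) (hηN : η * S.growth P ^ π.N ≤ 1) {b : ℝ} (hb0 : 0 ≤ b)
    (hb : ∀ h < π.N, (1 - 2 * α * lamMin S.R * lamMin Sigma0) ^ (π.T h) * S.initBound P M
      ≤ b * η ^ 2) :
    ENNReal.ofReal (1 - π.N * b) ≤ samplesLaw D (S.goodSet π η π.N) := by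
  have := hD.prob
  have := isProbabilityMeasure_samplesLaw (n := n) (m := m) (D := D)
  have h1 : ∀ k ≤ π.N, samplesLaw D (S.goodSet π η k)ᶜ ≤ ENNReal.ofReal (k * b) := by
    intro k hk
    induction k with
    | zero =>
      have : (S.goodSet π η 0)ᶜ = ∅ := by simp [goodSet]
      simp [this]
    | succ k ih =>
      have hsub : (S.goodSet π η (k + 1))ᶜ
          ⊆ (S.goodSet π η k)ᶜ ∪ (S.goodSet π η k \ S.goodSet π η (k + 1)) := by
        intro ω hω
        by_cases h : ω ∈ S.goodSet π η k
        · exact Or.inr ⟨h, hω⟩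
        · exact Or.inl h
      refine (measure_mono hsub).trans ((measure_union_le _ _).trans
        ((add_le_add (ih (by omega)) (samplesLaw_goodSet_diff_le π hS hD hinit hα hπα hπr hαl hβ
          hη hηN (by omega) (hb _ (by omega)))).trans ?_))
      rw [← ENNReal.ofReal_add (by positivity) hb0]
      exact ENNReal.ofReal_le_ofReal (by push_cast; linarith)
  have h2 := h1 π.N le_rfl
  have h3 := prob_add_prob_compl (μ := samplesLaw D)
    (measurableSet_goodSet π hS hinit η (le_refl π.N))
  rw [ENNReal.ofReal_sub _ (by positivity), ENNReal.ofReal_one, ← h3]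
  exact tsub_le_iff_right.2 (add_le_add le_rfl h2)

end Good

end LQR

/-! ### From accurate stages to the output; size of the horizon. -/

namespace LQR
variable {n m : ℕ} {S : LQR n m} {P : Matrix (Fin n) (Fin n) ℝ}

/-- The gain is optimal for every initial state separately, hence also on average. -/
theorem isStageOptimal_gain (hS : S.Admissible P) {D : Measure (EuclideanSpace ℝ (Fin n))}
    {Sigma0 : Matrix (Fin n) (Fin n) ℝ} {Cm : ℝ} (hD : InitialLaw D Sigma0 Cm) {N h : ℕ}
    (hh : h < N) (G : ℕ → Matrix (Fin m) (Fin n) ℝ) :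
    S.IsStageOptimal D N h G (S.gain (S.tailCost N G (N - h - 1))) := by
  intro K _
  simp only [Set.mem_ofPred_eq, surrogateCost, sampleCost_eq hh]
  refine integral_mono (hD.integrable_qf _) (hD.integrable_qf _) fun x => ?_
  exact qf_costStep_gain_le hS.posDef_R (tailCost_posSemidef hS _ _ _) K x.ofLp

/-- The numerator in the logarithm that determines the horizon. -/
def horizonConst (S : LQR n m) (P : Matrix (Fin n) (Fin n) ℝ) : ℝ :=
  2 * inducedNorm P (S.QN - P) * condNum P * ‖S.closedLoop (S.gain P)‖ * ‖S.B‖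

theorem horizonConst_nonneg : 0 ≤ S.horizonConst P := by
  have := inducedNorm_nonneg P (S.QN - P)
  unfold horizonConst condNum
  positivity

theorem horizon_eq (ε : ℝ) : S.horizon P ε
    = ⌈(1 / 2) * (Real.log (S.horizonConst P / (ε * lamMin S.R)) / Real.log (1 / S.rho P))⌉₊ + 1 :=
  rfl

theorem log_inv_rho_pos [NeZero n] (hS : S.Admissible P) : 0 < Real.log (1 / S.rho P) :=
  Real.log_pos (by rw [one_div]; exact (one_lt_inv₀ (rho_pos hS)).2 (rho_lt_one hS))

section
variable [NeZero n] [NeZero m]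

/-- The index is `N - 1` because the gain at time `0` uses the cost-to-go of time `1`; this is what
the `+ 1` in the horizon provides. The logarithm is chosen so that `ρ^(2(N-1))` brings the Lipschitz
bound down to `ε/2`. -/
theorem norm_gain_rde_horizon_sub_le (hS : S.Admissible P) {ε : ℝ} (hε : 0 < ε) :
    ‖S.gain (S.rde (S.horizon P ε - 1)) - S.gain P‖ ≤ ε / 2 := by
  have hl := lamMin_pos hS.posDef_R
  have hρ := rho_pos hS
  have hlog := log_inv_rho_pos hS
  set c := S.horizonConst P with hc
  have hc0 : 0 ≤ c := horizonConst_nonneg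
  set k := S.horizon P ε - 1 with hk
  have h1 : ‖S.gain (S.rde k) - S.gain P‖ ≤ c / (2 * lamMin S.R) * (S.rho P ^ 2) ^ k := by
    refine (norm_gain_sub_le hS.posDef_R hS.posDef_P.posSemidef (rde_posSemidef hS k)).trans ?_
    calc _ ≤ ‖S.B‖ * ‖S.closedLoop (S.gain P)‖ / lamMin S.R
          * (inducedNorm P (S.QN - P) * condNum P * (S.rho P ^ 2) ^ k) := by
            gcongr
            exact norm_rde_sub_le hS k
      _ = _ := by rw [hc, horizonConst]; field_simp
  refine h1.trans ?_
  -- If the constant vanishes, the bound is already `0` and the logarithm in the horizon plays no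
  -- role.
  rcases hc0.eq_or_lt with h0 | h0
  · rw [← h0]; simp; positivity
  have h2 : (1 / 2) * (Real.log (c / (ε * lamMin S.R)) / Real.log (1 / S.rho P)) ≤ k := by
    have : k = ⌈(1 / 2) * (Real.log (c / (ε * lamMin S.R)) / Real.log (1 / S.rho P))⌉₊ := by
      rw [hk, horizon_eq, Nat.add_sub_cancel]
    rw [this]
    exact Nat.le_ceil _
  have h3 : Real.log (c / (ε * lamMin S.R)) ≤ 2 * k * Real.log (1 / S.rho P) := by
    rw [← div_le_iff₀ hlog]
    linarith
  have h4 : (S.rho P ^ 2) ^ k ≤ ε * lamMin S.R / c := by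
    rw [← Real.log_le_log_iff (by positivity) (by positivity), Real.log_pow, Real.log_pow]
    rw [one_div, Real.log_inv] at h3
    have : Real.log (ε * lamMin S.R / c) = - Real.log (c / (ε * lamMin S.R)) := by
      rw [← Real.log_inv, inv_div]
    rw [this]
    push_cast
    linarith
  calc _ ≤ c / (2 * lamMin S.R) * (ε * lamMin S.R / c) := by gcongr
    _ = ε / 2 := by field_simp

theorem success_of_mem_goodSet (hS : S.Admissible P) {D : Measure (EuclideanSpace ℝ (Fin n))}
    {Sigma0 : Matrix (Fin n) (Fin n) ℝ} {Cm : ℝ} (hD : InitialLaw D Sigma0 Cm) {ε : ℝ}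
    (hε : 0 < ε) (π : Params n m) (hπ : π.N = S.horizon P ε) {η : ℝ} (hη : 0 ≤ η)
    (hηN : η * S.growth P ^ π.N ≤ 1) (htol : ∀ h < π.N, η ≤ S.tolerance π.N ε h)
    (hηε : η + S.gainLip P * (η * S.growth P ^ π.N) ≤ ε / 2) {ω : Samples n m}
    (hω : ω ∈ S.goodSet π η π.N) : S.Success D P ε π ω := by
  have hN : 1 ≤ π.N := by rw [hπ, horizon_eq]; omega
  have key : ∀ h < π.N,
      ‖S.output π ω h - S.gain (S.tailCost π.N (S.output π ω) (π.N - h - 1))‖ ≤ η := by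
    intro h hh
    have h1 := S.outerLoop_sub_gain π ω (j := π.N - h - 1) (by omega) (le_refl π.N)
    have h2 : π.N - (π.N - h - 1 + 1) = h := by omega
    rw [h2] at h1
    rw [output, h1]
    exact norm_finalErr_le π hη hω (by omega)
  refine ⟨fun h hh => ⟨_, isStageOptimal_gain hS hD hh _, (key h hh).trans (htol h hh)⟩, ?_⟩
  have h0 := key 0 (by omega)
  rw [output, Nat.sub_zero, S.tailCost_outerLoop π ω (Nat.sub_le _ _) le_rfl] at h0
  have h1 := norm_stageTail_sub_rde_le π hS hη hηN (Nat.sub_le π.N 1)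
    (ω := ω) fun j hj => hω j (by omega)
  have h2 := norm_gain_sub_rde_le hS (π.N - 1) (stageTail_posSemidef π hS ω (π.N - 1))
  have h3 := norm_gain_rde_horizon_sub_le hS hε
  rw [← hπ] at h3
  have h4 : S.gainLip P * ‖S.stageTail π ω (π.N - 1) - S.rde (π.N - 1)‖
      ≤ S.gainLip P * (η * S.growth P ^ π.N) := by
    refine mul_le_mul_of_nonneg_left (h1.trans ?_) (gainLip_nonneg hS)
    exact mul_le_mul_of_nonneg_left (pow_le_pow_right₀ one_le_growth (Nat.sub_le _ _)) hη
  -- Three errors: the last inner loop, the accumulated perturbation of the cost-to-go, and the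
  -- finite horizon. The first two share one half of `ε`; the third takes the other.
  have h5 : S.outerLoop π ω π.N 0 - S.gain P
      = (S.outerLoop π ω π.N 0 - S.gain (S.stageTail π ω (π.N - 1)))
        + ((S.gain (S.stageTail π ω (π.N - 1)) - S.gain (S.rde (π.N - 1)))
          + (S.gain (S.rde (π.N - 1)) - S.gain P)) := by abel
  rw [output, h5]
  have h6 := norm_add_le (S.gain (S.stageTail π ω (π.N - 1)) - S.gain (S.rde (π.N - 1)))
    (S.gain (S.rde (π.N - 1)) - S.gain P)
  refine (norm_add_le _ _).trans ?_
  linarith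

end

/-! ### Asymptotics -/

theorem eventually_log_inv_ge (b : ℝ) :
    ∀ᶠ ε : ℝ in 𝓝[>] 0, 0 < ε ∧ b ≤ Real.log (1 / ε) := by
  have h : Tendsto (fun ε : ℝ => Real.log (1 / ε)) (𝓝[>] 0) atTop := by
    simp only [one_div]
    exact Real.tendsto_log_atTop.comp tendsto_inv_nhdsGT_zero
  exact (eventually_mem_nhdsWithin).and (h.eventually_ge_atTop b)

theorem rpow_neg_eq_exp {ε : ℝ} (hε : 0 < ε) (x : ℝ) :
    ε ^ (-x) = Real.exp (x * Real.log (1 / ε)) := by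
  rw [Real.rpow_def_of_pos hε, one_div, Real.log_inv]
  congr 1
  ring

/-- Real-valued length of the horizon before rounding. -/
def realHorizon (S : LQR n m) (P : Matrix (Fin n) (Fin n) ℝ) (ε : ℝ) : ℝ :=
  (Real.log (S.horizonConst P / lamMin S.R) + Real.log (1 / ε)) / (2 * Real.log (1 / S.rho P))

theorem horizon_eq_one (hc : S.horizonConst P = 0) (ε : ℝ) : S.horizon P ε = 1 := by
  simp [horizon_eq, hc]

section
variable [NeZero m]

theorem realHorizon_eq (hS : S.Admissible P) (hc : S.horizonConst P ≠ 0) {ε : ℝ} (hε : 0 < ε) :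
    (1 / 2) * (Real.log (S.horizonConst P / (ε * lamMin S.R)) / Real.log (1 / S.rho P))
      = S.realHorizon P ε := by
  have hl := lamMin_pos hS.posDef_R
  have h : S.horizonConst P / (ε * lamMin S.R) = S.horizonConst P / lamMin S.R * (1 / ε) := by
    field_simp
  rw [h, Real.log_mul (by positivity) (by positivity), realHorizon]
  ring

theorem horizon_lt (hS : S.Admissible P) (hc : S.horizonConst P ≠ 0) {ε : ℝ} (hε : 0 < ε)
    (h0 : 0 ≤ S.realHorizon P ε) : (S.horizon P ε : ℝ) < S.realHorizon P ε + 2 := by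
  rw [horizon_eq, realHorizon_eq hS hc hε]
  push_cast
  linarith [Nat.ceil_lt_add_one h0]

theorem realHorizon_le_horizon (hS : S.Admissible P) (hc : S.horizonConst P ≠ 0) {ε : ℝ}
    (hε : 0 < ε) : S.realHorizon P ε + 1 ≤ S.horizon P ε := by
  rw [horizon_eq, realHorizon_eq hS hc hε]
  push_cast
  linarith [Nat.le_ceil (S.realHorizon P ε)]

theorem exists_horizon_le [NeZero n] (hS : S.Admissible P) :
    ∃ b : ℝ, 0 < b ∧ ∀ᶠ ε : ℝ in 𝓝[>] 0, (S.horizon P ε : ℝ) ≤ b * Real.log (1 / ε) := by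
  have hρ := log_inv_rho_pos hS
  by_cases hc : S.horizonConst P = 0
  · refine ⟨1, one_pos, ?_⟩
    filter_upwards [eventually_log_inv_ge 1] with ε hε
    rw [horizon_eq_one hc]
    simpa using hε.2
  · set κ := Real.log (S.horizonConst P / lamMin S.R)
    refine ⟨1 / Real.log (1 / S.rho P) + 2, by positivity, ?_⟩
    filter_upwards [eventually_log_inv_ge (max 1 |κ|)] with ε ⟨hε, hb⟩
    have h1 := (le_max_left _ _).trans hb
    have h2 := abs_le.1 ((le_max_right 1 |κ|).trans hb)
    set l := Real.log (1 / ε)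
    have h0 : 0 ≤ S.realHorizon P ε := div_nonneg (by linarith [h2.1]) (by positivity)
    have h3 : S.realHorizon P ε ≤ 1 / Real.log (1 / S.rho P) * l := by
      rw [realHorizon, div_le_iff₀ (by positivity)]
      have : 1 / Real.log (1 / S.rho P) * l * (2 * Real.log (1 / S.rho P)) = 2 * l := by
        field_simp
      rw [this]
      linarith [h2.2]
    linarith [horizon_lt hS hc hε h0]

end

end LQR

/-! ### Bounds on the constants, the tolerances and the rate. -/

namespace LQR
variable {n m : ℕ} {S : LQR n m} {P : Matrix (Fin n) (Fin n) ℝ}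

theorem phi_le [NeZero n] [NeZero m] (hS : S.Admissible P) (N : ℕ) : S.phi N ≤ S.loopBound P :=
  Real.iSup_le (fun t => norm_closedLoop_gain_le hS (rde_posSemidef hS _)
    ((norm_rde_le hS _).trans (by linarith))) (loopBound_nonneg hS)

theorem le_phi (S : LQR n m) {N k : ℕ} (hk : k < N) :
    ‖S.closedLoop (S.gain (S.rde k))‖ ≤ S.phi N := by
  have h := le_ciSup (f := fun t : Fin N => ‖S.closedLoop (S.finiteGain N t)‖)
    (Set.finite_range _).bddAbove ⟨N - (k + 1), by omega⟩
  have : N - (N - (k + 1) + 1) = k := by omega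
  simpa only [phi, finiteGain, this] using h

theorem phi_pos (hS : S.Admissible P) {N : ℕ} (hN : 0 < N) : 0 < S.phi N :=
  (norm_pos_iff.2 (closedLoop_gain_ne_zero hS.posDef_R (QN_posSemidef hS) hS.A_ne_zero)).trans_le
    (le_phi S (k := 0) hN)

theorem a_pos [NeZero n] (hS : S.Admissible P) : 0 < S.a := by
  have h : (S.Qᵀ * S.Q).PosDef := by
    have := Matrix.PosDef.conjTranspose_mul_self S.Q
      (Matrix.mulVec_injective_iff_isUnit.2 hS.posDef_Q.isUnit)
    simpa using this
  have := Real.sqrt_pos.2 (lamMin_pos h)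
  unfold a sigmaMin
  positivity

theorem C3_pos [NeZero n] [NeZero m] (hS : S.Admissible P) : 0 < S.C3 := by
  have ha := a_pos hS
  have h1 : (S.QN + S.a • (1 : Matrix (Fin n) (Fin n) ℝ)).PosSemidef :=
    (QN_posSemidef hS).add (Matrix.PosSemidef.one.smul ha.le)
  have h2 : S.hess (S.QN + S.a • (1 : Matrix (Fin n) (Fin n) ℝ)) ≠ 0 := by
    intro h0
    have h := qf_pos (hess_posDef hS.posDef_R h1) (v := fun _ => 1)
      (fun h => one_ne_zero (congrFun h (0 : Fin m)))
    rw [h0] at h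
    simp [qf] at h
  have := norm_pos_iff.2 h2
  unfold C3
  change 0 < 2 * ‖S.hess _‖
  positivity

theorem C1_pos [NeZero m] (hS : S.Admissible P) (hB : S.B ≠ 0) {N : ℕ} (hN : 0 < N) :
    0 < S.C1 N := by
  have := phi_pos hS hN
  have := norm_pos_iff.2 hB
  have := lamMin_pos hS.posDef_R
  unfold C1
  positivity

theorem C2_pos [NeZero m] (hS : S.Admissible P) {N : ℕ} (hN : 0 < N) :
    0 < S.C2 N := by
  have := phi_pos hS hN
  have := norm_pos_iff.2 hS.A_ne_zero
  have := lamMin_pos hS.posDef_R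
  unfold C2
  positivity

theorem C1_le [NeZero n] [NeZero m] (hS : S.Admissible P) (N : ℕ) :
    S.C1 N ≤ S.loopBound P * ‖S.B‖ / lamMin S.R := by
  have := lamMin_pos hS.posDef_R
  have := phi_le hS N
  unfold C1
  gcongr

/-- A bound for `C₂` which does not depend on the horizon. -/
def C2Bound (S : LQR n m) (P : Matrix (Fin n) (Fin n) ℝ) : ℝ :=
  2 * S.loopBound P * ‖S.A‖
    * (1 + ‖S.QN + S.a • (1 : Matrix (Fin n) (Fin n) ℝ)‖ * ‖S.B‖ ^ 2 / lamMin S.R)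

theorem C2_le [NeZero n] [NeZero m] (hS : S.Admissible P) (N : ℕ) : S.C2 N ≤ S.C2Bound P := by
  have := lamMin_pos hS.posDef_R
  have := phi_le hS N
  unfold C2 C2Bound
  gcongr

/-- Truncated subtraction makes `h - 2 = 0` at `h = 1`, where the second entry of the minimum
repeats the first; both cases of the definition become one formula. -/
theorem tolerance_of_pos (N : ℕ) (ε : ℝ) {h : ℕ} (hh : h ≠ 0) :
    S.tolerance N ε h = min (Real.sqrt (S.a / S.C3))
      (min (Real.sqrt (S.a / (S.C2 N ^ (h - 2) * S.C3)))
        (1 / 2 * Real.sqrt (ε / (S.C1 N * S.C2 N ^ (h - 2) * S.C3)))) := by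
  rw [tolerance, if_neg hh]
  split_ifs with h1
  · subst h1
    simp
  · rfl

theorem inv_min_sq_le {x y : ℝ} (hx : 0 < x) (hy : 0 < y) :
    1 / min x y ^ 2 ≤ 1 / x ^ 2 + 1 / y ^ 2 := by
  have h1 : 0 < 1 / x ^ 2 := by positivity
  have h2 : 0 < 1 / y ^ 2 := by positivity
  rcases min_choice x y with h | h <;> rw [h] <;> linarith

theorem B_ne_zero_of_horizonConst (hc : S.horizonConst P ≠ 0) : S.B ≠ 0 := by
  intro h
  exact hc (by simp [horizonConst, h])

theorem rate_pos {ε : ℝ} (hε : 0 < ε) : 0 < S.rate P ε :=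
  lt_max_of_lt_left (Real.rpow_pos_of_pos hε _)

section
variable [NeZero n] [NeZero m]

theorem tolerance_bounds (hS : S.Admissible P) (hB : S.B ≠ 0) {N : ℕ} (hN : 0 < N) {ε : ℝ}
    (hε : 0 < ε) {h : ℕ} (hh : h ≠ 0) :
    0 < S.tolerance N ε h ∧ S.tolerance N ε h ^ 2 ≤ S.a / S.C3 ∧
    1 / S.tolerance N ε h ^ 2 ≤ S.C3 / S.a + S.C2 N ^ (h - 2) * S.C3 / S.a
      + 4 * S.C1 N * S.C2 N ^ (h - 2) * S.C3 / ε := by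
  have ha := a_pos hS
  have hC1 := C1_pos hS hB hN
  have hC2 := C2_pos hS hN
  have hC3 := C3_pos hS
  have hw : 0 < S.C2 N ^ (h - 2) := by positivity
  rw [tolerance_of_pos N ε hh]
  set w := S.C2 N ^ (h - 2)
  have x1 : 0 < Real.sqrt (S.a / S.C3) := Real.sqrt_pos.2 (by positivity)
  have x2 : 0 < Real.sqrt (S.a / (w * S.C3)) := Real.sqrt_pos.2 (by positivity)
  have x3 : 0 < 1 / 2 * Real.sqrt (ε / (S.C1 N * w * S.C3)) :=
    mul_pos (by norm_num) (Real.sqrt_pos.2 (by positivity))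
  refine ⟨lt_min x1 (lt_min x2 x3), ?_, ?_⟩
  · calc _ ≤ Real.sqrt (S.a / S.C3) ^ 2 :=
          pow_le_pow_left₀ (lt_min x1 (lt_min x2 x3)).le (min_le_left _ _) 2
      _ = _ := Real.sq_sqrt (by positivity)
  · have h1 := inv_min_sq_le x1 (lt_min x2 x3)
    have h2 := inv_min_sq_le x2 x3
    rw [Real.sq_sqrt (by positivity)] at h1
    rw [Real.sq_sqrt (by positivity), mul_pow, Real.sq_sqrt (by positivity)] at h2
    have e1 : 1 / (S.a / S.C3) = S.C3 / S.a := by field_simp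
    have e2 : 1 / (S.a / (w * S.C3)) = w * S.C3 / S.a := by field_simp
    have e3 : 1 / ((1 / 2 : ℝ) ^ 2 * (ε / (S.C1 N * w * S.C3))) = 4 * S.C1 N * w * S.C3 / ε := by
      field_simp
      norm_num
    rw [e1] at h1
    rw [e2, e3] at h2
    linarith

/-- A bound for the exponent `log C₂ / (2 log (1 / ‖A*_K‖_*))`. -/
def exponentBound (S : LQR n m) (P : Matrix (Fin n) (Fin n) ℝ) : ℝ :=
  |Real.log (S.C2Bound P)| / (2 * Real.log (1 / S.rho P))

theorem exponent_le (hS : S.Admissible P) (ε : ℝ) : S.exponent P ε ≤ 1 + S.exponentBound P := by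
  have hρ := log_inv_rho_pos hS
  have hN : 0 < S.horizon P ε := by rw [horizon_eq]; omega
  have := (Real.log_le_log (C2_pos hS hN) (C2_le hS _)).trans (le_abs_self _)
  unfold exponent exponentBound
  gcongr

theorem rate_le (hS : S.Admissible P) {ε : ℝ} (hε : 0 < ε) (hl : 0 ≤ Real.log (1 / ε)) :
    S.rate P ε ≤ Real.exp ((2 + S.exponentBound P) * Real.log (1 / ε)) := by
  have hρ := log_inv_rho_pos hS
  have h0 : 0 ≤ S.exponentBound P := by unfold exponentBound; positivity
  have h1 := exponent_le hS ε
  rw [rate, rpow_neg_eq_exp hε, rpow_neg_eq_exp hε]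
  refine max_le ?_ ?_ <;> gcongr <;> linarith

/-- The geometric factor in the tolerances is at most of the order of the rate. -/
theorem C2_pow_div_le (hS : S.Admissible P) (hc : S.horizonConst P ≠ 0) {ε : ℝ} (hε : 0 < ε)
    (hl : 0 ≤ Real.log (1 / ε)) (h0 : 0 ≤ S.realHorizon P ε) {h : ℕ}
    (hh : h < S.horizon P ε) :
    S.C2 (S.horizon P ε) ^ (h - 2) / ε
      ≤ Real.exp (S.exponentBound P * |Real.log (S.horizonConst P / lamMin S.R)|)
        * S.rate P ε := by
  have hρ := log_inv_rho_pos hS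
  have hN : 0 < S.horizon P ε := by omega
  have hC2 := C2_pos hS hN
  have hlogC := (Real.log_le_log hC2 (C2_le hS _)).trans (le_abs_self _)
  have hε1 : 1 / ε = Real.exp (Real.log (1 / ε)) := (Real.exp_log (by positivity)).symm
  have hb : 0 ≤ S.exponentBound P := by unfold exponentBound; positivity
  set C := S.C2 (S.horizon P ε) with hC
  set κ := Real.log (S.horizonConst P / lamMin S.R) with hκ
  set l := Real.log (1 / ε) with hldef
  have hW : 1 ≤ Real.exp (S.exponentBound P * |κ|) := Real.one_le_exp (by positivity)
  rw [div_eq_mul_one_div, hε1]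
  -- When `C ≤ 1` the power does not grow and `ε⁻¹ ≤ ε⁻²` suffices; the second term of the rate is
  -- needed only when `C > 1`.
  by_cases h1 : C ≤ 1
  · have hw : C ^ (h - 2) ≤ 1 := pow_le_one₀ hC2.le h1
    have h2 : Real.exp l ≤ S.rate P ε := by
      refine le_trans ?_ (le_max_left _ _)
      rw [rpow_neg_eq_exp hε]
      gcongr
      linarith
    calc _ ≤ 1 * Real.exp l := by gcongr
      _ ≤ Real.exp (S.exponentBound P * |κ|) * S.rate P ε :=
        mul_le_mul hW h2 (Real.exp_pos _).le (zero_le_one.trans hW)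
  · have h1 := (not_le.1 h1).le
    have hL := Real.log_nonneg h1
    -- The shift by `2` compensates exactly for the ceiling and the `+ 1` in the horizon.
    have hx : ((h - 2 : ℕ) : ℝ) ≤ S.realHorizon P ε := by
      have h3 := horizon_lt hS hc hε h0
      rcases le_or_gt 2 h with h4 | h4
      · rw [Nat.cast_sub h4]
        have : (h : ℝ) < S.horizon P ε := by exact_mod_cast hh
        push_cast
        linarith
      · have : h - 2 = 0 := by omega
        rw [this]
        simpa using h0
    set s := Real.log C / (2 * Real.log (1 / S.rho P)) with hs
    have hs0 : 0 ≤ s := by positivity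
    have hsb : s ≤ S.exponentBound P := by unfold exponentBound; rw [hs]; gcongr
    -- Here `s` depends on `ε` through `C` but is bounded uniformly, so `exp (s * κ)` is a constant
    -- and `exp (s * l)` is `ε ^ (-s)`.
    have h2 : C ^ (h - 2) ≤ Real.exp (s * (κ + l)) := by
      rw [← Real.log_le_iff_le_exp (by positivity), Real.log_pow]
      calc _ ≤ S.realHorizon P ε * Real.log C := by gcongr
        _ = _ := by rw [realHorizon, hs, ← hκ, ← hldef]; ring
    calc C ^ (h - 2) * Real.exp l ≤ Real.exp (s * (κ + l)) * Real.exp l := by gcongr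
      _ = Real.exp (s * κ) * Real.exp ((1 + s) * l) := by
          rw [← Real.exp_add, ← Real.exp_add]; congr 1; ring
      _ ≤ Real.exp (S.exponentBound P * |κ|) * S.rate P ε := by
          have h3 : s * κ ≤ S.exponentBound P * |κ| :=
            (mul_le_mul_of_nonneg_left (le_abs_self _) hs0).trans
              (mul_le_mul_of_nonneg_right hsb (abs_nonneg _))
          refine mul_le_mul (Real.exp_le_exp.2 h3) ?_ (Real.exp_pos _).le (Real.exp_pos _).le
          refine le_trans (le_of_eq ?_) (le_max_right _ _)
          rw [rpow_neg_eq_exp hε]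
          rfl

theorem exists_inv_tolerance_sq_le (hS : S.Admissible P) :
    ∃ K τ : ℝ, 0 < K ∧ 0 < τ ∧ ∀ᶠ ε : ℝ in 𝓝[>] 0, ∀ h < S.horizon P ε,
      0 < S.tolerance (S.horizon P ε) ε h ∧ S.tolerance (S.horizon P ε) ε h ^ 2 ≤ τ ∧
      1 / S.tolerance (S.horizon P ε) ε h ^ 2 ≤ K * S.rate P ε := by
  have hρ := log_inv_rho_pos hS
  have ha := a_pos hS
  have hC3 := C3_pos hS
  have hlR := lamMin_pos hS.posDef_R
  have hlb := loopBound_nonneg hS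
  set κ := Real.log (S.horizonConst P / lamMin S.R) with hκ
  set W := Real.exp (S.exponentBound P * |κ|) with hW
  have hW0 : 0 < W := Real.exp_pos _
  set b := S.loopBound P * ‖S.B‖ / lamMin S.R with hb
  have hb0 : 0 ≤ b := by positivity
  set K0 := S.C3 / S.a + W * S.C3 / S.a + 4 * b * W * S.C3 with hK0
  have hK0' : 0 ≤ K0 := by positivity
  refine ⟨16 + K0, max 1 (S.a / S.C3), by positivity, by positivity, ?_⟩
  filter_upwards [eventually_log_inv_ge (max 1 |κ|)] with ε ⟨hε, hl⟩ h hh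
  have hl1 := (le_max_left _ _).trans hl
  have hl2 := abs_le.1 ((le_max_right 1 |κ|).trans hl)
  have hr := rate_pos (S := S) (P := P) hε
  have hε1 : 1 ≤ 1 / ε := by
    rw [← Real.exp_log (show 0 < 1 / ε by positivity)]
    exact Real.one_le_exp (by linarith)
  have hε2 : ε ≤ 1 := by rwa [le_div_iff₀ hε, one_mul] at hε1
  by_cases h0 : h = 0
  · subst h0
    rw [tolerance, if_pos rfl]
    refine ⟨by positivity, le_max_of_le_left (by nlinarith), ?_⟩
    have h1 : 1 / (ε / 4) ^ 2 = 16 * ε ^ (-2 : ℝ) := by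
      rw [Real.rpow_neg hε.le, Real.rpow_two]
      field_simp
      norm_num
    have h2 : ε ^ (-2 : ℝ) ≤ S.rate P ε := le_max_left _ _
    rw [h1]
    nlinarith
  -- A stage `h ≥ 1` exists only if the horizon exceeds `1`. This forces `B ≠ 0`, hence `C₁ > 0`,
  -- and the quotients in the tolerance are genuine.
  · have hc : S.horizonConst P ≠ 0 := by
      intro hc
      rw [horizon_eq_one hc] at hh
      omega
    obtain ⟨t1, t2, t3⟩ := tolerance_bounds hS (B_ne_zero_of_horizonConst hc)
      (show 0 < S.horizon P ε by omega) hε h0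
    refine ⟨t1, t2.trans (le_max_right _ _), t3.trans ?_⟩
    have hrh : 0 ≤ S.realHorizon P ε := div_nonneg (by linarith [hl2.1]) (by positivity)
    have h1 := C2_pow_div_le hS hc hε (by linarith) hrh hh
    have hC2 := C2_pos hS (show 0 < S.horizon P ε by omega)
    have hw : 0 < S.C2 (S.horizon P ε) ^ (h - 2) := by positivity
    set w := S.C2 (S.horizon P ε) ^ (h - 2) with hwdef
    have h2 : w ≤ W * S.rate P ε := by
      refine le_trans ?_ h1
      rw [div_eq_mul_one_div]
      exact le_mul_of_one_le_right hw.le hε1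
    have h3 : 1 ≤ S.rate P ε := by
      refine le_trans ?_ (le_max_left _ _)
      rw [rpow_neg_eq_exp hε]
      exact Real.one_le_exp (by positivity)
    have h4 := C1_le hS (S.horizon P ε)
    have h5 : S.C3 / S.a ≤ S.C3 / S.a * S.rate P ε := le_mul_of_one_le_right (by positivity) h3
    have h6 : w * S.C3 / S.a ≤ W * S.rate P ε * S.C3 / S.a := by gcongr
    have h7 : 4 * S.C1 (S.horizon P ε) * w * S.C3 / ε ≤ 4 * b * (W * S.rate P ε) * S.C3 := by
      calc _ = 4 * S.C1 (S.horizon P ε) * (w / ε) * S.C3 := by ring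
        _ ≤ _ := by gcongr
    calc _ ≤ S.C3 / S.a * S.rate P ε + W * S.rate P ε * S.C3 / S.a
          + 4 * b * (W * S.rate P ε) * S.C3 := by linarith
      _ = K0 * S.rate P ε := by rw [hK0]; ring
      _ ≤ _ := by nlinarith

end

end LQR

/-! ### Choice of the parameters and probability of success. -/

namespace LQR
variable {n m : ℕ} {S : LQR n m} {P : Matrix (Fin n) (Fin n) ℝ}

theorem initBound_nonneg (M : ℝ) : 0 ≤ S.initBound P M := by
  unfold initBound
  positivity

variable [NeZero n] [NeZero m]

/-- Two logarithms come from the iteration counts and the third from the number of stages. -/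
theorem exists_sum_iterations_le (hS : S.Admissible P) :
    ∃ C : ℝ, 0 < C ∧ ∀ᶠ ε : ℝ in 𝓝[>] 0,
      ∑ h ∈ Finset.range (S.horizon P ε), (S.iterations P 1 2 ε h : ℝ)
        ≤ C * Real.log (1 / ε) ^ 3 * S.rate P ε := by
  obtain ⟨b, hb, hN⟩ := exists_horizon_le hS
  obtain ⟨K, τ, hK, -, htol⟩ := exists_inv_tolerance_sq_le hS
  refine ⟨b * (K + 1), by positivity, ?_⟩
  filter_upwards [hN, htol, eventually_log_inv_ge 1] with ε hN htol ⟨hε, hl⟩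
  have hr := rate_pos (S := S) (P := P) hε
  set l := Real.log (1 / ε)
  have h3 : 1 ≤ S.rate P ε := by
    refine le_trans ?_ (le_max_left _ _)
    rw [rpow_neg_eq_exp hε]
    exact Real.one_le_exp (by positivity)
  have h1 : ∀ h ∈ Finset.range (S.horizon P ε),
      (S.iterations P 1 2 ε h : ℝ) ≤ (K + 1) * l ^ 2 * S.rate P ε := by
    intro h hh
    obtain ⟨-, -, t3⟩ := htol h (Finset.mem_range.1 hh)
    have h4 := (Nat.ceil_lt_add_one (a := 1 * l ^ 2 / S.tolerance (S.horizon P ε) ε h ^ 2)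
      (by positivity)).le
    refine h4.trans ?_
    have h5 : 1 * l ^ 2 / S.tolerance (S.horizon P ε) ε h ^ 2 ≤ l ^ 2 * (K * S.rate P ε) := by
      rw [one_mul, div_eq_mul_one_div]
      gcongr
    have h6 : 1 ≤ l ^ 2 * S.rate P ε := one_le_mul_of_one_le_of_one_le (one_le_pow₀ hl) h3
    linarith
  refine (Finset.sum_le_sum h1).trans ?_
  rw [Finset.sum_const, Finset.card_range, nsmul_eq_mul]
  calc _ ≤ (b * l) * ((K + 1) * l ^ 2 * S.rate P ε) := by gcongr
    _ = _ := by ring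

theorem exists_stepsize (hS : S.Admissible P) {D : Measure (EuclideanSpace ℝ (Fin n))}
    {Sigma0 : Matrix (Fin n) (Fin n) ℝ} {Cm : ℝ} (hD : InitialLaw D Sigma0 Cm) :
    ∃ α : ℝ, 0 < α ∧ 2 * α * (m * n) * S.hessBound P ^ 2 * Cm ≤ lamMin S.R ∧
      0 < 1 - 2 * α * lamMin S.R * lamMin Sigma0 ∧
      1 - 2 * α * lamMin S.R * lamMin Sigma0 < 1 := by
  have hl := lamMin_pos hS.posDef_R
  have hs := lamMin_pos hD.posDef
  have hC := hD.Cm_pos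
  set X := 2 * ((m : ℝ) * n) * S.hessBound P ^ 2 * Cm with hX
  have hX0 : 0 ≤ X := by positivity
  -- The first entry makes the descent dominate the noise, the second makes the contraction factor
  -- at least `1/2`; `X + 1` avoids division by zero.
  have hα : 0 < min (lamMin S.R / (X + 1)) (1 / (4 * lamMin S.R * lamMin Sigma0)) :=
    lt_min (by positivity) (by positivity)
  refine ⟨_, hα, ?_, ?_, ?_⟩
  · calc _ = min (lamMin S.R / (X + 1)) (1 / (4 * lamMin S.R * lamMin Sigma0)) * X := by
          rw [hX]; ring
      _ ≤ lamMin S.R / (X + 1) * (X + 1) := by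
          gcongr
          · exact min_le_left _ _
          · linarith
      _ = _ := by field_simp
  · have h1 := mul_le_mul_of_nonneg_right (min_le_right (lamMin S.R / (X + 1))
      (1 / (4 * lamMin S.R * lamMin Sigma0))) (show 0 ≤ 4 * lamMin S.R * lamMin Sigma0 by positivity)
    have h2 : 1 / (4 * lamMin S.R * lamMin Sigma0) * (4 * lamMin S.R * lamMin Sigma0) = 1 := by
      field_simp
    nlinarith
  · have : 0 < min (lamMin S.R / (X + 1)) (1 / (4 * lamMin S.R * lamMin Sigma0))
      * (lamMin S.R * lamMin Sigma0) := by positivity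
    nlinarith

-- With `l = log(1/ε)`, the failure bound decays like `exp (-γ l² / τ)`, while the accuracy, the
-- growth of errors over the stages and the number of stages are all at most exponential in `l`. The
-- square of the logarithm therefore wins, with stepsize and radius independent of `ε`.
set_option maxHeartbeats 400000 in
theorem eventually_success (hS : S.Admissible P) {D : Measure (EuclideanSpace ℝ (Fin n))}
    {Sigma0 : Matrix (Fin n) (Fin n) ℝ} {Cm : ℝ} (hD : InitialLaw D Sigma0 Cm) {δ : ℝ}
    (hδ : 0 < δ) (M : ℝ) :
    ∀ᶠ ε : ℝ in 𝓝[>] 0, ∃ (α : ℕ → ℕ → ℝ) (r : ℕ → ℝ), (∀ h i, 0 < α h i) ∧ (∀ h, 0 < r h) ∧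
      ∀ init : ℕ → Matrix (Fin m) (Fin n) ℝ → Matrix (Fin m) (Fin n) ℝ, IsInitRule M init →
        ENNReal.ofReal (1 - δ) ≤ samplesLaw D {ω : Samples n m | S.Success D P ε
          { N := S.horizon P ε, T := S.iterations P 1 2 ε, α := α, r := r, init := init } ω} := by
  obtain ⟨b, hb, hN⟩ := exists_horizon_le hS
  obtain ⟨K, τ, hK, hτ, htol⟩ := exists_inv_tolerance_sq_le hS
  obtain ⟨α, hα, hαl, hβ0, hβ1⟩ := exists_stepsize hS hD
  have hρ := log_inv_rho_pos hS
  set β := 1 - 2 * α * lamMin S.R * lamMin Sigma0 with hβ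
  have hγ : 0 < -Real.log β := by linarith [Real.log_neg hβ0 hβ1]
  set γ := -Real.log β with hγdef
  set L := S.growth P with hL
  have hL1 : 1 ≤ L := one_le_growth
  set g := Real.log L with hg
  have hg0 : 0 ≤ g := Real.log_nonneg hL1
  set e := 2 + S.exponentBound P with he
  have he0 : 0 ≤ e := by rw [he]; unfold exponentBound; positivity
  -- `e` covers the tolerances through `rate_le`, `b * g` cancels the growth factor `L ^ N`, and `2`
  -- leaves `ε²`, enough to beat `ε/2` and the remaining constants.
  set q := e + b * g + 2 with hq
  have hq0 : 0 ≤ q := by positivity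
  have hgl := gainLip_nonneg hS
  have hD0 := initBound_nonneg (S := S) (P := P) M
  set D0 := S.initBound P M
  filter_upwards [hN, htol, eventually_log_inv_ge (max (max 1 K) (max (2 * (1 + S.gainLip P))
    (max (D0 * b / δ) (τ * (2 * q + 2) / γ))))] with ε hN htol ⟨hε, hl⟩
  set l := Real.log (1 / ε) with hldef
  simp only [max_le_iff] at hl
  obtain ⟨⟨hl1, hlK⟩, hlg, hlD, hlτ⟩ := hl
  have hεexp : ε = Real.exp (-l) := by
    rw [hldef, one_div, Real.log_inv, neg_neg, Real.exp_log hε]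
  have hlexp : l ≤ Real.exp l := (by linarith [Real.add_one_le_exp l])
  have hN1 : 1 ≤ S.horizon P ε := by rw [horizon_eq]; omega
  set N := S.horizon P ε with hNdef
  set η := Real.exp (-(q * l)) with hη
  have hη0 : 0 < η := Real.exp_pos _
  have hLN : L ^ N ≤ Real.exp (g * (b * l)) := by
    rw [← Real.log_le_iff_le_exp (by positivity), Real.log_pow, mul_comm]
    gcongr
  have hηL : η * L ^ N ≤ Real.exp (-(2 * l)) := by
    calc _ ≤ η * Real.exp (g * (b * l)) := by gcongr
      _ = Real.exp (-(e * l) + -(2 * l)) := by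
          rw [hη, ← Real.exp_add, hq]; congr 1; ring
      _ ≤ _ := by
          gcongr
          have : 0 ≤ e * l := by positivity
          linarith
  have hηN : η * L ^ N ≤ 1 := hηL.trans (Real.exp_le_one_iff.2 (by linarith))
  have hηε : η + S.gainLip P * (η * L ^ N) ≤ ε / 2 := by
    have h1 : η ≤ η * L ^ N := le_mul_of_one_le_right hη0.le (one_le_pow₀ hL1)
    have h2 : Real.exp (-(2 * l)) = ε * ε := by
      rw [hεexp, ← Real.exp_add]; congr 1; ring
    have h3 : Real.exp l * ε = 1 := by rw [hεexp, ← Real.exp_add]; simp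
    have h4 : 2 * (1 + S.gainLip P) * ε ≤ 1 :=
      (mul_le_mul_of_nonneg_right (hlg.trans hlexp) hε.le).trans h3.le
    calc _ ≤ (1 + S.gainLip P) * (η * L ^ N) := by linarith
      _ ≤ (1 + S.gainLip P) * (ε * ε) := by rw [← h2]; gcongr
      _ ≤ ε / 2 := by nlinarith
  have hηtol : ∀ h < N, η ≤ S.tolerance N ε h := by
    intro h hh
    obtain ⟨t1, -, t3⟩ := htol h hh
    have h1 : 1 / S.tolerance N ε h ^ 2 ≤ Real.exp l * Real.exp (e * l) := by
      refine t3.trans ?_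
      have := rate_le hS hε (by linarith)
      have := rate_pos (S := S) (P := P) hε
      gcongr
      exact hlK.trans hlexp
    have h2 : 1 ≤ Real.exp l * Real.exp (e * l) * S.tolerance N ε h ^ 2 := by
      rwa [div_le_iff₀ (by positivity)] at h1
    refine le_of_sq_le_sq ?_ t1.le
    calc η ^ 2 = η ^ 2 * 1 := by ring
      _ ≤ η ^ 2 * (Real.exp l * Real.exp (e * l) * S.tolerance N ε h ^ 2) := by gcongr
      _ = Real.exp (-(2 * (q * l)) + l + e * l) * S.tolerance N ε h ^ 2 := by
          rw [hη, ← Real.exp_nat_mul, Real.exp_add, Real.exp_add]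
          push_cast
          rw [mul_neg]
          ring
      _ ≤ 1 * S.tolerance N ε h ^ 2 := by
          gcongr
          rw [Real.exp_le_one_iff, hq]
          have h5 : 0 ≤ b * g * l := by positivity
          have h6 : 0 ≤ e * l := by positivity
          nlinarith
      _ = _ := one_mul _
  have hNpos : 0 < (N : ℝ) := by exact_mod_cast hN1
  have hfail : ∀ h < N, β ^ (S.iterations P 1 2 ε h) * D0 ≤ δ / N * η ^ 2 := by
    intro h hh
    obtain ⟨t1, t2, -⟩ := htol h hh
    have hT : l ^ 2 / τ ≤ S.iterations P 1 2 ε h := by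
      calc l ^ 2 / τ ≤ 1 * l ^ 2 / S.tolerance N ε h ^ 2 := by rw [one_mul]; gcongr
        _ ≤ _ := Nat.le_ceil _
    have h1 : β ^ (S.iterations P 1 2 ε h) ≤ Real.exp (-(γ * (l ^ 2 / τ))) := by
      rw [← Real.log_le_iff_le_exp (by positivity), Real.log_pow]
      have : Real.log β = -γ := by rw [hγdef, neg_neg]
      rw [this]
      linarith [mul_le_mul_of_nonneg_left hT hγ.le]
    have h2 : (2 * q + 2) * l ≤ γ * (l ^ 2 / τ) := by
      rw [div_le_iff₀ hγ] at hlτ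
      rw [mul_div_assoc', le_div_iff₀ hτ]
      linarith [mul_le_mul_of_nonneg_right hlτ (show 0 ≤ l by linarith)]
    -- The spare factor `exp (-2 l)` in the contraction pays for the initial error, the number of
    -- stages and `1/δ`.
    have h3 : D0 * N ≤ δ * Real.exp (2 * l) := by
      rw [div_le_iff₀ hδ] at hlD
      have h4 : Real.exp (2 * l) = Real.exp l * Real.exp l := by rw [← Real.exp_add]; ring_nf
      calc D0 * N ≤ D0 * (b * l) := by gcongr
        _ = (D0 * b) * l := by ring
        _ ≤ (l * δ) * l := by gcongr
        _ = δ * (l * l) := by ring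
        _ ≤ _ := by rw [h4]; gcongr
    rw [div_mul_eq_mul_div, le_div_iff₀ hNpos]
    calc _ = β ^ (S.iterations P 1 2 ε h) * (D0 * N) := by ring
      _ ≤ Real.exp (-((2 * q + 2) * l)) * (δ * Real.exp (2 * l)) := by
          gcongr
          exact h1.trans (Real.exp_le_exp.2 (by linarith))
      _ = δ * η ^ 2 := by
          rw [hη, ← Real.exp_nat_mul, mul_left_comm, ← Real.exp_add]
          congr 2
          push_cast
          ring
  refine ⟨fun _ _ => α, fun _ => 1, fun _ _ => hα, fun _ => one_pos, fun init hinit => ?_⟩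
  set π : Params n m :=
    { N := N, T := S.iterations P 1 2 ε, α := fun _ _ => α, r := fun _ => 1, init := init }
    with hπ
  have h1 := le_samplesLaw_goodSet π hS hD hinit hα (fun _ _ => rfl) (fun _ => one_pos) hαl hβ0.le
    hη0 hηN (b := δ / N) (by positivity) hfail
  have h2 : (π.N : ℝ) * (δ / N) = δ := by
    change (N : ℝ) * (δ / N) = δ
    field_simp
  rw [h2] at h1
  exact h1.trans (measure_mono fun ω hω =>
    success_of_mem_goodSet hS hD hε π rfl hη0.le hηN hηtol hηε hω)

end LQR

/-! ### A scalar family whose exponent is unbounded. -/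

namespace LQR

/-- A scalar problem with terminal cost `q`; the Riccati solution is `1` and the optimal closed
loop is `1 / 2`. -/
def scalarLQR (q : ℝ) : LQR 1 1 where
  A := 1
  B := 1
  Q := (1 / 2 : ℝ) • 1
  R := 1
  QN := q • 1

theorem norm_smul_one (c : ℝ) : ‖c • (1 : Matrix (Fin 1) (Fin 1) ℝ)‖ = |c| := by
  rw [norm_smul, norm_one, mul_one, Real.norm_eq_abs]

theorem inv_smul_one {c : ℝ} (hc : c ≠ 0) :
    (c • (1 : Matrix (Fin 1) (Fin 1) ℝ))⁻¹ = c⁻¹ • 1 := by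
  refine Matrix.inv_eq_right_inv ?_
  rw [smul_mul_smul_comm, mul_one, mul_inv_cancel₀ hc, one_smul]

variable {q : ℝ}

theorem scalarLQR_gain {p : ℝ} (hp : 0 ≤ p) :
    (scalarLQR q).gain (p • 1) = (p / (1 + p)) • 1 := by
  have h : (1 : Matrix (Fin 1) (Fin 1) ℝ) + p • 1 = (1 + p) • 1 := by rw [add_smul, one_smul]
  have h1 : 1 + p ≠ 0 := by positivity
  simp only [gain, scalarLQR, Matrix.transpose_one, Matrix.one_mul, Matrix.mul_one, h,
    inv_smul_one h1, smul_mul_smul_comm]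
  rw [div_eq_inv_mul]

theorem scalarLQR_closedLoop (k : ℝ) : (scalarLQR q).closedLoop (k • 1) = (1 - k) • 1 := by
  simp [closedLoop, scalarLQR, sub_smul]

theorem scalarLQR_costStep (k p : ℝ) :
    (scalarLQR q).costStep (k • 1) (p • 1) = ((1 - k) ^ 2 * p + k ^ 2 + 1 / 2) • 1 := by
  rw [costStep, scalarLQR_closedLoop]
  simp only [scalarLQR, Matrix.transpose_smul, Matrix.transpose_one, smul_mul_smul_comm,
    Matrix.mul_one, ← add_smul]
  congr 1
  ring

theorem scalarLQR_admissible (hq : 1 ≤ q) : (scalarLQR q).Admissible 1 where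
  posDef_Q := Matrix.PosDef.one.smul (by norm_num)
  posDef_R := Matrix.PosDef.one
  stabilizable := by
    refine ⟨1, fun z hz => ?_⟩
    have h : (scalarLQR q).closedLoop 1 = 0 := by simp [closedLoop, scalarLQR]
    rw [h, Matrix.map_zero _ Complex.ofReal_zero, spectrum.zero_eq, Set.mem_singleton_iff] at hz
    simp [hz]
  posDef_P := Matrix.PosDef.one
  are := by
    have h : (1 : Matrix (Fin 1) (Fin 1) ℝ) + 1 = (2 : ℝ) • 1 := by
      rw [two_smul]
    have h2 : (1 : Matrix (Fin 1) (Fin 1) ℝ) = (1 : ℝ) • 1 := (one_smul _ _).symm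
    simp only [IsARESolution, scalarLQR, Matrix.transpose_one, Matrix.mul_one, Matrix.one_mul, h,
      inv_smul_one two_ne_zero]
    conv_rhs => enter [1, 1]; rw [h2]
    rw [← sub_smul, ← add_smul]
    norm_num
  terminal := by
    have : (scalarLQR q).QN - 1 = (q - 1) • (1 : Matrix (Fin 1) (Fin 1) ℝ) := by
      rw [sub_smul, one_smul]; rfl
    rw [this]
    exact Matrix.PosSemidef.one.smul (sub_nonneg.2 hq)
  A_ne_zero := one_ne_zero

theorem scalarLQR_closedLoop_gain {p : ℝ} (hp : 0 ≤ p) :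
    (scalarLQR q).closedLoop ((scalarLQR q).gain (p • 1)) = (1 / (1 + p)) • 1 := by
  rw [scalarLQR_gain hp, scalarLQR_closedLoop]
  congr 1
  field_simp
  ring

theorem abs_le_inducedNorm_one (c : ℝ) :
    |c| ≤ inducedNorm 1 (c • (1 : Matrix (Fin 1) (Fin 1) ℝ)) := by
  have h := qf_mulVec_le Matrix.PosDef.one (c • (1 : Matrix (Fin 1) (Fin 1) ℝ)) (fun _ => 1)
  simp only [qf_one, Matrix.smul_mulVec, Matrix.one_mulVec, smul_dotProduct, dotProduct_smul] at h
  refine abs_le_of_sq_le_sq ?_ (inducedNorm_nonneg _ _)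
  simpa [sq, dotProduct] using h

theorem scalarLQR_half_le_rho : 1 / 2 ≤ (scalarLQR q).rho 1 := by
  have h1 : (1 : Matrix (Fin 1) (Fin 1) ℝ) = (1 : ℝ) • 1 := (one_smul _ _).symm
  have h : (scalarLQR q).closedLoop ((scalarLQR q).gain 1) = (1 / (1 + 1) : ℝ) • 1 := by
    conv_lhs => rw [h1]
    exact scalarLQR_closedLoop_gain zero_le_one
  rw [rho, h]
  refine le_trans ?_ (abs_le_inducedNorm_one _)
  norm_num

theorem scalarLQR_horizonConst_ne_zero (hq : 1 < q) : (scalarLQR q).horizonConst 1 ≠ 0 := by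
  have hS := scalarLQR_admissible hq.le
  have h1 : (scalarLQR q).QN - 1 = (q - 1) • (1 : Matrix (Fin 1) (Fin 1) ℝ) := by
    rw [sub_smul, one_smul]; rfl
  have h2 : 0 < inducedNorm 1 ((scalarLQR q).QN - 1) := by
    rw [h1]
    exact (abs_pos.2 (sub_pos.2 hq).ne').trans_le (abs_le_inducedNorm_one _)
  have h3 := norm_pos_iff.2
    (closedLoop_gain_ne_zero hS.posDef_R hS.posDef_P.posSemidef hS.A_ne_zero)
  have h4 : condNum (1 : Matrix (Fin 1) (Fin 1) ℝ) = 1 := by simp [condNum]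
  have h5 : ‖(scalarLQR q).B‖ = 1 := norm_one
  rw [horizonConst, h4, h5]
  positivity

/-- The closed loop for the cost-to-go `q` is `1 / (1 + q)`, small for large `q`. One Riccati step
later the cost-to-go is at most `3/2` for every `q`, which gives `1 / (1 + 3/2) = 2/5`. -/
theorem scalarLQR_phi_ge (hq : 1 ≤ q) {N : ℕ} (hN : 2 ≤ N) : 2 / 5 ≤ (scalarLQR q).phi N := by
  refine le_trans ?_ (le_phi _ (k := 1) hN)
  have h1 : (scalarLQR q).rde 1 = (q / (1 + q) + 1 / 2) • 1 := by
    change (scalarLQR q).costStep ((scalarLQR q).gain (q • 1)) (q • 1) = _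
    rw [scalarLQR_gain (by linarith), scalarLQR_costStep]
    congr 1
    field_simp
    ring
  have h2 : q / (1 + q) ≤ 1 := (div_le_one (by linarith)).2 (by linarith)
  have h3 : 0 ≤ q / (1 + q) := by positivity
  rw [h1, scalarLQR_closedLoop_gain (by positivity), norm_smul_one, abs_of_pos (by positivity),
    div_le_div_iff₀ (by norm_num) (by positivity)]
  linarith

theorem scalarLQR_lamMin_le : lamMin (scalarLQR q).R ≤ 1 := by
  have h := lamMin_mul_le (X := (1 : Matrix (Fin 1) (Fin 1) ℝ)) Matrix.PosSemidef.one (fun _ => 1)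
  rw [qf_one] at h
  change lamMin (1 : Matrix (Fin 1) (Fin 1) ℝ) ≤ 1
  simpa [dotProduct] using h

theorem scalarLQR_C1_ge (hq : 1 ≤ q) {N : ℕ} (hN : 2 ≤ N) : 2 / 5 ≤ (scalarLQR q).C1 N := by
  have hS := scalarLQR_admissible hq
  have h1 := scalarLQR_phi_ge hq hN
  have hl := lamMin_pos hS.posDef_R
  have h5 : ‖(scalarLQR q).B‖ = 1 := norm_one
  rw [C1, h5, mul_one, le_div_iff₀ hl]
  nlinarith [scalarLQR_lamMin_le (q := q)]

theorem scalarLQR_C2_ge (hq : 1 ≤ q) {N : ℕ} (hN : 2 ≤ N) :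
    4 / 5 * q ≤ (scalarLQR q).C2 N := by
  have hS := scalarLQR_admissible hq
  have h1 := scalarLQR_phi_ge hq hN
  have hl := lamMin_pos hS.posDef_R
  have ha := a_pos hS
  have h5 : ‖(scalarLQR q).B‖ = 1 := norm_one
  have h6 : ‖(scalarLQR q).A‖ = 1 := norm_one
  have h7 : ‖(scalarLQR q).QN + (scalarLQR q).a • (1 : Matrix (Fin 1) (Fin 1) ℝ)‖
      = q + (scalarLQR q).a := by
    change ‖q • (1 : Matrix (Fin 1) (Fin 1) ℝ) + (scalarLQR q).a • 1‖ = _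
    rw [← add_smul, norm_smul_one, abs_of_pos (by linarith)]
  rw [C2, h5, h6, h7]
  have h8 : q ≤ (q + (scalarLQR q).a) * 1 ^ 2 / lamMin (scalarLQR q).R := by
    rw [le_div_iff₀ hl]
    nlinarith [scalarLQR_lamMin_le (q := q)]
  calc 4 / 5 * q ≤ 2 * (2 / 5) * 1 * (1 + q) := by linarith
    _ ≤ _ := by gcongr

theorem scalarLQR_log_inv_rho_le (hq : 1 ≤ q) : Real.log (1 / (scalarLQR q).rho 1) ≤ 1 := by
  have hρ := rho_pos (scalarLQR_admissible hq)
  have h1 : 1 / (scalarLQR q).rho 1 ≤ 2 := by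
    rw [div_le_iff₀ hρ]
    linarith [scalarLQR_half_le_rho (q := q)]
  calc _ ≤ Real.log 2 := Real.log_le_log (by positivity) h1
    _ ≤ 1 := by linarith [Real.log_two_lt_d9]

theorem scalarLQR_realHorizon_ge (hq : 1 ≤ q) {ε : ℝ}
    (h : 0 ≤ Real.log ((scalarLQR q).horizonConst 1 / lamMin (scalarLQR q).R)
      + Real.log (1 / ε)) :
    (Real.log ((scalarLQR q).horizonConst 1 / lamMin (scalarLQR q).R) + Real.log (1 / ε)) / 2
      ≤ (scalarLQR q).realHorizon 1 ε := by
  have h1 := log_inv_rho_pos (scalarLQR_admissible hq)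
  have h2 := scalarLQR_log_inv_rho_le hq
  unfold realHorizon
  gcongr
  linarith

theorem scalarLQR_eventually_horizon (hq : 1 < q) :
    ∀ᶠ ε : ℝ in 𝓝[>] 0, 3 ≤ (scalarLQR q).horizon 1 ε := by
  filter_upwards [eventually_log_inv_ge
    (4 - Real.log ((scalarLQR q).horizonConst 1 / lamMin (scalarLQR q).R))] with ε ⟨hε, hl⟩
  have h1 := scalarLQR_realHorizon_ge hq.le (ε := ε) (by linarith)
  have h2 := realHorizon_le_horizon (scalarLQR_admissible hq.le)
    (scalarLQR_horizonConst_ne_zero hq) hε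
  have : (3 : ℝ) ≤ (scalarLQR q).horizon 1 ε := by linarith
  exact_mod_cast this

theorem scalarLQR_eventually_rate_ge (hq : 1 < q) {M : ℝ} (hM0 : 0 ≤ M)
    (hM : 2 * M ≤ Real.log (4 / 5 * q)) :
    ∀ᶠ ε : ℝ in 𝓝[>] 0, ε ^ (-M) ≤ (scalarLQR q).rate 1 ε := by
  filter_upwards [scalarLQR_eventually_horizon hq, eventually_log_inv_ge 0] with ε hN ⟨hε, hl⟩
  have h1 := log_inv_rho_pos (scalarLQR_admissible hq.le)
  have h2 := scalarLQR_log_inv_rho_le hq.le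
  refine le_trans ?_ (le_max_right _ _)
  rw [rpow_neg_eq_exp hε, rpow_neg_eq_exp hε]
  gcongr
  have h3 := Real.log_le_log (by positivity) (scalarLQR_C2_ge hq.le (show 2 ≤ _ by omega : 2 ≤
    (scalarLQR q).horizon 1 ε))
  have h4 : M ≤ Real.log ((scalarLQR q).C2 ((scalarLQR q).horizon 1 ε))
      / (2 * Real.log (1 / (scalarLQR q).rho 1)) := by
    rw [le_div_iff₀ (by positivity)]
    nlinarith
  unfold exponent
  linarith

/-- Stage `N - 1` alone suffices: its tolerance contains `C₂ ^ (N - 3)`, and `N` is at least about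
half of `log(1/ε)`, so the power is at least a constant times `ε ^ (-M)`. -/
theorem scalarLQR_eventually_budget_ge (hq : 1 < q) {M : ℝ} (hM0 : 0 ≤ M)
    (hM : 2 * M ≤ Real.log (4 / 5 * q)) {c : ℝ} (hc : 0 < c) (p : ℕ) :
    ∀ᶠ ε : ℝ in 𝓝[>] 0, ε ^ (-M) ≤ ∑ h ∈ Finset.range ((scalarLQR q).horizon 1 ε),
      ((scalarLQR q).iterations 1 c p ε h : ℝ) := by
  have hS := scalarLQR_admissible hq.le
  have hC3 := C3_pos hS
  set κ := Real.log ((scalarLQR q).horizonConst 1 / lamMin (scalarLQR q).R) with hκ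
  set b := c * (4 * (2 / 5) * (scalarLQR q).C3) * Real.exp (2 * M * (κ / 2 - 2)) with hb
  have hb0 : 0 < b := by positivity
  filter_upwards [scalarLQR_eventually_horizon hq,
    eventually_log_inv_ge (max 1 (max (4 - κ) (1 / b)))] with ε hN ⟨hε, hl⟩
  simp only [max_le_iff] at hl
  obtain ⟨hl1, hlκ, hlb⟩ := hl
  set l := Real.log (1 / ε) with hldef
  set N := (scalarLQR q).horizon 1 ε with hNdef
  have hC1 := scalarLQR_C1_ge hq.le (show 2 ≤ N by omega)
  have hC2 := scalarLQR_C2_ge hq.le (show 2 ≤ N by omega)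
  have hC2pos := C2_pos hS (show 0 < N by omega)
  set w := (scalarLQR q).C2 N ^ (N - 1 - 2) with hw
  have hw0 : 0 < w := by positivity
  have hwge : Real.exp (2 * M * ((κ + l) / 2 - 2)) ≤ w := by
    rw [← Real.le_log_iff_exp_le hw0, hw, Real.log_pow]
    have h1 := scalarLQR_realHorizon_ge hq.le (ε := ε) (by linarith)
    have h2 := realHorizon_le_horizon hS (scalarLQR_horizonConst_ne_zero hq) hε
    have h3 : (κ + l) / 2 - 2 ≤ ((N - 1 - 2 : ℕ) : ℝ) := by
      rw [Nat.sub_sub, Nat.cast_sub (by omega)]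
      push_cast
      linarith
    have h4 : 2 * M ≤ Real.log ((scalarLQR q).C2 N) :=
      hM.trans (Real.log_le_log (by positivity) hC2)
    rw [mul_comm]
    exact mul_le_mul h3 h4 (by positivity) (Nat.cast_nonneg _)
  have htol0 := (tolerance_bounds hS (B_ne_zero_of_horizonConst
    (scalarLQR_horizonConst_ne_zero hq)) (show 0 < N by omega) hε (show N - 1 ≠ 0 by omega)).1
  have hC10 : 0 < (scalarLQR q).C1 N := by linarith
  have htol : (scalarLQR q).tolerance N ε (N - 1) ^ 2
      ≤ ε / (4 * (scalarLQR q).C1 N * w * (scalarLQR q).C3) := by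
    calc _ ≤ (1 / 2 * Real.sqrt (ε / ((scalarLQR q).C1 N * w * (scalarLQR q).C3))) ^ 2 := by
          refine pow_le_pow_left₀ htol0.le ?_ 2
          rw [tolerance_of_pos _ _ (by omega)]
          exact (min_le_right _ _).trans (min_le_right _ _)
      _ = _ := by
          rw [mul_pow, Real.sq_sqrt (by positivity)]
          field_simp
          norm_num
  have hT : b * Real.exp ((M + 1) * l) ≤ (scalarLQR q).iterations 1 c p ε (N - 1) := by
    refine le_trans ?_ (Nat.le_ceil _)
    have h1 : 1 / ε = Real.exp l := (Real.exp_log (by positivity)).symm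
    calc b * Real.exp ((M + 1) * l)
        = c * (4 * (2 / 5) * (scalarLQR q).C3)
          * Real.exp (2 * M * ((κ + l) / 2 - 2)) * Real.exp l := by
          have h2 : Real.exp (2 * M * (κ / 2 - 2)) * Real.exp ((M + 1) * l)
              = Real.exp (2 * M * ((κ + l) / 2 - 2)) * Real.exp l := by
            rw [← Real.exp_add, ← Real.exp_add]
            ring_nf
          rw [hb, mul_assoc _ _ (Real.exp ((M + 1) * l)), h2, mul_assoc _ _ (Real.exp l)]
      _ ≤ c * (4 * (scalarLQR q).C1 N * (scalarLQR q).C3) * w * (1 / ε) := by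
          rw [h1]; gcongr
      _ = c * 1 / (ε / (4 * (scalarLQR q).C1 N * w * (scalarLQR q).C3)) := by
          field_simp
      _ ≤ c * l ^ p / (scalarLQR q).tolerance N ε (N - 1) ^ 2 := by
          gcongr
          exact one_le_pow₀ hl1
  have hsum : ((scalarLQR q).iterations 1 c p ε (N - 1) : ℝ)
      ≤ ∑ h ∈ Finset.range N, ((scalarLQR q).iterations 1 c p ε h : ℝ) :=
    Finset.single_le_sum (f := fun h => ((scalarLQR q).iterations 1 c p ε h : ℝ))
      (fun _ _ => Nat.cast_nonneg _) (Finset.mem_range.2 (by omega))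
  refine le_trans ?_ (hT.trans hsum)
  rw [rpow_neg_eq_exp hε]
  have h2 : Real.exp ((M + 1) * l) = Real.exp l * Real.exp (M * l) := by
    rw [← Real.exp_add]; ring_nf
  -- The factor `1/ε` in the squared inverse tolerance is not needed for the exponent and absorbs
  -- the constant `b`.
  have h3 : 1 ≤ b * Real.exp l := by
    rw [div_le_iff₀ hb0] at hlb
    nlinarith [Real.add_one_le_exp l]
  rw [h2, ← mul_assoc]
  exact le_mul_of_one_le_left (Real.exp_pos _).le h3

end LQR
end RHPG
end

theorem mainTheorem6 :
    (∀ (n m : ℕ) [NeZero n] [NeZero m] (S : RHPG.LQR n m) (P : Matrix (Fin n) (Fin n) ℝ),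
      S.Admissible P →
      ∀ (D : Measure (EuclideanSpace ℝ (Fin n))) (Sigma0 : Matrix (Fin n) (Fin n) ℝ) (Cm : ℝ),
      RHPG.InitialLaw D Sigma0 Cm →
      ∀ δ : ℝ, 0 < δ → δ < 1 → ∀ M : ℝ,
      ∃ (c C : ℝ) (p q : ℕ), 0 < c ∧ 0 < C ∧
        ∀ᶠ ε : ℝ in 𝓝[>] 0,
          (∃ (α : ℕ → ℕ → ℝ) (r : ℕ → ℝ), (∀ h i, 0 < α h i) ∧ (∀ h, 0 < r h) ∧
            ∀ init : ℕ → Matrix (Fin m) (Fin n) ℝ → Matrix (Fin m) (Fin n) ℝ,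
              RHPG.IsInitRule M init →
              ENNReal.ofReal (1 - δ) ≤ RHPG.samplesLaw D
                {ω : RHPG.Samples n m | S.Success D P ε
                  { N := S.horizon P ε, T := S.iterations P c p ε,
                    α := α, r := r, init := init } ω}) ∧
          ∑ h ∈ Finset.range (S.horizon P ε), (S.iterations P c p ε h : ℝ)
            ≤ C * Real.log (1 / ε) ^ q * S.rate P ε) ∧
    (∀ M : ℝ, ∃ (n m : ℕ) (S : RHPG.LQR n m) (P : Matrix (Fin n) (Fin n) ℝ),
      S.Admissible P ∧ IsUnit S.A.det ∧ S.B ≠ 0 ∧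
      (∀ᶠ ε : ℝ in 𝓝[>] 0, ε ^ (-M) ≤ S.rate P ε) ∧
      ∀ (c : ℝ) (p : ℕ), 0 < c → ∀ᶠ ε : ℝ in 𝓝[>] 0,
        ε ^ (-M) ≤ ∑ h ∈ Finset.range (S.horizon P ε), (S.iterations P c p ε h : ℝ)) := by
  refine ⟨fun n m _ _ S P hS D Sigma0 Cm hD δ hδ _ M => ?_, fun M => ?_⟩
  · obtain ⟨C, hC, hsum⟩ := RHPG.LQR.exists_sum_iterations_le hS
    refine ⟨1, C, 2, 3, one_pos, hC, ?_⟩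
    filter_upwards [RHPG.LQR.eventually_success hS hD hδ M, hsum] with ε h1 h2
    exact ⟨h1, h2⟩
  -- Chosen so that the lower bound `4 / 5 * q` for `C₂` has logarithm exactly `2 * |M|`; the
  -- absolute value reduces negative `M` to the nonnegative case.
  · set q := 5 / 4 * Real.exp (2 * |M|) with hq
    have hq1 : 1 < q := by
      have := Real.one_le_exp (show 0 ≤ 2 * |M| by positivity)
      linarith
    have hM : 2 * |M| ≤ Real.log (4 / 5 * q) := by
      rw [hq, ← mul_assoc]
      norm_num
    have hle : ∀ᶠ ε : ℝ in 𝓝[>] 0, ε ^ (-M) ≤ ε ^ (-|M|) := by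
      filter_upwards [RHPG.LQR.eventually_log_inv_ge 0] with ε ⟨hε, hl⟩
      rw [RHPG.LQR.rpow_neg_eq_exp hε, RHPG.LQR.rpow_neg_eq_exp hε]
      gcongr
      exact le_abs_self M
    refine ⟨1, 1, RHPG.LQR.scalarLQR q, 1, RHPG.LQR.scalarLQR_admissible hq1.le, ?_, ?_, ?_, ?_⟩
    · simp [RHPG.LQR.scalarLQR]
    · exact one_ne_zero
    · filter_upwards [hle, RHPG.LQR.scalarLQR_eventually_rate_ge hq1 (abs_nonneg M) hM]
        with ε h1 h2
      exact h1.trans h2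
    · intro c p hc
      filter_upwards [hle, RHPG.LQR.scalarLQR_eventually_budget_ge hq1 (abs_nonneg M) hM hc p]
        with ε h1 h2
      exact h1.trans h2
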